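/- Let $c_1, c_2 \ge 1$ be integer constants. For a string $x$ of length $n$, let the parameterized alphabet be $\Pi = \{0,\dots,n^{c_1}\}$ and the static alphabet be $\Sigma = \{n^{c_1}+1,\dots,n^{c_2}\}$; a p-string is a string over $\Pi\cup\Sigma$. The prev encoding $\mathit{prev}(y)$ of a p-string $y$ keeps every symbol of $\Sigma$ and replaces every symbol of $\Pi$ by the distance to its previous occurrence in $y$, or by $0$ if there is none. The parameterized suffix array of a p-string $x$ of length $n$ is the array $\mathit{PSA}[1..n]$ such that $\mathit{PSA}[i]=j$ if and only if $\mathit{prev}(x[j..n])$ is the $i$th lexicographically smallest string in $\{\mathit{prev}(x[1..n]),\dots,\mathit{prev}(x[n..n])\}$, where symbols are compared as integers and a proper prefix of a string is smaller than the string. There are a word RAM program (unit-cost addition, truncated subtraction, multiplication, integer division and remainder, comparison, and indirect memory access) and a constant $k \ge \max(c_1,c_2)$, both depending only on $c_1$ and $c_2$, such that for every $n \ge 0$ and every p-string $x$ of length $n$, on input $x$ and with any word size $w$ satisfying $2^w \ge (n+2)^k$ (so $w = \Theta(\log (n+2))$ bits suffice), the program computes the parameterized suffix array of $x$ in $O(n\cdot\max(1,\pi)+1)$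 time and $O(n+1)$ words of space (including input and output), where $\pi$ is the number of distinct symbols of $\Pi$ that occur in $x$. The constants hidden in the $O$-notation depend only on $c_1$ and $c_2$. In particular, for $n,\pi\ge 1$ the time is $O(n\pi)$ and the space is $O(n)$. -/

import Mathlib

/-! ### Parameterized strings -/

namespace PString

/-- The parameterized alphabet `Π = {0, …, n ^ c₁}`. -/
def paramAlphabet (n c₁ : ℕ) : Finset ℕ := Finset.Icc 0 (n ^ c₁)

/-- The static alphabet `Σ = {n ^ c₁ + 1, …, n ^ c₂}` (empty if `n ^ c₂ ≤ n ^ c₁`). -/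
def staticAlphabet (n c₁ c₂ : ℕ) : Finset ℕ := Finset.Icc (n ^ c₁ + 1) (n ^ c₂)

/-- The positions (counted from `0`) before position `i` at which `x` has the symbol `a`. -/
def earlier (x : List ℕ) (i a : ℕ) : Finset ℕ :=
  (Finset.range i).filter fun j => x[j]? = some a

/-- The prev encoding of `x` for the parameterized alphabet `P`: a symbol outside `P` is kept; a
symbol of `P` is replaced by the distance to its previous occurrence in `x`, or by `0` if there is
none. -/
def prev (P : Finset ℕ) (x : List ℕ) : List ℕ :=
  x.mapIdx fun i a =>
    if a ∈ P then
      if h : (earlier x i a).Nonempty then i - (earlier x i a).max' h else 0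
    else a

/-- The suffix `x[j..n]` of a string of length `n`, where `1 ≤ j ≤ n` (positions start at `1`). -/
def suffixFrom (x : List ℕ) (j : ℕ) : List ℕ := x.drop (j - 1)

/-- The set `{prev(x[j..n]) | j = 1, …, n}`. -/
def prevSuffixes (P : Finset ℕ) (x : List ℕ) : Finset (List ℕ) :=
  (Finset.Icc 1 x.length).image fun j => prev P (suffixFrom x j)

/-- `u` is the `i`-th smallest element (`i` starts at `1`) of a finite set of strings, in the
lexicographic order induced by the order of the integers, in which a proper prefix is smaller. -/
def IsNthSmallest (U : Finset (List ℕ)) (i : ℕ) (u : List ℕ) : Prop :=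
  u ∈ U ∧ (U.filter fun v => v < u).card + 1 = i

/-- The entries `A 1, …, A n` form the parameterized suffix array of `x`, where `n` is the length
of `x` and `P` is the parameterized alphabet. -/
def IsPSA (P : Finset ℕ) (x : List ℕ) (A : ℕ → ℕ) : Prop :=
  ∀ i ∈ Finset.Icc 1 x.length, ∀ j,
    A i = j ↔
      j ∈ Finset.Icc 1 x.length ∧ IsNthSmallest (prevSuffixes P x) i (prev P (suffixFrom x j))

/-- The number `π` of distinct parameterized symbols that occur in `x`. -/
def numParams (P : Finset ℕ) (x : List ℕ) : ℕ := (x.toFinset ∩ P).card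

end PString

/-! ### The word RAM

A machine with word size `w` and `S` memory cells.  A program names finitely many registers; every
register and every memory cell holds one word, an integer in `[0, 2 ^ w)`.  Every instruction and
every test costs one step.  An execution that computes a number that does not fit into a word, or
that accesses a memory cell with an address `≥ S`, has no result. -/

namespace WordRAM

/-- Arithmetic operations; subtraction is truncated at `0`, division rounds down. -/
inductive Op where
  | add | sub | mul | div | mod

/-- The result of an arithmetic operation, as an unbounded natural number. -/
def Op.eval : Op → ℕ → ℕ → ℕ
  | .add, a, b => a + b
  | .sub, a, b => a - b
  | .mul, a, b => a * b
  | .div, a, b => a / b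
  | .mod, a, b => a % b

/-- Comparisons of two registers. -/
inductive Test where
  | eq (a b : ℕ)
  | lt (a b : ℕ)

/-- Programs. The numbers `r`, `a`, `b` are names of registers. -/
inductive Cmd where
  /-- do nothing -/
  | skip
  /-- `r := k` -/
  | const (r k : ℕ)
  /-- `r := a` -/
  | move (r a : ℕ)
  /-- `r := a o b` -/
  | op (o : Op) (r a b : ℕ)
  /-- `r := memory[a]` -/
  | load (r a : ℕ)
  /-- `memory[a] := r` -/
  | store (a r : ℕ)
  /-- `c; d` -/
  | seq (c d : Cmd)
  /-- `if q then c else d` -/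
  | ite (q : Test) (c d : Cmd)
  /-- `while q do c` -/
  | loop (q : Test) (c : Cmd)

/-- The contents of the registers and of the memory. -/
structure State where
  reg : ℕ → ℕ
  mem : ℕ → ℕ

/-- Write the word `v` to the register `r`. -/
def State.setReg (s : State) (r v : ℕ) : State := { s with reg := Function.update s.reg r v }

/-- Write the word `v` to the memory cell `i`. -/
def State.setMem (s : State) (i v : ℕ) : State := { s with mem := Function.update s.mem i v }

/-- The truth of a comparison. -/
def Test.Holds (s : State) : Test → Prop
  | .eq a b => s.reg a = s.reg b
  | .lt a b => s.reg a < s.reg b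

/-- `Exec w S c s t s'`: with word size `w` and `S` memory cells, the program `c`, started in the
state `s`, halts after exactly `t` steps in the state `s'`. -/
inductive Exec (w S : ℕ) : Cmd → State → ℕ → State → Prop where
  | skip (s : State) : Exec w S .skip s 1 s
  | const (s : State) (r k : ℕ) : k < 2 ^ w → Exec w S (.const r k) s 1 (s.setReg r k)
  | move (s : State) (r a : ℕ) : Exec w S (.move r a) s 1 (s.setReg r (s.reg a))
  | op (s : State) (o : Op) (r a b : ℕ) : o.eval (s.reg a) (s.reg b) < 2 ^ w →
      Exec w S (.op o r a b) s 1 (s.setReg r (o.eval (s.reg a) (s.reg b)))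
  | load (s : State) (r a : ℕ) : s.reg a < S →
      Exec w S (.load r a) s 1 (s.setReg r (s.mem (s.reg a)))
  | store (s : State) (a r : ℕ) : s.reg a < S →
      Exec w S (.store a r) s 1 (s.setMem (s.reg a) (s.reg r))
  | seq {c d : Cmd} {s₀ s₁ s₂ : State} {t₁ t₂ : ℕ} :
      Exec w S c s₀ t₁ s₁ → Exec w S d s₁ t₂ s₂ → Exec w S (.seq c d) s₀ (t₁ + t₂) s₂
  | ite_true {q : Test} {c d : Cmd} {s s' : State} {t : ℕ} :
      q.Holds s → Exec w S c s t s' → Exec w S (.ite q c d) s (t + 1) s'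
  | ite_false {q : Test} {c d : Cmd} {s s' : State} {t : ℕ} :
      ¬ q.Holds s → Exec w S d s t s' → Exec w S (.ite q c d) s (t + 1) s'
  | loop_done {q : Test} {c : Cmd} {s : State} :
      ¬ q.Holds s → Exec w S (.loop q c) s 1 s
  | loop_step {q : Test} {c : Cmd} {s₀ s₁ s₂ : State} {t₁ t₂ : ℕ} :
      q.Holds s₀ → Exec w S c s₀ t₁ s₁ → Exec w S (.loop q c) s₁ t₂ s₂ →
      Exec w S (.loop q c) s₀ (t₁ + t₂ + 1) s₂

/-- The initial state for the input string `x` of length `n`: register `0` holds `n`, the memory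
cells `1, …, n` hold the symbols of `x`, and everything else is `0`. -/
def initial (x : List ℕ) : State where
  reg := fun r => if r = 0 then x.length else 0
  mem := fun i => if i = 0 then 0 else x.getD (i - 1) 0

end WordRAM

set_option linter.constructorNameAsVariable false

/-! Scan a suffix `x[i..n]` from left to right and let `r` be the number of distinct parameterized
symbols met so far. Give each position `j` a threshold `e j`, independent of `i`: if the symbol at
`j` is parameterized and last occurred at `p`, let `e j` be the number of distinct parameterized
symbols in `x[p..j-1]`; let it be `n + 2`, in effect infinity, if there is no earlier occurrence,
and `0` for a static symbol. The symbol at `j` is the first of its kind in the suffix exactly when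
`r < e j` (`CodeAt.lt_iff`): if `p` lies inside the suffix, everything counted by `e j` has been
counted by `r`; if `p` lies before it, `e j` counts everything that `r` does and also the symbol
itself. In the first case of the test the encoding has a `0` and `r` grows by one, otherwise it
agrees with `prev(x)` at `j`. So what remains of an encoded suffix depends only on the current
position and on `r`; this is `layer`.

Let layer `r` consist of these strings for all starting positions. Up to its first zero, such a
string is a piece of `prev(x)`; after that zero there follows a string of layer `r + 1`. If the
ranks in layer `r + 1` are known, the zero together with everything behind it can be replaced by one
symbol, namely such a rank. Layer `r` is then ordered like the ordinary suffixes of one ordinary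
string (`layerString_lt`, `sufRank_layer`). No information is lost by keeping the text behind the
substituted symbol: equal ranks mean equal strings, hence equal lengths, hence equal positions. For
`r = π`, a position with `r < e j` is a first occurrence in all of `x`, where `prev(x)` is `0`
already, so that layer consists of the suffixes of `prev(x)` (`sufRank_base`). Layer `0` is the
family of encoded suffixes (`layer_zero`). Thus `π + 1` linear-time suffix sortings suffice.

The thresholds come from a table of at most `π` symbols with their last positions, scanned twice per
position, in total time `O(n·max(1,π))`. Static symbols are polynomially large; a radix sort with a
constant number of digits in base `n + 2` replaces them by ranks, shifted by `n` above all
distances.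

Ordinary suffixes are sorted by a difference cover modulo 3. Instead of merging, the rank of a
suffix is obtained by inclusion and exclusion from its ranks within two classes of residues that
cover everything and within their intersection (`classRank_add`, `sufRank_eq`). The recursion runs
on an explicit stack of linear total size (`totalLen_le`).

On the machine side, a small structured language with variables, arrays and expressions is compiled
to the word RAM, and `Reach` is a total-correctness judgement with a time bound. Everything else is
proved in that language. -/

namespace WordRAM

/-! ### A structured language with named variables and arrays, compiled to the word RAM -/

/-- The names of the arrays. -/
inductive Arr where
  | key | perm | buf | cnt | fst | snd | rnk
  | str | lens | bases | srk | smp | rA | rB | rC | dA | dB | dC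
  | txt | cod | exi | sym | last | srt
  deriving DecidableEq

/-- The names of the variables. -/
inductive Var where
  | size
  | i | m | kb | acc | tmp | cur
  | b | len | dep | c
  | j | t | cnt | th | f | q | d | lay
  deriving DecidableEq

/-- Arrays of level `0` are scratch space for ranking, those of level `1` for suffix sorting. -/
def Arr.level : Arr → ℕ
  | .key | .perm | .buf | .cnt | .fst | .snd | .rnk => 0
  | .str | .lens | .bases | .srk | .smp | .rA | .rB | .rC | .dA | .dB | .dC => 1
  | _ => 2

/-- Variables of level `0` are scratch space for ranking, those of level `1` for suffix sorting. -/
def Var.level : Var → ℕ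
  | .i | .m | .kb | .acc | .tmp | .cur => 0
  | .b | .len | .dep | .c => 1
  | _ => 2

def Arr.idx (a : Arr) : ℕ := a.ctorIdx

def Var.idx (r : Var) : ℕ := r.ctorIdx

theorem Arr.idx_lt (a : Arr) : a.idx < 32 := by cases a <;> decide

theorem Arr.idx_inj {a b : Arr} (h : a.idx = b.idx) : a = b := by
  have h' := congrArg Arr.ofNat h
  simpa [Arr.idx, Arr.ofNat_ctorIdx] using h'

theorem Var.idx_inj {a b : Var} (h : a.idx = b.idx) : a = b := by
  have h' := congrArg Var.ofNat h
  simpa [Var.idx, Var.ofNat_ctorIdx] using h'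

/-- Variables, arrays, and the input and output cells. -/
structure Store where
  v : Var → ℕ
  arr : Arr → ℕ → ℕ
  io : ℕ → ℕ

def Store.setV (h : Store) (r : Var) (x : ℕ) : Store := { h with v := Function.update h.v r x }

def Store.setA (h : Store) (a : Arr) (f : ℕ → ℕ) : Store :=
  { h with arr := Function.update h.arr a f }

def Store.setCell (h : Store) (k x : ℕ) : Store := { h with io := Function.update h.io k x }

/-- The parameters of a machine: word size `w`, memory size `S`, size `n` of the input region,
bound `L` for array indices, and bound `B` for computed numbers. -/
structure Machine where
  (w S n L B : ℕ)
  space : n + 1 + 32 * L ≤ S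
  addr : n + 33 + 32 * L ≤ B
  word : B ≤ 2 ^ w

/-- Register `1` holds `n`, the even registers hold the variables, and the arrays are interleaved
in the memory after the input cells. -/
structure Rep (n : ℕ) (h : Store) (s : State) : Prop where
  len : s.reg 1 = n
  var : ∀ r : Var, s.reg (2 * r.idx) = h.v r
  io : ∀ i ≤ n, s.mem i = h.io i
  arr : ∀ (a : Arr) (i : ℕ), s.mem (n + 1 + (32 * i + a.idx)) = h.arr a i

/-! ### Expressions and their compilation -/

inductive Expr where
  | lit (k : ℕ)
  | var (r : Var)
  | bin (o : Op) (e f : Expr)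
  | get (a : Arr) (e : Expr)
  | inp (e : Expr)
  | ifLt (e f a b : Expr)
  | ifEq (e f a b : Expr)

namespace Expr

def eval (h : Store) : Expr → ℕ
  | lit k => k
  | var r => h.v r
  | bin o e f => o.eval (e.eval h) (f.eval h)
  | get a e => h.arr a (e.eval h)
  | inp e => h.io (e.eval h)
  | ifLt e f a b => if e.eval h < f.eval h then a.eval h else b.eval h
  | ifEq e f a b => if e.eval h = f.eval h then a.eval h else b.eval h

/-- No overflow and no access out of bounds. -/
def Ok (M : Machine) (h : Store) : Expr → Prop
  | lit k => k < M.B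
  | var _ => True
  | bin o e f => e.Ok M h ∧ f.Ok M h ∧ o.eval (e.eval h) (f.eval h) < M.B
  | get _ e => e.Ok M h ∧ e.eval h < M.L
  | inp e => e.Ok M h ∧ e.eval h ≤ M.n
  | ifLt e f a b => e.Ok M h ∧ f.Ok M h ∧ (e.eval h < f.eval h → a.Ok M h) ∧
      (¬ e.eval h < f.eval h → b.Ok M h)
  | ifEq e f a b => e.Ok M h ∧ f.Ok M h ∧ (e.eval h = f.eval h → a.Ok M h) ∧
      (¬ e.eval h = f.eval h → b.Ok M h)

/-- An upper bound that does not depend on the store: both branches of a conditional are charged.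
The 6 for an array access is five instructions for the address and the load. -/
def cost : Expr → ℕ
  | lit _ => 1
  | var _ => 1
  | bin _ e f => e.cost + f.cost + 1
  | get _ e => e.cost + 6
  | inp e => e.cost + 1
  | ifLt e f a b => e.cost + f.cost + a.cost + b.cost + 1
  | ifEq e f a b => e.cost + f.cost + a.cost + b.cost + 1

end Expr

/-- The register for temporary values at depth `d`. -/
def tmp (d : ℕ) : ℕ := 2 * d + 3

/-- Turn the index in `tmp d` into the address of a cell of the array `a`. -/
def addrCmd (a : Arr) (d : ℕ) : Cmd :=
  .seq (.const (tmp (d + 1)) 32) (.seq (.op .mul (tmp d) (tmp d) (tmp (d + 1)))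
    (.seq (.const (tmp (d + 1)) (a.idx + 1)) (.seq (.op .add (tmp d) (tmp d) (tmp (d + 1)))
      (.op .add (tmp d) (tmp d) 1))))

/-- Evaluate an expression into the register `tmp d`. -/
def Expr.comp : Expr → ℕ → Cmd
  | lit k, d => .const (tmp d) k
  | var r, d => .move (tmp d) (2 * r.idx)
  | bin o e f, d => .seq (e.comp d) (.seq (f.comp (d + 1)) (.op o (tmp d) (tmp d) (tmp (d + 1))))
  | get a e, d => .seq (e.comp d) (.seq (addrCmd a d) (.load (tmp d) (tmp d)))
  | inp e, d => .seq (e.comp d) (.load (tmp d) (tmp d))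
  | ifLt e f a b, d => .seq (e.comp d) (.seq (f.comp (d + 1))
      (.ite (.lt (tmp d) (tmp (d + 1))) (a.comp d) (b.comp d)))
  | ifEq e f a b, d => .seq (e.comp d) (.seq (f.comp (d + 1))
      (.ite (.eq (tmp d) (tmp (d + 1))) (a.comp d) (b.comp d)))

/-- Variables live in even registers and temporaries in odd registers from 3 on, so the evaluation
of an expression cannot disturb the represented store. -/
theorem Rep.of_frame {n : ℕ} {h : Store} {s s' : State} {d : ℕ} (hr : Rep n h s)
    (hm : s'.mem = s.mem) (hf : ∀ r, r % 2 = 0 ∨ r < tmp d → s'.reg r = s.reg r) : Rep n h s' where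
  len := by rw [hf 1 (Or.inr (by unfold tmp; omega)), hr.len]
  var r := by rw [hf _ (Or.inl (by omega)), hr.var]
  io i hi := by rw [hm, hr.io i hi]
  arr a i := by rw [hm, hr.arr a i]

theorem addrCmd_exec (M : Machine) (a : Arr) (d : ℕ) (s : State) (hn : s.reg 1 = M.n)
    (hi : s.reg (tmp d) < M.L) :
    ∃ s', Exec M.w M.S (addrCmd a d) s 5 s' ∧
      s'.reg (tmp d) = M.n + 1 + (32 * s.reg (tmp d) + a.idx) ∧ s'.mem = s.mem ∧
      ∀ r, r % 2 = 0 ∨ r < tmp d → s'.reg r = s.reg r := by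
  have h1 := M.addr
  have h2 := M.word
  have h3 := a.idx_lt
  have h4 : tmp (d + 1) ≠ tmp d := by unfold tmp; omega
  have h5 : tmp d ≠ tmp (d + 1) := h4.symm
  have h6 : (1 : ℕ) ≠ tmp d := by unfold tmp; omega
  have h7 : (1 : ℕ) ≠ tmp (d + 1) := by unfold tmp; omega
  refine ⟨_, Exec.seq (Exec.const _ _ _ ?_) (Exec.seq (Exec.op _ _ _ _ _ ?_)
    (Exec.seq (Exec.const _ _ _ ?_) (Exec.seq (Exec.op _ _ _ _ _ ?_) (Exec.op _ _ _ _ _ ?_)))),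
    ?_, rfl, ?_⟩
  · omega
  · simp [State.setReg, h5, Op.eval]; omega
  · omega
  · simp [State.setReg, h5, Op.eval]; omega
  · simp [State.setReg, h5, h6, h7, hn, Op.eval]; omega
  · simp [State.setReg, h5, h6, h7, hn, Op.eval]; omega
  · intro r hr
    have h8 : r ≠ tmp d := by unfold tmp at *; omega
    have h9 : r ≠ tmp (d + 1) := by unfold tmp at *; omega
    simp [State.setReg, h8, h9]

/-- Structural induction. The last clause, that registers below `tmp d` survive, is what keeps the
value of a left operand intact while the right operand is evaluated one register deeper. -/
theorem Expr.comp_exec (M : Machine) (h : Store) (e : Expr) : ∀ (d : ℕ) (s : State),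
    Rep M.n h s → e.Ok M h →
    ∃ t s', Exec M.w M.S (e.comp d) s t s' ∧ t ≤ e.cost ∧ s'.reg (tmp d) = e.eval h ∧
      s'.mem = s.mem ∧ ∀ r, r % 2 = 0 ∨ r < tmp d → s'.reg r = s.reg r := by
  have hB := M.word
  have hlt : ∀ d, tmp d < tmp (d + 1) := fun d => by unfold tmp; omega
  have set_frame : ∀ (s : State) (d x r : ℕ), r % 2 = 0 ∨ r < tmp d →
      (s.setReg (tmp d) x).reg r = s.reg r := by
    intro s d x r hr
    have : r ≠ tmp d := by unfold tmp at *; omega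
    simp [State.setReg, this]
  -- Both conditionals compile to the same shape with different tests; this treats them together,
  -- with the induction hypotheses as arguments.
  have branch : ∀ (q : Test) (d : ℕ) (s : State) (e f a b : Expr) (P : Prop) [Decidable P],
      (∀ d s, Rep M.n h s → e.Ok M h → ∃ t s', Exec M.w M.S (e.comp d) s t s' ∧ t ≤ e.cost ∧
        s'.reg (tmp d) = e.eval h ∧ s'.mem = s.mem ∧
        ∀ r, r % 2 = 0 ∨ r < tmp d → s'.reg r = s.reg r) →
      (∀ d s, Rep M.n h s → f.Ok M h → ∃ t s', Exec M.w M.S (f.comp d) s t s' ∧ t ≤ f.cost ∧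
        s'.reg (tmp d) = f.eval h ∧ s'.mem = s.mem ∧
        ∀ r, r % 2 = 0 ∨ r < tmp d → s'.reg r = s.reg r) →
      (∀ d s, Rep M.n h s → a.Ok M h → ∃ t s', Exec M.w M.S (a.comp d) s t s' ∧ t ≤ a.cost ∧
        s'.reg (tmp d) = a.eval h ∧ s'.mem = s.mem ∧
        ∀ r, r % 2 = 0 ∨ r < tmp d → s'.reg r = s.reg r) →
      (∀ d s, Rep M.n h s → b.Ok M h → ∃ t s', Exec M.w M.S (b.comp d) s t s' ∧ t ≤ b.cost ∧
        s'.reg (tmp d) = b.eval h ∧ s'.mem = s.mem ∧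
        ∀ r, r % 2 = 0 ∨ r < tmp d → s'.reg r = s.reg r) →
      Rep M.n h s → e.Ok M h → f.Ok M h → (P → a.Ok M h) → (¬ P → b.Ok M h) →
      (∀ s, s.reg (tmp d) = e.eval h → s.reg (tmp (d + 1)) = f.eval h → (q.Holds s ↔ P)) →
      ∃ t s', Exec M.w M.S (.seq (e.comp d) (.seq (f.comp (d + 1))
          (.ite q (a.comp d) (b.comp d)))) s t s' ∧
        t ≤ e.cost + f.cost + a.cost + b.cost + 1 ∧
        s'.reg (tmp d) = (if P then a.eval h else b.eval h) ∧ s'.mem = s.mem ∧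
        ∀ r, r % 2 = 0 ∨ r < tmp d → s'.reg r = s.reg r := by
    intro q d s e f a b P _ ihe ihf iha ihb hr he hf ha hb hq
    obtain ⟨t1, s1, x1, c1, v1, m1, f1⟩ := ihe d s hr he
    obtain ⟨t2, s2, x2, c2, v2, m2, f2⟩ := ihf (d + 1) s1 (hr.of_frame m1 f1) hf
    have hr2 := (hr.of_frame m1 f1).of_frame m2 f2
    have hd : s2.reg (tmp d) = e.eval h := by rw [f2 _ (Or.inr (hlt d)), v1]
    by_cases hP : P
    · obtain ⟨t3, s3, x3, c3, v3, m3, f3⟩ := iha d s2 hr2 (ha hP)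
      refine ⟨_, s3, x1.seq (x2.seq (Exec.ite_true ((hq s2 hd v2).2 hP) x3)), by omega,
        by simp [hP, v3], by rw [m3, m2, m1], fun r hr => ?_⟩
      rw [f3 r hr, f2 r (hr.imp_right fun h => h.trans (hlt d)), f1 r hr]
    · obtain ⟨t3, s3, x3, c3, v3, m3, f3⟩ := ihb d s2 hr2 (hb hP)
      refine ⟨_, s3, x1.seq (x2.seq (Exec.ite_false (fun hc => hP ((hq s2 hd v2).1 hc)) x3)),
        by omega, by simp [hP, v3], by rw [m3, m2, m1], fun r hr => ?_⟩
      rw [f3 r hr, f2 r (hr.imp_right fun h => h.trans (hlt d)), f1 r hr]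
  induction e with
  | lit k =>
    intro d s _ hk
    refine ⟨1, _, Exec.const _ _ _ (lt_of_lt_of_le hk hB), le_rfl, ?_, rfl, set_frame s d k⟩
    simp [State.setReg, eval]
  | var r =>
    intro d s hr _
    refine ⟨1, _, Exec.move _ _ _, le_rfl, ?_, rfl, set_frame s d _⟩
    simp [State.setReg, eval, hr.var]
  | bin o e f ihe ihf =>
    intro d s hr ⟨he, hf, ho⟩
    obtain ⟨t1, s1, x1, c1, v1, m1, f1⟩ := ihe d s hr he
    obtain ⟨t2, s2, x2, c2, v2, m2, f2⟩ := ihf (d + 1) s1 (hr.of_frame m1 f1) hf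
    have hd : s2.reg (tmp d) = e.eval h := by rw [f2 _ (Or.inr (hlt d)), v1]
    refine ⟨_, _, x1.seq (x2.seq (Exec.op _ _ _ _ _ ?_)), by simp only [cost]; omega, ?_, ?_, ?_⟩
    · rw [hd, v2]; omega
    · simp [State.setReg, hd, v2, eval]
    · simp [State.setReg, m1, m2]
    · intro r hr
      rw [set_frame _ _ _ _ hr, f2 r (hr.imp_right fun h => h.trans (hlt d)), f1 r hr]
  | get a e ihe =>
    intro d s hr ⟨he, hL⟩
    obtain ⟨t1, s1, x1, c1, v1, m1, f1⟩ := ihe d s hr he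
    have hr1 := hr.of_frame m1 f1
    obtain ⟨s2, x2, v2, m2, f2⟩ := addrCmd_exec M a d s1 hr1.len (by rw [v1]; exact hL)
    have hsp := M.space
    have hai := a.idx_lt
    have hv2 : s2.reg (tmp d) = M.n + 1 + (32 * e.eval h + a.idx) := by rw [v2, v1]
    refine ⟨_, _, x1.seq (x2.seq (Exec.load _ _ _ ?_)), by simp only [cost]; omega, ?_, ?_, ?_⟩
    · rw [hv2]; omega
    · rw [hv2]; simp [State.setReg, eval, m2, hr1.arr]
    · simp [State.setReg, m1, m2]
    · intro r hr
      rw [set_frame _ _ _ _ hr, f2 r hr, f1 r hr]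
  | inp e ihe =>
    intro d s hr ⟨he, hL⟩
    obtain ⟨t1, s1, x1, c1, v1, m1, f1⟩ := ihe d s hr he
    have hsp := M.space
    refine ⟨_, _, x1.seq (Exec.load _ _ _ ?_), by simp only [cost]; omega, ?_, ?_, ?_⟩
    · rw [v1]; omega
    · simp [State.setReg, eval, v1, m1, hr.io _ hL]
    · simp [State.setReg, m1]
    · intro r hr
      rw [set_frame _ _ _ _ hr, f1 r hr]
  | ifLt e f a b ihe ihf iha ihb =>
    intro d s hr ⟨he, hf, ha, hb⟩
    exact branch _ d s e f a b (e.eval h < f.eval h) ihe ihf iha ihb hr he hf ha hb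
      fun s h1 h2 => by simp [Test.Holds, h1, h2]
  | ifEq e f a b ihe ihf iha ihb =>
    intro d s hr ⟨he, hf, ha, hb⟩
    exact branch _ d s e f a b (e.eval h = f.eval h) ihe ihf iha ihb hr he hf ha hb
      fun s h1 h2 => by simp [Test.Holds, h1, h2]

/-! ### Programs and their compilation -/

inductive Prog where
  | skip
  | set (r : Var) (e : Expr)
  | put (a : Arr) (e f : Expr)
  | out (e f : Expr)
  | seq (p q : Prog)
  | ifLt (e f : Expr) (p q : Prog)
  | ifEq (e f : Expr) (p q : Prog)
  | whileLt (e f : Expr) (p : Prog)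

/-- The machine's loop test only compares two registers, so the two sides of a guard are evaluated
before the loop and again at the end of each iteration. -/
def Prog.comp : Prog → Cmd
  | skip => .skip
  | set r e => .seq (e.comp 0) (.move (2 * r.idx) (tmp 0))
  | put a e f => .seq (e.comp 0) (.seq (addrCmd a 0) (.seq (f.comp 1) (.store (tmp 0) (tmp 1))))
  | out e f => .seq (e.comp 0) (.seq (f.comp 1) (.store (tmp 0) (tmp 1)))
  | seq p q => .seq p.comp q.comp
  | ifLt e f p q => .seq (e.comp 0) (.seq (f.comp 1) (.ite (.lt (tmp 0) (tmp 1)) p.comp q.comp))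
  | ifEq e f p q => .seq (e.comp 0) (.seq (f.comp 1) (.ite (.eq (tmp 0) (tmp 1)) p.comp q.comp))
  | whileLt e f p => .seq (.seq (e.comp 0) (f.comp 1))
      (.loop (.lt (tmp 0) (tmp 1)) (.seq p.comp (.seq (e.comp 0) (f.comp 1))))

/-! ### Total correctness with time bounds -/

/-- From the store `h`, the program `p` halts within `T` steps in a store that satisfies `Q`. -/
def Reach (M : Machine) (p : Prog) (T : ℕ) (h : Store) (Q : Store → Prop) : Prop :=
  ∀ s, Rep M.n h s → ∃ t s', Exec M.w M.S p.comp s t s' ∧ t ≤ T ∧ ∃ h', Rep M.n h' s' ∧ Q h'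

namespace Reach

variable {M : Machine} {p q : Prog} {T T' : ℕ} {h : Store} {Q Q' : Store → Prop}

theorem mono (hp : Reach M p T h Q) (hT : T ≤ T') (hQ : ∀ g, Q g → Q' g) : Reach M p T' h Q' := by
  intro s hs
  obtain ⟨t, s', x, ht, h', hr, hq⟩ := hp s hs
  exact ⟨t, s', x, ht.trans hT, h', hr, hQ _ hq⟩

theorem le (hp : Reach M p T h Q) (hT : T ≤ T') : Reach M p T' h Q := hp.mono hT fun _ hg => hg

theorem skip (hQ : Q h) : Reach M .skip 1 h Q := fun s hs => ⟨1, s, .skip s, le_rfl, h, hs, hQ⟩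

theorem set {r : Var} {e : Expr} (ho : e.Ok M h) (hQ : Q (h.setV r (e.eval h))) :
    Reach M (.set r e) (e.cost + 1) h Q := by
  intro s hs
  obtain ⟨t, s', x, ht, hv, hm, hf⟩ := e.comp_exec M h 0 s hs ho
  refine ⟨_, _, x.seq (.move _ _ _), by omega, _, ?_, hQ⟩
  have hr := hs.of_frame hm hf
  refine ⟨?_, fun r' => ?_, fun i hi => ?_, fun a i => ?_⟩
  · have : (1 : ℕ) ≠ 2 * r.idx := by omega
    simp [State.setReg, this, hr.len]
  · by_cases hrr : r' = r
    · subst hrr; simp [State.setReg, Store.setV, hv]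
    · have : 2 * r'.idx ≠ 2 * r.idx := fun h => hrr (Var.idx_inj (by omega))
      simp [State.setReg, Store.setV, hrr, this, hr.var]
  · simpa [State.setReg, Store.setV] using hr.io i hi
  · simpa [State.setReg, Store.setV] using hr.arr a i

theorem put {a : Arr} {e f : Expr} (he : e.Ok M h) (hL : e.eval h < M.L) (hf : f.Ok M h)
    (hQ : Q (h.setA a (Function.update (h.arr a) (e.eval h) (f.eval h)))) :
    Reach M (.put a e f) (e.cost + f.cost + 6) h Q := by
  intro s hs
  obtain ⟨t1, s1, x1, c1, v1, m1, f1⟩ := e.comp_exec M h 0 s hs he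
  have hr1 := hs.of_frame m1 f1
  obtain ⟨s2, x2, v2, m2, f2⟩ := addrCmd_exec M a 0 s1 hr1.len (by rw [v1]; exact hL)
  have hr2 := hr1.of_frame m2 f2
  obtain ⟨t3, s3, x3, c3, v3, m3, f3⟩ := f.comp_exec M h 1 s2 hr2 hf
  have hr3 := hr2.of_frame m3 f3
  have hA : s3.reg (tmp 0) = M.n + 1 + (32 * e.eval h + a.idx) := by
    rw [f3 _ (Or.inr (by decide)), v2, v1]
  have hsp := M.space
  have hai := a.idx_lt
  refine ⟨_, _, x1.seq (x2.seq (x3.seq (.store _ _ _ (by rw [hA]; omega)))), by omega, _, ?_, hQ⟩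
  rw [hA, v3]
  refine ⟨hr3.len, hr3.var, fun i hi => ?_, fun a' i => ?_⟩
  · have : i ≠ M.n + 1 + (32 * e.eval h + a.idx) := by omega
    simpa [State.setMem, Store.setA, this] using hr3.io i hi
  · have hai' := a'.idx_lt
    by_cases haa : a' = a
    · subst haa
      by_cases hi : i = e.eval h
      · subst hi; simp [State.setMem, Store.setA]
      · have : M.n + 1 + (32 * i + a'.idx) ≠ M.n + 1 + (32 * e.eval h + a'.idx) := by omega
        simp only [State.setMem, Store.setA, Function.update_self, Function.update_of_ne this,
          Function.update_of_ne hi, hr3.arr]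
    -- Different arrays never collide, since their addresses differ modulo 32.
    · have : M.n + 1 + (32 * i + a'.idx) ≠ M.n + 1 + (32 * e.eval h + a.idx) :=
        fun h => haa (Arr.idx_inj (by omega))
      simp only [State.setMem, Store.setA, Function.update_of_ne this, Function.update_of_ne haa,
        hr3.arr]

theorem out {e f : Expr} (he : e.Ok M h) (hL : e.eval h ≤ M.n) (hf : f.Ok M h)
    (hQ : Q (h.setCell (e.eval h) (f.eval h))) :
    Reach M (.out e f) (e.cost + f.cost + 1) h Q := by
  intro s hs
  obtain ⟨t1, s1, x1, c1, v1, m1, f1⟩ := e.comp_exec M h 0 s hs he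
  have hr1 := hs.of_frame m1 f1
  obtain ⟨t3, s3, x3, c3, v3, m3, f3⟩ := f.comp_exec M h 1 s1 hr1 hf
  have hr3 := hr1.of_frame m3 f3
  have hA : s3.reg (tmp 0) = e.eval h := by
    rw [f3 _ (Or.inr (by decide)), v1]
  have hsp := M.space
  refine ⟨_, _, x1.seq (x3.seq (.store _ _ _ (by rw [hA]; omega))), by omega, _, ?_, hQ⟩
  rw [hA, v3]
  refine ⟨hr3.len, hr3.var, fun i hi => ?_, fun a' i => ?_⟩
  · by_cases hie : i = e.eval h
    · subst hie; simp [State.setMem, Store.setCell]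
    · simp only [State.setMem, Store.setCell, Function.update_of_ne hie, hr3.io i hi]
  · have : M.n + 1 + (32 * i + a'.idx) ≠ e.eval h := by omega
    simp only [State.setMem, Store.setCell, Function.update_of_ne this, hr3.arr]

/-- The postcondition of `p` is the judgement for `q` itself. A proof about a long program can
therefore proceed statement by statement, without naming intermediate assertions. -/
theorem seq (hp : Reach M p T h fun g => Reach M q T' g Q) : Reach M (.seq p q) (T + T') h Q := by
  intro s hs
  obtain ⟨t, s', x, ht, h', hr, hq⟩ := hp s hs
  obtain ⟨t2, s2, x2, ht2, h2, hr2, hq2⟩ := hq s' hr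
  exact ⟨_, s2, x.seq x2, by omega, h2, hr2, hq2⟩

theorem ifLt {e f : Expr} (he : e.Ok M h) (hf : f.Ok M h)
    (hp : e.eval h < f.eval h → Reach M p T h Q) (hq : ¬ e.eval h < f.eval h → Reach M q T' h Q) :
    Reach M (.ifLt e f p q) (e.cost + f.cost + T + T' + 1) h Q := by
  intro s hs
  obtain ⟨t1, s1, x1, c1, v1, m1, f1⟩ := e.comp_exec M h 0 s hs he
  have hr1 := hs.of_frame m1 f1
  obtain ⟨t3, s3, x3, c3, v3, m3, f3⟩ := f.comp_exec M h 1 s1 hr1 hf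
  have hr3 := hr1.of_frame m3 f3
  have hA : s3.reg (tmp 0) = e.eval h := by
    rw [f3 _ (Or.inr (by decide)), v1]
  by_cases hc : e.eval h < f.eval h
  · obtain ⟨t, s', x, ht, h', hr, hq⟩ := hp hc s3 hr3
    exact ⟨_, s', x1.seq (x3.seq (.ite_true (by simpa [Test.Holds, hA, v3] using hc) x)),
      by omega, h', hr, hq⟩
  · obtain ⟨t, s', x, ht, h', hr, hq⟩ := hq hc s3 hr3
    exact ⟨_, s', x1.seq (x3.seq (.ite_false (by simpa [Test.Holds, hA, v3] using hc) x)),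
      by omega, h', hr, hq⟩

theorem ifEq {e f : Expr} (he : e.Ok M h) (hf : f.Ok M h)
    (hp : e.eval h = f.eval h → Reach M p T h Q) (hq : ¬ e.eval h = f.eval h → Reach M q T' h Q) :
    Reach M (.ifEq e f p q) (e.cost + f.cost + T + T' + 1) h Q := by
  intro s hs
  obtain ⟨t1, s1, x1, c1, v1, m1, f1⟩ := e.comp_exec M h 0 s hs he
  have hr1 := hs.of_frame m1 f1
  obtain ⟨t3, s3, x3, c3, v3, m3, f3⟩ := f.comp_exec M h 1 s1 hr1 hf
  have hr3 := hr1.of_frame m3 f3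
  have hA : s3.reg (tmp 0) = e.eval h := by
    rw [f3 _ (Or.inr (by decide)), v1]
  by_cases hc : e.eval h = f.eval h
  · obtain ⟨t, s', x, ht, h', hr, hq⟩ := hp hc s3 hr3
    exact ⟨_, s', x1.seq (x3.seq (.ite_true (by simpa [Test.Holds, hA, v3] using hc) x)),
      by omega, h', hr, hq⟩
  · obtain ⟨t, s', x, ht, h', hr, hq⟩ := hq hc s3 hr3
    exact ⟨_, s', x1.seq (x3.seq (.ite_false (by simpa [Test.Holds, hA, v3] using hc) x)),
      by omega, h', hr, hq⟩

/-- A loop with invariant `I k` before iteration `k` and `D` iterations, the `k`-th of which takes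
`T k` steps. -/
theorem whileLt {e f : Expr} (I : ℕ → Store → Prop) (D : ℕ) (T : ℕ → ℕ)
    (step : ∀ k < D, ∀ g, I k g →
      e.Ok M g ∧ f.Ok M g ∧ e.eval g < f.eval g ∧ Reach M p (T k) g (I (k + 1)))
    (last : ∀ g, I D g → e.Ok M g ∧ f.Ok M g ∧ ¬ e.eval g < f.eval g ∧ Q g) (h0 : I 0 h) :
    Reach M (.whileLt e f p)
      ((∑ k ∈ Finset.range D, (T k + (e.cost + f.cost + 1))) + (e.cost + f.cost + 1)) h Q := by
  have guards : ∀ g s, Rep M.n g s → e.Ok M g → f.Ok M g →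
      ∃ t s', Exec M.w M.S (.seq (e.comp 0) (f.comp 1)) s t s' ∧ t ≤ e.cost + f.cost ∧
        s'.reg (tmp 0) = e.eval g ∧ s'.reg (tmp 1) = f.eval g ∧ Rep M.n g s' := by
    intro g s hs he hf
    obtain ⟨t1, s1, x1, c1, v1, m1, f1⟩ := e.comp_exec M g 0 s hs he
    have hr1 := hs.of_frame m1 f1
    obtain ⟨t3, s3, x3, c3, v3, m3, f3⟩ := f.comp_exec M g 1 s1 hr1 hf
    exact ⟨_, s3, x1.seq x3, by omega, by rw [f3 _ (Or.inr (by decide)), v1], v3,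
      hr1.of_frame m3 f3⟩
  have okI : ∀ k ≤ D, ∀ g, I k g → e.Ok M g ∧ f.Ok M g := by
    intro k hk g hg
    rcases hk.eq_or_lt with rfl | hk
    · exact ⟨(last g hg).1, (last g hg).2.1⟩
    · exact ⟨(step k hk g hg).1, (step k hk g hg).2.1⟩
  -- Induction on the number `j` of iterations that remain, from states in which the guard is
  -- already evaluated.
  have main : ∀ j k, k + j = D → ∀ g s, I k g → Rep M.n g s → s.reg (tmp 0) = e.eval g →
      s.reg (tmp 1) = f.eval g →
      ∃ t s', Exec M.w M.S (.loop (.lt (tmp 0) (tmp 1))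
          (.seq p.comp (.seq (e.comp 0) (f.comp 1)))) s t s' ∧
        t ≤ (∑ i ∈ Finset.Ico k D, (T i + (e.cost + f.cost + 1))) + 1 ∧
        ∃ h', Rep M.n h' s' ∧ Q h' := by
    intro j
    induction j with
    | zero =>
      intro k hk g s hI hr h0 h1
      obtain rfl : k = D := by omega
      obtain ⟨-, -, hn, hQ⟩ := last g hI
      exact ⟨1, s, .loop_done (by simpa [Test.Holds, h0, h1] using hn), by simp, g, hr, hQ⟩
    | succ j ih =>
      intro k hk g s hI hr h0 h1
      have hkD : k < D := by omega
      obtain ⟨-, -, hlt, hb⟩ := step k hkD g hI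
      obtain ⟨t, s1, x1, ht, g1, hr1, hI1⟩ := hb s hr
      obtain ⟨he, hf⟩ := okI (k + 1) hkD g1 hI1
      obtain ⟨t2, s2, x2, ht2, v0, v1, hr2⟩ := guards g1 s1 hr1 he hf
      obtain ⟨t3, s3, x3, ht3, hh⟩ := ih (k + 1) (by omega) g1 s2 hI1 hr2 v0 v1
      refine ⟨_, s3, .loop_step (by simpa [Test.Holds, h0, h1] using hlt) (x1.seq x2) x3, ?_, hh⟩
      rw [Finset.sum_eq_sum_Ico_succ_bot hkD]
      omega
  intro s hs
  obtain ⟨he, hf⟩ := okI 0 (Nat.zero_le _) h h0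
  obtain ⟨t2, s2, x2, ht2, v0, v1, hr2⟩ := guards h s hs he hf
  obtain ⟨t3, s3, x3, ht3, hh⟩ := main D 0 (by omega) h s2 h0 hr2 v0 v1
  refine ⟨_, s3, x2.seq x3, ?_, hh⟩
  rw [Finset.range_eq_Ico]
  omega

end Reach

/-! ### Weakest preconditions of loop-free programs -/

/-- The weakest precondition of a program without loops. -/
def Prog.wp (M : Machine) : Prog → (Store → Prop) → Store → Prop
  | skip, Q, h => Q h
  | set r e, Q, h => e.Ok M h ∧ Q (h.setV r (e.eval h))
  | put a e f, Q, h => e.Ok M h ∧ e.eval h < M.L ∧ f.Ok M h ∧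
      Q (h.setA a (Function.update (h.arr a) (e.eval h) (f.eval h)))
  | out e f, Q, h => e.Ok M h ∧ e.eval h ≤ M.n ∧ f.Ok M h ∧ Q (h.setCell (e.eval h) (f.eval h))
  | seq p q, Q, h => p.wp M (fun g => q.wp M Q g) h
  | ifLt e f p q, Q, h => e.Ok M h ∧ f.Ok M h ∧ (e.eval h < f.eval h → p.wp M Q h) ∧
      (¬ e.eval h < f.eval h → q.wp M Q h)
  | ifEq e f p q, Q, h => e.Ok M h ∧ f.Ok M h ∧ (e.eval h = f.eval h → p.wp M Q h) ∧
      (¬ e.eval h = f.eval h → q.wp M Q h)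
  | whileLt _ _ _, _, _ => False

theorem Prog.wp_mono {M : Machine} {P Q : Store → Prop} (hPQ : ∀ g, P g → Q g) (p : Prog) :
    ∀ {h : Store}, p.wp M P h → p.wp M Q h := by
  induction p generalizing P Q with
  | skip => exact fun h => hPQ _ h
  | set r e => exact fun h => ⟨h.1, hPQ _ h.2⟩
  | put a e f => exact fun h => ⟨h.1, h.2.1, h.2.2.1, hPQ _ h.2.2.2⟩
  | out e f => exact fun h => ⟨h.1, h.2.1, h.2.2.1, hPQ _ h.2.2.2⟩
  | seq p q ihp ihq => exact fun h => ihp (fun g hg => ihq hPQ hg) h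
  | ifLt e f p q ihp ihq =>
    exact fun h => ⟨h.1, h.2.1, fun hc => ihp hPQ (h.2.2.1 hc), fun hc => ihq hPQ (h.2.2.2 hc)⟩
  | ifEq e f p q ihp ihq =>
    exact fun h => ⟨h.1, h.2.1, fun hc => ihp hPQ (h.2.2.1 hc), fun hc => ihq hPQ (h.2.2.2 hc)⟩
  | whileLt => exact fun h => h.elim

/-- A bound for the running time of a program without loops. -/
def Prog.cost : Prog → ℕ
  | skip => 1
  | set _ e => e.cost + 1
  | put _ e f => e.cost + f.cost + 6
  | out e f => e.cost + f.cost + 1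
  | seq p q => p.cost + q.cost
  | ifLt e f p q => e.cost + f.cost + p.cost + q.cost + 1
  | ifEq e f p q => e.cost + f.cost + p.cost + q.cost + 1
  | whileLt _ _ _ => 0

/-- Loop-free code is verified by unfolding `wp`; loops have precondition `False` there and need an
invariant rule instead. -/
theorem Reach.of_wp {M : Machine} (p : Prog) : ∀ {h : Store} {Q : Store → Prop},
    p.wp M Q h → Reach M p p.cost h Q := by
  induction p with
  | skip => exact fun h => .skip h
  | set r e => exact fun h => .set h.1 h.2
  | put a e f => exact fun h => .put h.1 h.2.1 h.2.2.1 h.2.2.2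
  | out e f => exact fun h => .out h.1 h.2.1 h.2.2.1 h.2.2.2
  | seq p q ihp ihq => exact fun h => .seq ((ihp h).mono le_rfl fun g hg => ihq hg)
  | ifLt e f p q ihp ihq =>
    exact fun h => .ifLt h.1 h.2.1 (fun hc => ihp (h.2.2.1 hc)) (fun hc => ihq (h.2.2.2 hc))
  | ifEq e f p q ihp ihq =>
    exact fun h => .ifEq h.1 h.2.1 (fun hc => ihp (h.2.2.1 hc)) (fun hc => ihq (h.2.2.2 hc))
  | whileLt => exact fun h => h.elim

/-! ### Counting loops and frames -/

/-- `for i := 0 to e - 1 do p`. -/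
def Prog.for (i : Var) (e : Expr) (p : Prog) : Prog :=
  .seq (.set i (.lit 0)) (.whileLt (.var i) e (.seq p (.set i (.bin .add (.var i) (.lit 1)))))

/-- The body must leave the counter alone, and it has to establish the next invariant for the store
in which the counter is already incremented. -/
theorem Reach.for {M : Machine} {p : Prog} {h : Store} {Q : Store → Prop} {i : Var} {e : Expr}
    (I : ℕ → Store → Prop) (N T : ℕ) (hN : N < M.B) (h0 : I 0 (h.setV i 0))
    (bound : ∀ k ≤ N, ∀ g, I k g → g.v i = k → e.Ok M g ∧ e.eval g = N)
    (step : ∀ k < N, ∀ g, I k g → g.v i = k →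
      Reach M p T g fun g' => g'.v i = k ∧ I (k + 1) (g'.setV i (k + 1)))
    (last : ∀ g, I N g → g.v i = N → Q g) :
    Reach M (.for i e p) (N * (T + e.cost + 6) + e.cost + 4) h Q := by
  have hB : 1 < M.B := by have := M.addr; omega
  have key : Reach M (.for i e p) (2 + ((∑ k ∈ Finset.range N,
      ((T + 4) + ((Expr.var i).cost + e.cost + 1))) + ((Expr.var i).cost + e.cost + 1))) h Q := by
    refine .seq ((Reach.set (by simp only [Expr.Ok]; omega) ?_).mono le_rfl fun g hg => hg)
    refine Reach.whileLt (fun k g => I k g ∧ g.v i = k) N (fun _ => T + 4) ?_ ?_ ?_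
    · rintro k hk g ⟨hI, hi⟩
      obtain ⟨hok, hev⟩ := bound k hk.le g hI hi
      refine ⟨trivial, hok, by simp [Expr.eval, hi, hev, hk], .seq ((step k hk g hI hi).mono le_rfl
        fun g' hg' => ?_)⟩
      have hok : (Expr.bin .add (.var i) (.lit 1)).Ok M g' := by
        simp only [Expr.Ok, Expr.eval, Op.eval, hg'.1, true_and]; omega
      refine (Reach.set hok ?_).mono (by simp [Expr.cost]) fun g hg => hg
      · simp only [Expr.eval, Op.eval, hg'.1]
        exact ⟨hg'.2, by simp [Store.setV]⟩
    · rintro g ⟨hI, hi⟩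
      obtain ⟨hok, hev⟩ := bound N le_rfl g hI hi
      exact ⟨trivial, hok, by simp [Expr.eval, hi, hev], last g hI hi⟩
    · exact ⟨h0, by simp [Store.setV, Expr.eval]⟩
  refine key.mono ?_ fun g hg => hg
  simp only [Finset.sum_const, Finset.card_range, smul_eq_mul, Expr.cost]
  have : N * (T + 4 + (1 + e.cost + 1)) = N * (T + e.cost + 6) := by ring
  omega

/-- `for i := 0 to e - 1 do a[i] := f`. -/
def Prog.map (i : Var) (e : Expr) (a : Arr) (f : Expr) : Prog := .for i e (.put a (.var i) f)

/-- The store `h` after `k` iterations of a loop that fills the array `a` with the values `F`. -/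
structure MapState (h : Store) (i : Var) (a : Arr) (F : ℕ → ℕ) (k : ℕ) (g : Store) : Prop where
  idx : g.v i = k
  v : ∀ r, r ≠ i → g.v r = h.v r
  arr : ∀ b, b ≠ a → g.arr b = h.arr b
  lt : ∀ j < k, g.arr a j = F j
  ge : ∀ j, k ≤ j → g.arr a j = h.arr a j
  io : g.io = h.io

theorem Reach.map {M : Machine} {h : Store} {Q : Store → Prop} {i : Var} {e : Expr} {a : Arr}
    {f : Expr} (N : ℕ) (F : ℕ → ℕ) (hN : N ≤ M.L)
    (bound : ∀ k g, MapState h i a F k g → e.Ok M g ∧ e.eval g = N)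
    (step : ∀ k < N, ∀ g, MapState h i a F k g → f.Ok M g ∧ f.eval g = F k)
    (last : ∀ g, MapState h i a F N g → Q g) :
    Reach M (.map i e a f) (N * (f.cost + e.cost + 13) + e.cost + 4) h Q := by
  have hB : N < M.B := by have := M.addr; omega
  refine (Reach.for (MapState h i a F) N ((Expr.var i).cost + f.cost + 6) hB ?_ ?_ ?_ ?_).mono ?_
    fun g hg => hg
  · refine ⟨by simp [Store.setV], fun r hr => by simp [Store.setV, hr], fun b _ => rfl,
      fun j hj => absurd hj (Nat.not_lt_zero j), fun _ _ => rfl, rfl⟩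
  · exact fun k _ g hg _ => bound k g hg
  · intro k hk g hg hi
    obtain ⟨h1, h2⟩ := step k hk g hg
    refine .put trivial ?_ h1 ?_
    · simp only [Expr.eval, hi]; omega
    · simp only [Expr.eval, h2, hi, Store.setA, Store.setV]
      refine ⟨trivial, by simp, fun r hr => by simp [hr, hg.v r hr], fun b hb => by simp [hb, hg.arr b hb],
        fun j hj => ?_, fun j hj => ?_, hg.io⟩
      · rcases (Nat.lt_succ_iff.1 hj).lt_or_eq with hj | rfl
        · simp [hj.ne, hg.lt j hj]
        · simp
      · have : j ≠ k := by omega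
        simp [this, hg.ge j (by omega)]
  · exact fun g hg _ => last g hg
  · simp only [Expr.cost]
    have : N * (1 + f.cost + 6 + e.cost + 6) = N * (f.cost + e.cost + 13) := by ring
    omega

attribute [simp] Expr.eval Expr.Ok Expr.cost Op.eval Prog.wp Prog.cost Store.setV Store.setA
  Store.setCell

/-- The variables and arrays of level at least `l` and the input cells are unchanged. -/
structure Frame (l : ℕ) (h g : Store) : Prop where
  v : ∀ r : Var, l ≤ r.level → g.v r = h.v r
  arr : ∀ a : Arr, l ≤ a.level → g.arr a = h.arr a
  io : g.io = h.io

theorem Frame.refl (l : ℕ) (h : Store) : Frame l h h := ⟨fun _ _ => rfl, fun _ _ => rfl, rfl⟩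

theorem Frame.trans {l : ℕ} {h g k : Store} (h₁ : Frame l h g) (h₂ : Frame l g k) : Frame l h k :=
  ⟨fun r hr => (h₂.v r hr).trans (h₁.v r hr), fun a ha => (h₂.arr a ha).trans (h₁.arr a ha),
    h₂.io.trans h₁.io⟩

theorem Frame.setV {l : ℕ} {h g : Store} (hf : Frame l h g) {r : Var} (hr : r.level < l) (x : ℕ) :
    Frame l h (g.setV r x) := by
  refine ⟨fun r' hr' => ?_, hf.arr, hf.io⟩
  have : r' ≠ r := by rintro rfl; omega
  simp [this, hf.v r' hr']

theorem Frame.setA {l : ℕ} {h g : Store} (hf : Frame l h g) {a : Arr} (ha : a.level < l)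
    (x : ℕ → ℕ) : Frame l h (g.setA a x) := by
  refine ⟨hf.v, fun a' ha' => ?_, hf.io⟩
  have : a' ≠ a := by rintro rfl; omega
  simp [this, hf.arr a' ha']

end WordRAM

/-! ### Ranks -/

/-- The number of `j < N` with a smaller key than `i`. -/
def rankOf {α : Type*} [LinearOrder α] (N : ℕ) (κ : ℕ → α) (i : ℕ) : ℕ :=
  ((Finset.range N).filter fun j => κ j < κ i).card

section rankOf

variable {α β : Type*} [LinearOrder α] [LinearOrder β] {N : ℕ} {κ : ℕ → α}

theorem rankOf_le_rankOf {i j : ℕ} (h : κ i ≤ κ j) : rankOf N κ i ≤ rankOf N κ j :=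
  Finset.card_le_card fun k hk => by
    simp only [Finset.mem_filter] at hk ⊢
    exact ⟨hk.1, hk.2.trans_le h⟩

theorem rankOf_lt_rankOf {i j : ℕ} (hi : i < N) : rankOf N κ i < rankOf N κ j ↔ κ i < κ j := by
  refine ⟨fun h => lt_of_not_ge fun h' => absurd (rankOf_le_rankOf (N := N) h') (not_le.2 h),
    fun h => Finset.card_lt_card (Finset.ssubset_iff_of_subset (fun k hk => ?_) |>.2 ⟨i, ?_, ?_⟩)⟩
  · simp only [Finset.mem_filter] at hk ⊢
    exact ⟨hk.1, hk.2.trans h⟩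
  · simp [hi, h]
  · simp

theorem rankOf_inj {i j : ℕ} (hi : i < N) (hj : j < N) :
    rankOf N κ i = rankOf N κ j ↔ κ i = κ j := by
  have h1 := rankOf_lt_rankOf (κ := κ) (j := j) hi
  have h2 := rankOf_lt_rankOf (κ := κ) (j := i) hj
  rw [eq_iff_le_not_lt, eq_iff_le_not_lt, ← not_lt, ← not_lt, h1, h2]

theorem rankOf_le (i : ℕ) : rankOf N κ i ≤ N := by
  simpa [rankOf] using Finset.card_filter_le (Finset.range N) fun j => κ j < κ i

theorem rankOf_lt {i : ℕ} (hi : i < N) : rankOf N κ i < N := by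
  have : (Finset.range N).filter (fun j => κ j < κ i) ⊂ Finset.range N :=
    Finset.filter_ssubset.2 ⟨i, by simpa using hi, by simp⟩
  simpa [rankOf] using Finset.card_lt_card this

theorem rankOf_congr {κ' : ℕ → β} {i : ℕ} (h : ∀ j < N, κ j < κ i ↔ κ' j < κ' i) :
    rankOf N κ i = rankOf N κ' i :=
  congrArg Finset.card (Finset.filter_congr fun j hj => h j (Finset.mem_range.1 hj))

theorem surj_of_inj_range {f : ℕ → ℕ} (hf : ∀ i < N, f i < N)
    (hi : ∀ i < N, ∀ j < N, f i = f j → i = j) : ∀ p < N, ∃ i < N, f i = p := by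
  intro p hp
  have := Finset.surjOn_of_injOn_of_card_le (s := Finset.range N) (t := Finset.range N) f
    (fun i h => by simpa using hf i (by simpa using h))
    (fun i h j h' => hi i (by simpa using h) j (by simpa using h')) le_rfl
  obtain ⟨i, h, h'⟩ := this (show p ∈ (Finset.range N : Set ℕ) by simpa using hp)
  exact ⟨i, by simpa using h, h'⟩

theorem inj_of_surj_range {f : ℕ → ℕ} (hf : ∀ i < N, f i < N)
    (hs : ∀ p < N, ∃ i < N, f i = p) : ∀ i < N, ∀ j < N, f i = f j → i = j := by
  intro i hi j hj hij
  have := Finset.injOn_of_surjOn_of_card_le (s := Finset.range N) (t := Finset.range N) f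
    (fun i h => by simpa using hf i (by simpa using h))
    (fun p hp => by
      obtain ⟨i, h, h'⟩ := hs p (by simpa using hp)
      exact ⟨i, by simpa using h, h'⟩) le_rfl
  exact this (by simpa using hi) (by simpa using hj) hij

theorem rankOf_surj (hκ : ∀ i < N, ∀ j < N, κ i = κ j → i = j) :
    ∀ p < N, ∃ i < N, rankOf N κ i = p :=
  surj_of_inj_range (fun _ hi => rankOf_lt hi)
    fun i hi j hj h => hκ i hi j hj ((rankOf_inj hi hj).1 h)

/-- Listing `0, …, N - 1` by nondecreasing key, an element whose key is new gets its position. -/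
theorem rankOf_of_sorted {Q : ℕ → ℕ} (hQ : ∀ p < N, Q p < N) (hs : ∀ j < N, ∃ p < N, Q p = j)
    (ho : ∀ p p', p < p' → p' < N → κ (Q p) ≤ κ (Q p')) {p : ℕ} (hp : p < N)
    (hnew : ∀ p', p' + 1 = p → κ (Q p') < κ (Q p)) : rankOf N κ (Q p) = p := by
  have hset : (Finset.range N).filter (fun j => κ j < κ (Q p)) = (Finset.range p).image Q := by
    ext j
    simp only [Finset.mem_filter, Finset.mem_range, Finset.mem_image]
    constructor
    · rintro ⟨hj, hlt⟩
      obtain ⟨p', hp', rfl⟩ := hs j hj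
      refine ⟨p', lt_of_not_ge fun hge => ?_, rfl⟩
      rcases hge.eq_or_lt with rfl | hge
      · exact lt_irrefl _ hlt
      · exact absurd (ho p p' hge hp') (not_le.2 hlt)
    · rintro ⟨p', hp', rfl⟩
      refine ⟨hQ p' (by omega), ?_⟩
      obtain ⟨r, rfl⟩ : ∃ r, p = r + 1 := ⟨p - 1, by omega⟩
      rcases (Nat.lt_succ_iff.1 hp').eq_or_lt with rfl | h
      · exact hnew _ rfl
      · exact (ho p' r h (by omega)).trans_lt (hnew r rfl)
  rw [rankOf, hset, Finset.card_image_of_injOn, Finset.card_range]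
  intro a ha b hb hab
  simp only [Finset.coe_range, Set.mem_Iio] at ha hb
  exact inj_of_surj_range hQ hs a (by omega) b (by omega) hab

end rankOf

/-- The rank of the pair `(X i, Y i)`. -/
def pairRank (N : ℕ) (X Y : ℕ → ℕ) (i : ℕ) : ℕ :=
  rankOf N (fun j => toLex (X j, Y j)) i

/-- With the index as tie breaker, this is the cell to which a stable counting sort moves entry `q`:
smaller keys come before it, and so do equal keys at earlier indices. -/
theorem rankOf_tie_eq {N : ℕ} {K : ℕ → ℕ} {q : ℕ} (hq : q < N) :
    rankOf N (fun j => toLex (K j, j)) q =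
      ((Finset.range N).filter fun j => K j < K q).card +
        ((Finset.range q).filter fun j => K j = K q).card := by
  rw [rankOf, ← Finset.card_union_of_disjoint]
  · congr 1
    ext j
    simp only [Prod.Lex.toLex_lt_toLex, Finset.mem_filter, Finset.mem_range, Finset.mem_union]
    constructor
    · rintro ⟨hj, h | ⟨h, h'⟩⟩ <;> simp_all
    · rintro (⟨hj, h⟩ | ⟨hj, h⟩)
      · exact ⟨hj, Or.inl h⟩
      · exact ⟨by omega, Or.inr ⟨h, hj⟩⟩
  · rw [Finset.disjoint_left]
    intro j h h'
    simp only [Finset.mem_filter] at h h'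
    exact h.2.ne h'.2

theorem rankOf_tie_surj (N : ℕ) (K : ℕ → ℕ) :
    ∀ p < N, ∃ q < N, rankOf N (fun j => toLex (K j, j)) q = p :=
  rankOf_surj fun i _ j _ h => by
    have := congrArg (fun z => (ofLex z).2) h
    simpa using this

/-- Stable sorting by the second component and then by the first one. -/
theorem sorted_of_two_passes {N : ℕ} {X Y B Q : ℕ → ℕ}
    (h1 : ∀ q < N, B (rankOf N (fun j => toLex (Y j, j)) q) = q)
    (h2 : ∀ q < N, Q (rankOf N (fun j => toLex (X (B j), j)) q) = B q) :
    (∀ p < N, Q p < N) ∧ (∀ j < N, ∃ p < N, Q p = j) ∧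
      ∀ p p', p < p' → p' < N → toLex (X (Q p), Y (Q p)) ≤ toLex (X (Q p'), Y (Q p')) := by
  have hB : ∀ p < N, B p < N ∧ rankOf N (fun j => toLex (Y j, j)) (B p) = p := by
    intro p hp
    obtain ⟨q, hq, rfl⟩ := rankOf_tie_surj N Y p hp
    rw [h1 q hq]
    exact ⟨hq, rfl⟩
  refine ⟨fun p hp => ?_, fun j hj => ?_, fun p p' hpp hp' => ?_⟩
  · obtain ⟨q, hq, rfl⟩ := rankOf_tie_surj N (fun j => X (B j)) p hp
    rw [h2 q hq]
    exact (hB q hq).1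
  · have := rankOf_lt (κ := fun j => toLex (Y j, j)) hj
    exact ⟨_, rankOf_lt this, (h2 _ this).trans (h1 j hj)⟩
  · obtain ⟨q, hq, rfl⟩ := rankOf_tie_surj N (fun j => X (B j)) p (hpp.trans hp')
    obtain ⟨q', hq', rfl⟩ := rankOf_tie_surj N (fun j => X (B j)) p' hp'
    rw [h2 q hq, h2 q' hq']
    rw [rankOf_lt_rankOf hq, Prod.Lex.toLex_lt_toLex] at hpp
    rw [Prod.Lex.toLex_le_toLex]
    rcases hpp with h | ⟨h, h'⟩
    · exact Or.inl h
    · refine Or.inr ⟨h, ?_⟩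
      simp only at h'
      -- A tie in `X` was broken by the position in `B`, and that position is the rank by `Y` with
      -- the index as tie breaker.
      rw [← (hB q hq).2, ← (hB q' hq').2, rankOf_lt_rankOf (hB q hq).1,
        Prod.Lex.toLex_lt_toLex] at h'
      rcases h' with h' | h'
      · exact h'.le
      · exact h'.1.le

namespace WordRAM

/-! ### Ranking pairs by counting -/

/-- Stable counting sort: write the entries of `perm` to `buf` by increasing `key`. -/
def csort : Prog :=
  .seq (.map .i (.var .kb) .cnt (.lit 0)) <|
  .seq (.for .i (.var .m) (.put .cnt (.get .key (.get .perm (.var .i)))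
    (.bin .add (.get .cnt (.get .key (.get .perm (.var .i)))) (.lit 1)))) <|
  .seq (.set .acc (.lit 0)) <|
  .seq (.for .i (.var .kb) (.seq (.set .tmp (.get .cnt (.var .i)))
    (.seq (.put .cnt (.var .i) (.var .acc)) (.set .acc (.bin .add (.var .acc) (.var .tmp)))))) <|
  .for .i (.var .m) (.seq (.set .tmp (.get .cnt (.get .key (.get .perm (.var .i)))))
    (.seq (.put .buf (.var .tmp) (.get .perm (.var .i)))
      (.put .cnt (.get .key (.get .perm (.var .i))) (.bin .add (.var .tmp) (.lit 1)))))

/-- The properties of a store that counting sort leaves alone. -/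
structure SortFrame (h g : Store) : Prop where
  v : ∀ r, r ≠ .i → r ≠ .acc → r ≠ .tmp → g.v r = h.v r
  arr : ∀ a, a ≠ .cnt → a ≠ .buf → g.arr a = h.arr a
  io : g.io = h.io

theorem card_filter_lt_succ (N c : ℕ) (K : ℕ → ℕ) :
    ((Finset.range N).filter fun j => K j < c + 1).card =
      ((Finset.range N).filter fun j => K j < c).card +
        ((Finset.range N).filter fun j => K j = c).card := by
  rw [← Finset.card_union_of_disjoint]
  · congr 1
    ext j
    simp only [Finset.mem_filter, Finset.mem_union]
    constructor
    · rintro ⟨h, h'⟩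
      rcases (Nat.lt_succ_iff.1 h').lt_or_eq with h' | h' <;> simp [h, h']
    · rintro (⟨h, h'⟩ | ⟨h, h'⟩) <;> exact ⟨h, by omega⟩
  · rw [Finset.disjoint_left]
    intro j h h'
    simp only [Finset.mem_filter] at h h'
    exact h.2.ne h'.2

theorem card_filter_range_succ (N : ℕ) (P : ℕ → Prop) [DecidablePred P] :
    ((Finset.range (N + 1)).filter P).card =
      ((Finset.range N).filter P).card + if P N then 1 else 0 := by
  rw [Finset.range_add_one, Finset.filter_insert]
  split_ifs with h
  · rw [Finset.card_insert_of_notMem (by simp)]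
  · rfl

theorem card_filter_range_le (N : ℕ) (P : ℕ → Prop) [DecidablePred P] :
    ((Finset.range N).filter P).card ≤ N := by
  simpa using Finset.card_filter_le (Finset.range N) P

/-- `E j c` counts the keys equal to `c` among the first `j` entries, and `C c` counts all keys
below `c`. The first loop turns `cnt` into `E N`, the prefix sums turn it into `C`, and in the last
loop `cnt` holds `C c + E j c`, the next free cell for key `c`. By `rankOf_tie_eq` that is where
entry `j` belongs. -/
theorem csort_spec {M : Machine} {h : Store} {N K : ℕ} (hN : h.v .m = N) (hK : h.v .kb = K)
    (hNL : N ≤ M.L) (hKL : K ≤ M.L) (hp : ∀ q < N, h.arr .perm q < M.L)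
    (hk : ∀ q < N, h.arr .key (h.arr .perm q) < K) :
    Reach M csort (150 * (N + K + 1)) h fun g => SortFrame h g ∧
      ∀ q < N, g.arr .buf (rankOf N (fun j => toLex (h.arr .key (h.arr .perm j), j)) q) =
        h.arr .perm q := by
  have hB := M.addr
  let κ : ℕ → ℕ := fun j => h.arr .key (h.arr .perm j)
  let E : ℕ → ℕ → ℕ := fun j c => ((Finset.range j).filter fun j => κ j = c).card
  let C : ℕ → ℕ := fun c => ((Finset.range N).filter fun j => κ j < c).card
  have hE : ∀ j c, E j c ≤ j := fun j c => card_filter_range_le _ _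
  have hC : ∀ c, C c ≤ N := fun j => card_filter_range_le _ _
  have hC1 : ∀ c, C (c + 1) = C c + E N c := fun c => card_filter_lt_succ _ _ _
  have hE1 : ∀ j c, E (j + 1) c = E j c + if κ j = c then 1 else 0 :=
    fun j c => card_filter_range_succ _ _
  have hpos : ∀ q < N, rankOf N (fun j => toLex (κ j, j)) q = C (κ q) + E q (κ q) :=
    fun q hq => rankOf_tie_eq hq
  have hposlt : ∀ q < N, C (κ q) + E q (κ q) < N := fun q hq => by
    rw [← hpos q hq]; exact rankOf_lt hq
  -- Distinct entries get distinct cells, so no write destroys an earlier one.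
  have hposinj : ∀ q < N, ∀ q' < N, C (κ q) + E q (κ q) = C (κ q') + E q' (κ q') → q = q' := by
    intro q hq q' hq' he
    rw [← hpos q hq, ← hpos q' hq', rankOf_inj hq hq'] at he
    simpa using congrArg (fun z => (ofLex z).2) he
  apply Reach.le
  · apply Reach.seq
    refine .map K (fun _ => 0) hKL (fun k g hg => ⟨trivial, by simp [hg.v, hK]⟩)
      (fun k hk g hg => ⟨by simp; omega, rfl⟩) fun g₀ hg₀ => ?_
    apply Reach.seq
    refine .for (fun j g => SortFrame h g ∧ ∀ c < K, g.arr .cnt c = E j c) N _ (by omega)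
      ?_ ?_ (fun j hj g hI hi => Reach.of_wp _ ?_) fun g hI hi => ?_
    · refine ⟨⟨fun r h1 h2 h3 => by simp [h1, hg₀.v], fun a h1 h2 => by simp [h1, hg₀.arr], hg₀.io⟩,
        fun c hc => ?_⟩
      simp [hg₀.lt c hc, E]
    · intro k hk g hI hi
      exact ⟨trivial, by simp [hI.1.v, hN]⟩
    · obtain ⟨hf, hc⟩ := hI
      have hp' := hp j hj
      have hk' := hk j hj
      have hc' := hc _ hk'
      have hEj := hE j (κ j)
      simp only [Prog.wp, Expr.Ok, Expr.eval, Op.eval, hi, hf.arr .key (by simp) (by simp),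
        hf.arr .perm (by simp) (by simp), hc', true_and]
      refine ⟨by omega, by omega, ?_, by simp [hi], ⟨fun r h1 h2 h3 => by simp [h1, hf.v r h1 h2 h3],
        fun a h1 h2 => by simp [h1, hf.arr a h1 h2], hf.io⟩, fun c hcK => ?_⟩
      · refine ⟨⟨by omega, by omega⟩, by omega, ?_⟩
        change E j (κ j) + 1 < _
        omega
      · rw [hE1]
        simp only [Store.setV, Store.setA, Function.update_self, Function.update_apply, hc c hcK]
        change (if c = κ j then E j (κ j) + 1 else E j c) = _
        by_cases hcκ : c = κ j
        · simp [hcκ]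
        · simp [hcκ, Ne.symm hcκ]
    obtain ⟨hf, hc⟩ := hI
    apply Reach.seq
    refine Reach.of_wp _ ?_
    refine ⟨by simp; omega, ?_⟩
    apply Reach.seq
    refine .for (fun c g => SortFrame h g ∧ g.v .acc = C c ∧
      ∀ c' < K, g.arr .cnt c' = if c' < c then C c' else E N c') K _ (by omega)
      ?_ ?_ (fun c hcK g hI hi => Reach.of_wp _ ?_) fun g hI hi => ?_
    · refine ⟨⟨fun r h1 h2 h3 => by simp [h1, h2, hf.v r h1 h2 h3],
        fun a h1 h2 => by simp [hf.arr a h1 h2], by simp [hf.io]⟩, by simp [C], fun c' hc' => ?_⟩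
      simpa using hc c' hc'
    · intro k hk g hI hi
      exact ⟨trivial, by simp [hI.1.v, hK]⟩
    · obtain ⟨hf, ha, hc⟩ := hI
      have hcc := hc c hcK
      have := hC (c + 1)
      have hC1c := hC1 c
      simp only [lt_irrefl, if_false] at hcc
      simp only [Prog.wp, Expr.Ok, Expr.eval, Op.eval, hi, Store.setV, Store.setA, hcc, ha,
        Function.update_apply, true_and, reduceCtorEq, if_true, if_false]
      refine ⟨by omega, by omega, by omega, ⟨fun r h1 h2 h3 => by simp [h1, h2, h3, hf.v r h1 h2 h3],
        fun a h1 h2 => by simp [h1, hf.arr a h1 h2], hf.io⟩, hC1c.symm, fun c' hc' => ?_⟩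
      rcases lt_trichotomy c' c with hlt | rfl | hlt
      · rw [if_neg hlt.ne, hc c' hc', if_pos hlt, if_pos (by omega)]
      · simp
      · rw [if_neg hlt.ne', hc c' hc', if_neg (by omega), if_neg (by omega)]
    obtain ⟨hf, ha, hc⟩ := hI
    refine .for (fun j g => SortFrame h g ∧ (∀ c < K, g.arr .cnt c = C c + E j c) ∧
      ∀ q < j, g.arr .buf (C (κ q) + E q (κ q)) = h.arr .perm q) N _ (by omega)
      ?_ ?_ (fun j hj g hI hi => Reach.of_wp _ ?_) fun g hI hi => ?_
    · refine ⟨⟨fun r h1 h2 h3 => by simp [h1, hf.v r h1 h2 h3],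
        fun a h1 h2 => by simp [hf.arr a h1 h2], by simp [hf.io]⟩, fun c hcK => ?_, by simp⟩
      simp [hc c hcK, hcK, E]
    · intro k hk g hI hi
      exact ⟨trivial, by simp [hI.1.v, hN]⟩
    · obtain ⟨hf, hc, hb⟩ := hI
      have hp' := hp j hj
      have hk' := hk j hj
      have hc' := hc _ hk'
      have hlt := hposlt j hj
      simp only [Prog.wp, Expr.Ok, Expr.eval, Op.eval, hi, Store.setV, Store.setA,
        hf.arr .key (by simp) (by simp),
        hf.arr .perm (by simp) (by simp), hc', true_and, Function.update_apply,
        reduceCtorEq, if_true, if_false]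
      refine ⟨by omega, ?_, by omega, by omega, by omega, ?_,
        ⟨fun r h1 h2 h3 => by simp [h1, h3, hf.v r h1 h2 h3],
        fun a h1 h2 => by simp [h1, h2, hf.arr a h1 h2], hf.io⟩, fun c hcK => ?_, fun q hq => ?_⟩
      · change C (κ j) + E j (κ j) < _
        omega
      · refine ⟨by omega, ?_⟩
        change C (κ j) + E j (κ j) + 1 < _
        omega
      · rw [hE1, hc c hcK]
        change (if c = κ j then C (κ j) + E j (κ j) + 1 else C c + E j c) = _
        by_cases hcκ : c = κ j
        · simp [hcκ, add_assoc]
        · simp [hcκ, Ne.symm hcκ]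
      · change (if C (κ q) + E q (κ q) = C (κ j) + E j (κ j) then h.arr .perm j else _) = _
        rcases (Nat.lt_succ_iff.1 hq).lt_or_eq with hq | rfl
        · rw [if_neg fun he => hq.ne (hposinj q (by omega) j hj he), hb q hq]
        · simp
    · refine ⟨hI.1, fun q hq => ?_⟩
      change g.arr .buf (rankOf N (fun j => toLex (κ j, j)) q) = _
      rw [hpos q hq, hI.2.2 q hq]
  · simp only [Expr.cost, Prog.cost]
    ring_nf
    omega

/-- Set `rnk i` to the rank of `(fst i, snd i)` for `i < m`. -/
def rankPairs : Prog :=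
  .seq (.map .i (.var .m) .perm (.var .i)) <|
  .seq (.map .i (.var .m) .key (.get .snd (.var .i))) <|
  .seq csort <|
  .seq (.map .i (.var .m) .perm (.get .buf (.var .i))) <|
  .seq (.map .i (.var .m) .key (.get .fst (.var .i))) <|
  .seq csort <|
  .for .i (.var .m) <|
    .seq (.set .cur (.get .buf (.var .i))) <|
    .ifEq (.var .i) (.lit 0) (.put .rnk (.var .cur) (.var .i)) <|
    .seq (.set .tmp (.get .buf (.bin .sub (.var .i) (.lit 1)))) <|
    .ifEq (.get .fst (.var .cur)) (.get .fst (.var .tmp))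
      (.ifEq (.get .snd (.var .cur)) (.get .snd (.var .tmp))
        (.put .rnk (.var .cur) (.get .rnk (.var .tmp)))
        (.put .rnk (.var .cur) (.var .i)))
      (.put .rnk (.var .cur) (.var .i))

/-- Stable sorting by the second component and then by the first puts the pairs in order. In the
final scan a pair that differs from its predecessor gets its position as rank (`rankOf_of_sorted`);
a repeated pair inherits the rank of its predecessor. -/
theorem rankPairs_spec {M : Machine} {h : Store} {N K : ℕ} (hN : h.v .m = N) (hK : h.v .kb = K)
    (hNL : N ≤ M.L) (hKL : K ≤ M.L) (hfst : ∀ q < N, h.arr .fst q < K)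
    (hsnd : ∀ q < N, h.arr .snd q < K) :
    Reach M rankPairs (500 * (N + K + 1)) h fun g => Frame 1 h g ∧ g.v .m = N ∧ g.v .kb = K ∧
      ∀ i < N, g.arr .rnk i = pairRank N (h.arr .fst) (h.arr .snd) i := by
  have hB := M.addr
  let X := h.arr .fst
  let Y := h.arr .snd
  apply Reach.le
  · apply Reach.seq
    refine .map N (fun j => j) hNL (fun k g hg => ⟨trivial, by simp [hg.v, hN]⟩)
      (fun k hk g hg => ⟨trivial, hg.idx⟩) fun g₁ h₁ => ?_
    apply Reach.seq
    refine .map N Y hNL (fun k g hg => ⟨trivial, by simp [hg.v, h₁.v, hN]⟩)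
      (fun k hk g hg => ⟨⟨trivial, by simp [hg.idx]; omega⟩, by simp [hg.idx, hg.arr, h₁.arr, Y]⟩)
      fun g₂ h₂ => ?_
    apply Reach.seq
    have p₂ : ∀ q < N, g₂.arr .perm q = q := fun q hq => by simp [h₂.arr, h₁.lt q hq]
    have k₂ : ∀ q < N, g₂.arr .key q = Y q := fun q hq => by simp [h₂.lt q hq]
    refine (csort_spec (N := N) (K := K) (by simp [h₂.v, h₁.v, hN]) (by simp [h₂.v, h₁.v, hK])
      hNL hKL (fun q hq => by rw [p₂ q hq]; omega)
      (fun q hq => by rw [p₂ q hq, k₂ q hq]; exact hsnd q hq)).mono le_rfl fun g₃ ⟨h₃, b₃⟩ => ?_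
    have B₃ : ∀ q < N, g₃.arr .buf (rankOf N (fun j => toLex (Y j, j)) q) = q := by
      intro q hq
      refine Eq.trans ?_ ((b₃ q hq).trans (p₂ q hq))
      congr 1
      refine rankOf_congr fun j hj => ?_
      simp only [p₂ j hj, p₂ q hq, k₂ j hj, k₂ q hq]
    let B := g₃.arr .buf
    have hBlt : ∀ p < N, B p < N := by
      intro p hp
      obtain ⟨q, hq, rfl⟩ := rankOf_tie_surj N Y p hp
      exact (B₃ q hq).trans_lt hq
    apply Reach.seq
    refine .map N B hNL (fun k g hg => ⟨trivial, by simp [hg.v, h₃.v, h₂.v, h₁.v, hN]⟩)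
      (fun k hk g hg => ⟨⟨trivial, by simp [hg.idx]; omega⟩, by simp [hg.idx, hg.arr, B]⟩)
      fun g₄ h₄ => ?_
    apply Reach.seq
    refine .map N X hNL (fun k g hg => ⟨trivial, by simp [hg.v, h₄.v, h₃.v, h₂.v, h₁.v, hN]⟩)
      (fun k hk g hg => ⟨⟨trivial, by simp [hg.idx]; omega⟩,
        by simp [hg.idx, hg.arr, h₄.arr, h₃.arr, h₂.arr, h₁.arr, X]⟩)
      fun g₅ h₅ => ?_
    have p₅ : ∀ q < N, g₅.arr .perm q = B q := fun q hq => by simp [h₅.arr, h₄.lt q hq]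
    have k₅ : ∀ q < N, g₅.arr .key q = X q := fun q hq => by simp [h₅.lt q hq]
    apply Reach.seq
    refine (csort_spec (N := N) (K := K) (by simp [h₅.v, h₄.v, h₃.v, h₂.v, h₁.v, hN])
      (by simp [h₅.v, h₄.v, h₃.v, h₂.v, h₁.v, hK])
      hNL hKL (fun q hq => by rw [p₅ q hq]; exact (hBlt q hq).trans_le hNL)
      (fun q hq => by rw [p₅ q hq, k₅ _ (hBlt q hq)]; exact hfst _ (hBlt q hq))).mono le_rfl
      fun g₆ ⟨h₆, b₆⟩ => ?_
    let Q := g₆.arr .buf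
    have B₆ : ∀ q < N, Q (rankOf N (fun j => toLex (X (B j), j)) q) = B q := by
      intro q hq
      refine Eq.trans ?_ ((b₆ q hq).trans (p₅ q hq))
      congr 1
      refine rankOf_congr fun j hj => ?_
      simp only [p₅ j hj, p₅ q hq, k₅ _ (hBlt j hj), k₅ _ (hBlt q hq)]
    obtain ⟨hQ, hs, ho⟩ := sorted_of_two_passes B₃ B₆
    have frame₆ : Frame 1 h g₆ := by
      refine ⟨fun r hr => ?_, fun a ha => ?_, ?_⟩
      · cases r <;> first | exact absurd hr (by decide) | simp [h₆.v, h₅.v, h₄.v, h₃.v, h₂.v, h₁.v]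
      · cases a <;> first | exact absurd ha (by decide) |
          simp [h₆.arr, h₅.arr, h₄.arr, h₃.arr, h₂.arr, h₁.arr]
      · rw [h₆.io, h₅.io, h₄.io, h₃.io, h₂.io, h₁.io]
    have X₆ : g₆.arr .fst = X := by simp [h₆.arr, h₅.arr, h₄.arr, h₃.arr, h₂.arr, h₁.arr, X]
    have Y₆ : g₆.arr .snd = Y := by simp [h₆.arr, h₅.arr, h₄.arr, h₃.arr, h₂.arr, h₁.arr, Y]
    have m₆ : g₆.v .m = N := by simp [h₆.v, h₅.v, h₄.v, h₃.v, h₂.v, h₁.v, hN]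
    have kb₆ : g₆.v .kb = K := by simp [h₆.v, h₅.v, h₄.v, h₃.v, h₂.v, h₁.v, hK]
    let I : ℕ → Store → Prop := fun p g => Frame 1 h g ∧ g.v .m = N ∧ g.v .kb = K ∧
      g.arr .fst = X ∧ g.arr .snd = Y ∧ g.arr .buf = Q ∧
      ∀ p' < p, g.arr .rnk (Q p') = pairRank N X Y (Q p')
    refine .for I N _ (by omega) ?_ ?_ (fun p hp g hI hi => Reach.of_wp _ ?_) fun g hI hi => ?_
    · exact ⟨frame₆.setV (by decide) 0, by simp [m₆], by simp [kb₆], X₆, Y₆, rfl, by simp⟩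
    · exact fun k hk g hI hi => ⟨trivial, hI.2.1⟩
    · obtain ⟨hf, hm, hkb, hX, hY, hb, hr⟩ := hI
      have hQp := hQ p hp
      -- `P` is an opaque name for the postcondition. It is only established through `upd`, once for
      -- each of the branches that write a rank.
      obtain ⟨P, hP, upd⟩ : ∃ P : Store → Prop,
          (∀ g', P g' → g'.v .i = p ∧ I (p + 1) (g'.setV .i (p + 1))) ∧
          ∀ g' x, Frame 1 h g' → g'.v .i = p → g'.v .m = N → g'.v .kb = K →
            g'.arr = g.arr → x = pairRank N X Y (Q p) →
            P (g'.setA .rnk (Function.update (g'.arr .rnk) (Q p) x)) := by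
        refine ⟨_, fun _ h => h, fun g' x hf hi hm hkb ha hx => ?_⟩
        refine ⟨by simp [hi], (hf.setA (by decide) _).setV (by decide) _, by simp [hm],
          by simp [hkb], by simp [ha, hX], by simp [ha, hY], by simp [ha, hb], fun p' hp' => ?_⟩
        simp only [Store.setA, Store.setV, Function.update_self, Function.update_apply]
        split_ifs with he
        · rw [he, hx]
        · rw [ha]
          refine hr p' (lt_of_le_of_ne (Nat.lt_succ_iff.1 hp') ?_)
          rintro rfl
          exact he rfl
      have base : p = 0 ∨ toLex (X (Q (p - 1)), Y (Q (p - 1))) < toLex (X (Q p), Y (Q p)) →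
          p = pairRank N X Y (Q p) := by
        intro hc
        refine (rankOf_of_sorted hQ hs ho hp fun p' hp' => ?_).symm
        rcases hc with hc | hc
        · omega
        · simpa [← hp'] using hc
      have hcur : g.arr .buf p = Q p := by rw [hb]
      have fr : ∀ x, Frame 1 h (g.setV .cur x) := fun x => hf.setV (by decide) x
      refine Prog.wp_mono hP _ ?_
      simp only [Prog.wp, Expr.Ok, Expr.eval, Op.eval]
      refine ⟨⟨trivial, by omega⟩, trivial, by omega, fun h0 => ?_, fun h0 => ?_⟩
      · have h0' : p = 0 := by simpa [hi] using h0
        refine ⟨trivial, by simp [hi, hb]; omega, trivial, ?_⟩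
        simp only [Store.setV, Function.update_self, hi, hcur]
        exact upd _ _ (fr _) (by simp [hi]) (by simp [hm]) (by simp [hkb]) rfl
          (by simpa [hi] using base (Or.inl h0'))
      · have h0' : p ≠ 0 := by simpa [hi] using h0
        have hlast : g.arr .buf (p - 1) = Q (p - 1) := by rw [hb]
        have hQl := hQ (p - 1) (by omega)
        have hle := ho (p - 1) p (by omega) hp
        simp only [Store.setV, Function.update_self, Function.update_apply, reduceCtorEq, if_false,
          hi, hcur, hlast, hX, hY]
        have fr2 : ∀ x y, Frame 1 h ((g.setV .cur x).setV .tmp y) :=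
          fun x y => (fr x).setV (by decide) y
        have done : p = pairRank N X Y (Q p) → P
            (((g.setV .cur (Q p)).setV .tmp (Q (p - 1))).setA .rnk
              (Function.update (g.arr .rnk) (Q p) p)) := fun hx =>
          upd _ _ (fr2 _ _) (by simp [hi]) (by simp [hm]) (by simp [hkb]) rfl hx
        refine ⟨⟨⟨trivial, by omega, by omega⟩, by omega⟩, ⟨trivial, by omega⟩, ⟨trivial, by omega⟩,
          fun hx => ⟨⟨trivial, by omega⟩, ⟨trivial, by omega⟩, fun hy => ?_, fun hy => ?_⟩,
          fun hx => ?_⟩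
        · refine ⟨trivial, by omega, ⟨trivial, by omega⟩, ?_⟩
          refine upd _ _ (fr2 _ _) (by simp [hi]) (by simp [hm]) (by simp [hkb]) rfl ?_
          rw [hr (p - 1) (by omega)]
          exact (rankOf_inj hQl hQp).2 (by simp only [hx, hy])
        · refine ⟨trivial, by omega, trivial, done (base (Or.inr ?_))⟩
          refine lt_of_le_of_ne hle fun he => hy ?_
          exact (congrArg (fun z => (ofLex z).2) he).symm
        · refine ⟨trivial, by omega, trivial, done (base (Or.inr ?_))⟩
          refine lt_of_le_of_ne hle fun he => hx ?_
          exact (congrArg (fun z => (ofLex z).1) he).symm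
    · refine ⟨hI.1, hI.2.1, hI.2.2.1, fun j hj => ?_⟩
      obtain ⟨p, hp, rfl⟩ := hs j hj
      exact hI.2.2.2.2.2.2 p hp
  · simp only [Expr.cost, Prog.cost]
    ring_nf
    omega

end WordRAM

/-! ### Suffix sorting by the difference cover modulo 3 -/

theorem pairRank_lt {N : ℕ} {X Y : ℕ → ℕ} {i j : ℕ} (hi : i < N) :
    pairRank N X Y i < pairRank N X Y j ↔ X i < X j ∨ X i = X j ∧ Y i < Y j := by
  rw [pairRank, pairRank, rankOf_lt_rankOf hi, Prod.Lex.toLex_lt_toLex]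

theorem pairRank_inj {N : ℕ} {X Y : ℕ → ℕ} {i j : ℕ} (hi : i < N) (hj : j < N) :
    pairRank N X Y i = pairRank N X Y j ↔ X i = X j ∧ Y i = Y j := by
  rw [pairRank, pairRank, rankOf_inj hi hj, toLex_inj, Prod.mk.injEq]

theorem pairRank_eq_card (N : ℕ) (X Y : ℕ → ℕ) (i : ℕ) : pairRank N X Y i =
    ((Finset.range N).filter fun j => X j < X i ∨ X j = X i ∧ Y j < Y i).card := by
  simp only [pairRank, rankOf, Prod.Lex.toLex_lt_toLex]

theorem pairRank_congr {N : ℕ} {X Y X' Y' : ℕ → ℕ} (hX : ∀ j < N, X j = X' j)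
    (hY : ∀ j < N, Y j = Y' j) {i : ℕ} (hi : i < N) : pairRank N X Y i = pairRank N X' Y' i :=
  rankOf_congr fun j hj => by rw [hX j hj, hX i hi, hY j hj, hY i hi]

theorem pairRank_le {N : ℕ} {X Y : ℕ → ℕ} (i : ℕ) : pairRank N X Y i ≤ N := rankOf_le i

namespace SuffixSort

/-- The rank of a suffix among all nonempty suffixes. -/
def sufRank (s : List ℕ) (i : ℕ) : ℕ := rankOf s.length (fun j => s.drop j) i

/-- The rank of the three symbols at position `i`. -/
def triRank (s : List ℕ) (i : ℕ) : ℕ :=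
  pairRank s.length (fun j => s.getD j 0)
    (pairRank s.length (fun j => s.getD (j + 1) 0) fun j => s.getD (j + 2) 0) i

/-- The length of the reduced string. -/
def reduceLen (N : ℕ) : ℕ := (N + 1) / 3 + 1 + N / 3

/-- The names of the triples at the positions `1, 4, …`, a separator, and the names of the triples
at the positions `2, 5, …`. -/
def reduce (s : List ℕ) : List ℕ :=
  (List.range (reduceLen s.length)).map fun q =>
    if q < (s.length + 1) / 3 then triRank s (3 * q + 1) + 2
    else if q = (s.length + 1) / 3 then 1
    else triRank s (3 * (q - ((s.length + 1) / 3 + 1)) + 2) + 2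

/-- The position in the reduced string of the triple at position `i`. -/
def slot (N i : ℕ) : ℕ := if i % 3 = 1 then i / 3 else (N + 1) / 3 + 1 + i / 3

theorem length_reduce (s : List ℕ) : (reduce s).length = reduceLen s.length := by simp [reduce]

theorem pos_of_mem_reduce {s : List ℕ} {a : ℕ} (h : a ∈ reduce s) : 0 < a := by
  simp only [reduce, List.mem_map, List.mem_range] at h
  obtain ⟨q, -, rfl⟩ := h
  split_ifs <;> omega

theorem slot_lt {N i : ℕ} (hi : i < N) (h3 : i % 3 ≠ 0) : slot N i < reduceLen N := by
  unfold slot reduceLen; split_ifs <;> omega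

theorem getD_reduce {s : List ℕ} {q : ℕ} (hq : q < reduceLen s.length) : (reduce s).getD q 0 =
    if q < (s.length + 1) / 3 then triRank s (3 * q + 1) + 2
    else if q = (s.length + 1) / 3 then 1
    else triRank s (3 * (q - ((s.length + 1) / 3 + 1)) + 2) + 2 := by
  simp [reduce, List.getD_eq_getElem?_getD, hq]

theorem getD_reduce_slot {s : List ℕ} {i : ℕ} (hi : i < s.length) (h3 : i % 3 ≠ 0) :
    (reduce s).getD (slot s.length i) 0 = triRank s i + 2 := by
  rw [getD_reduce (slot_lt hi h3)]
  unfold slot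
  split_ifs with h1 h2 h2 h4 h4
  · congr 2; omega
  · omega
  · omega
  · omega
  · omega
  · congr 2; omega

theorem slot_add_three {N i : ℕ} : slot N (i + 3) = slot N i + 1 := by
  unfold slot; split_ifs <;> omega

/-- Behind the last complete triple comes the separator `1` in the first half of the reduced string,
or its end, read as `0`, in the second half. Both are below all triple names, which start at `2`. -/
theorem getD_reduce_after_last {s : List ℕ} {i : ℕ} (hi : i + 3 = s.length) :
    (reduce s).getD (slot s.length i + 1) 0 ≤ 1 := by
  by_cases h1 : i % 3 = 1
  · have hs : slot s.length i + 1 = (s.length + 1) / 3 := by unfold slot; simp [h1]; omega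
    rw [hs, getD_reduce (by unfold reduceLen; omega)]
    simp
  · have hs : slot s.length i + 1 = reduceLen s.length := by
      unfold slot reduceLen; simp [h1]; omega
    rw [hs, List.getD_eq_default _ _ (length_reduce s).le]
    omega

variable {s : List ℕ}

theorem getD_pos (hs : ∀ a ∈ s, 0 < a) {i : ℕ} (hi : i < s.length) : 0 < s.getD i 0 := by
  rw [List.getD_eq_getElem _ _ hi]
  exact hs _ (List.getElem_mem hi)

/-- Since all symbols are positive, the default value `0` acts as an end marker below every symbol,
and the recursion for the order holds beyond the end too. -/
theorem drop_lt_drop (hs : ∀ a ∈ s, 0 < a) (i j : ℕ) : s.drop i < s.drop j ↔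
    s.getD i 0 < s.getD j 0 ∨ s.getD i 0 = s.getD j 0 ∧ s.drop (i + 1) < s.drop (j + 1) := by
  rcases lt_or_ge i s.length with hi | hi <;> rcases lt_or_ge j s.length with hj | hj
  · rw [List.drop_eq_getElem_cons hi, List.drop_eq_getElem_cons hj, List.getD_eq_getElem _ _ hi,
      List.getD_eq_getElem _ _ hj, List.cons_lt_cons_iff]
  · have := getD_pos hs hi
    rw [List.drop_eq_nil_of_le hj, List.getD_eq_default _ _ hj]
    simp only [List.not_lt_nil, false_iff]
    omega
  · have := getD_pos hs hj
    rw [List.drop_eq_nil_of_le hi, List.getD_eq_default _ _ hi]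
    simp only [this, true_or, iff_true]
    rw [List.drop_eq_getElem_cons hj]
    exact List.nil_lt_cons _ _
  · rw [List.drop_eq_nil_of_le hi, List.drop_eq_nil_of_le hj, List.getD_eq_default _ _ hi,
      List.getD_eq_default _ _ hj, List.drop_eq_nil_of_le (by omega : s.length ≤ i + 1),
      List.drop_eq_nil_of_le (by omega : s.length ≤ j + 1)]
    simp

theorem triRank_lt {i j : ℕ} (hi : i < s.length) : triRank s i < triRank s j ↔
    s.getD i 0 < s.getD j 0 ∨ s.getD i 0 = s.getD j 0 ∧
      (s.getD (i + 1) 0 < s.getD (j + 1) 0 ∨ s.getD (i + 1) 0 = s.getD (j + 1) 0 ∧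
        s.getD (i + 2) 0 < s.getD (j + 2) 0) := by
  rw [triRank, triRank, pairRank_lt hi, pairRank_lt hi]

theorem triRank_inj {i j : ℕ} (hi : i < s.length) (hj : j < s.length) :
    triRank s i = triRank s j ↔ s.getD i 0 = s.getD j 0 ∧ s.getD (i + 1) 0 = s.getD (j + 1) 0 ∧
      s.getD (i + 2) 0 = s.getD (j + 2) 0 := by
  rw [triRank, triRank, pairRank_inj hi hj, pairRank_inj hi hj]

theorem drop_lt_drop_triple (hs : ∀ a ∈ s, 0 < a) {i j : ℕ} (hi : i < s.length)
    (hj : j < s.length) : s.drop i < s.drop j ↔ triRank s i < triRank s j ∨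
      triRank s i = triRank s j ∧ s.drop (i + 3) < s.drop (j + 3) := by
  rw [drop_lt_drop hs i j, drop_lt_drop hs (i + 1) (j + 1), drop_lt_drop hs (i + 2) (j + 2),
    triRank_lt hi, triRank_inj hi hj]
  tauto

/-- Comparing suffixes symbol by symbol in the reduced string is comparing the original suffixes
triple by triple, because advancing by three positions advances by one slot. The delicate point is a
class of triples that runs out. If the triples at `i` and `j` agree, their padding zeros agree, so
exactly one of `i + 3`, `j + 3` can lie beyond the last position only by being the length itself;
then `getD_reduce_after_last` decides as the empty suffix does. -/
theorem reduce_drop_lt_drop (hs : ∀ a ∈ s, 0 < a) : ∀ (k : ℕ) {i j : ℕ}, s.length - i ≤ k →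
    i < s.length → j < s.length → i % 3 ≠ 0 → j % 3 ≠ 0 →
    ((reduce s).drop (slot s.length i) < (reduce s).drop (slot s.length j) ↔
      s.drop i < s.drop j) := by
  intro k
  induction k with
  | zero => intros; omega
  | succ k ih =>
    intro i j hk hi hj hi3 hj3
    rcases eq_or_ne i j with rfl | hij
    · simp
    have hpos : ∀ a ∈ reduce s, 0 < a := fun a ha => pos_of_mem_reduce ha
    rw [drop_lt_drop hpos, drop_lt_drop_triple hs hi hj, getD_reduce_slot hi hi3,
      getD_reduce_slot hj hj3, add_lt_add_iff_right, add_left_inj]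
    refine or_congr_right (and_congr_right fun heq => ?_)
    rw [triRank_inj hi hj] at heq
    have hz : ∀ a b, s.getD a 0 = s.getD b 0 → (a < s.length ↔ b < s.length) := by
      intro a b hab
      constructor <;> intro h <;> by_contra h'
      · have := getD_pos hs h
        rw [hab, List.getD_eq_default _ _ (not_lt.1 h')] at this
        exact lt_irrefl _ this
      · have := getD_pos hs h
        rw [← hab, List.getD_eq_default _ _ (not_lt.1 h')] at this
        exact lt_irrefl _ this
    have h1 := hz _ _ heq.2.1
    have h2 := hz _ _ heq.2.2
    rcases lt_or_ge (i + 3) s.length with hi' | hi' <;>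
      rcases lt_or_ge (j + 3) s.length with hj' | hj'
    · rw [← slot_add_three, ← slot_add_three]
      exact ih (by omega) hi' hj' (by omega) (by omega)
    · have hj2 : j + 3 = s.length := by omega
      have hd := getD_reduce_after_last hj2
      rw [drop_lt_drop hpos, ← slot_add_three (i := i), getD_reduce_slot hi' (by omega),
        List.drop_eq_nil_of_le hj']
      simp only [List.not_lt_nil, iff_false]
      omega
    · have hi2 : i + 3 = s.length := by omega
      have hd := getD_reduce_after_last hi2
      rw [drop_lt_drop hpos, ← slot_add_three (i := j), getD_reduce_slot hj' (by omega),
        List.drop_eq_nil_of_le hi', List.drop_eq_getElem_cons hj']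
      simp only [List.nil_lt_cons, iff_true]
      omega
    -- Both triples reach the end, and equal padding forces `i = j`, which is excluded.
    · omega

/-- The rank of a sample suffix, or `0` for an empty suffix. -/
def smpRank (s : List ℕ) (i : ℕ) : ℕ :=
  if i < s.length ∧ i % 3 ≠ 0 then sufRank (reduce s) (slot s.length i) + 1 else 0

/-- The shift by one reserves `0` for the empty suffix, which precedes all others; on sample
positions the order is that of the reduced string. -/
theorem smpRank_lt (hs : ∀ a ∈ s, 0 < a) {i j : ℕ} (hi : s.length ≤ i ∨ i % 3 ≠ 0)
    (hj : s.length ≤ j ∨ j % 3 ≠ 0) : smpRank s i < smpRank s j ↔ s.drop i < s.drop j := by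
  unfold smpRank
  rcases lt_or_ge i s.length with hi' | hi' <;> rcases lt_or_ge j s.length with hj' | hj'
  · have hi3 : i % 3 ≠ 0 := by omega
    have hj3 : j % 3 ≠ 0 := by omega
    rw [if_pos ⟨hi', hi3⟩, if_pos ⟨hj', hj3⟩, add_lt_add_iff_right, sufRank, sufRank,
      rankOf_lt_rankOf (by rw [length_reduce]; exact slot_lt hi' hi3),
      reduce_drop_lt_drop hs _ le_rfl hi' hj' hi3 hj3]
  · rw [if_neg (c := j < s.length ∧ j % 3 ≠ 0) fun h => absurd h.1 (not_lt.2 hj'),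
      List.drop_eq_nil_of_le hj']
    simp
  · have hj3 : j % 3 ≠ 0 := by omega
    rw [if_neg fun h => absurd h.1 (not_lt.2 hi'), if_pos ⟨hj', hj3⟩, List.drop_eq_nil_of_le hi',
      List.drop_eq_getElem_cons hj']
    exact iff_of_true (Nat.succ_pos _) (List.nil_lt_cons _ _)
  · rw [if_neg (c := j < s.length ∧ j % 3 ≠ 0) fun h => absurd h.1 (not_lt.2 hj'),
      List.drop_eq_nil_of_le hj']
    simp

theorem smpRank_le (s : List ℕ) (i : ℕ) : smpRank s i ≤ reduceLen s.length := by
  unfold smpRank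
  split_ifs with h
  · have : sufRank (reduce s) (slot s.length i) < (reduce s).length :=
      rankOf_lt (by rw [length_reduce]; exact slot_lt h.1 h.2)
    rwa [length_reduce] at this
  · exact Nat.zero_le _

/-- The ranks within the classes `{0, 1}`, `{0, 2}`, `{1, 2}`, `{0}`, `{1}`, `{2}` modulo 3, for
positions in these classes; `z` is larger than all symbols. -/
def rankA (s : List ℕ) (z : ℕ) : ℕ → ℕ :=
  pairRank s.length (fun j => if j % 3 = 2 then z else s.getD j 0) fun j => smpRank s (j + 1)

def rankB (s : List ℕ) (z : ℕ) : ℕ → ℕ :=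
  pairRank s.length (fun j => if j % 3 = 1 then z else s.getD j 0) <|
    pairRank s.length (fun j => s.getD (j + 1) 0) fun j => smpRank s (j + 2)

def rankC (s : List ℕ) : ℕ → ℕ :=
  pairRank s.length (fun j => if j % 3 = 0 then 1 else 0) (smpRank s)

def single (s : List ℕ) (c : ℕ) (r : ℕ → ℕ) : ℕ → ℕ :=
  pairRank s.length (fun j => if j % 3 = c then 0 else 1) r

/-- The number of smaller suffixes at positions with a given property. -/
def classRank (s : List ℕ) (p : ℕ → Prop) [DecidablePred p] (i : ℕ) : ℕ :=
  ((Finset.range s.length).filter fun j => p j ∧ s.drop j < s.drop i).card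

/-- Inclusion and exclusion for the sets of smaller suffixes. It replaces the merging phase of the
usual algorithm. -/
theorem classRank_add {p q r : ℕ → Prop} [DecidablePred p] [DecidablePred q] [DecidablePred r]
    (h : ∀ j, p j ∨ q j) (hr : ∀ j, r j ↔ p j ∧ q j) (i : ℕ) :
    classRank s p i + classRank s q i - classRank s r i = sufRank s i := by
  have := Finset.card_union_add_card_inter
    ((Finset.range s.length).filter fun j => p j ∧ s.drop j < s.drop i)
    ((Finset.range s.length).filter fun j => q j ∧ s.drop j < s.drop i)
  rw [← Finset.filter_or, ← Finset.filter_and] at this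
  have e1 : (Finset.range s.length).filter
      (fun j => p j ∧ s.drop j < s.drop i ∨ q j ∧ s.drop j < s.drop i) =
      (Finset.range s.length).filter fun j => s.drop j < s.drop i :=
    Finset.filter_congr fun j _ => by have := h j; tauto
  have e2 : (Finset.range s.length).filter
      (fun j => (p j ∧ s.drop j < s.drop i) ∧ q j ∧ s.drop j < s.drop i) =
      (Finset.range s.length).filter fun j => r j ∧ s.drop j < s.drop i :=
    Finset.filter_congr fun j _ => by rw [hr j]; tauto
  rw [e1, e2] at this
  unfold classRank sufRank rankOf
  simp only at this ⊢
  omega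

/-- For residues 0 and 1 the next position is a sample position or beyond the end, so one symbol and
one sample rank determine the order. Positions of residue 2 carry the oversized symbol `z` and are
never counted as smaller. -/
theorem rankA_eq (hs : ∀ a ∈ s, 0 < a) {z : ℕ} (hz : ∀ a ∈ s, a < z) {i : ℕ} (hi : i < s.length)
    (h3 : i % 3 ≠ 2) : rankA s z i = classRank s (fun j => j % 3 ≠ 2) i := by
  rw [rankA, pairRank_eq_card, classRank]
  congr 1
  refine Finset.filter_congr fun j hj => ?_
  have hj' := Finset.mem_range.1 hj
  have hzi : s.getD i 0 < z := by
    rw [List.getD_eq_getElem _ _ hi]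
    exact hz _ (List.getElem_mem hi)
  rw [if_neg h3]
  by_cases hj3 : j % 3 = 2
  · simp only [hj3, if_true, ne_eq, not_true_eq_false, false_and, iff_false]
    omega
  · rw [if_neg hj3, smpRank_lt hs (by omega) (by omega), ← drop_lt_drop hs]
    simp [hj3]

/-- For residues 0 and 2 it is the position two further on that has a sample rank, so two symbols
are compared before it. -/
theorem rankB_eq (hs : ∀ a ∈ s, 0 < a) {z : ℕ} (hz : ∀ a ∈ s, a < z) {i : ℕ} (hi : i < s.length)
    (h3 : i % 3 ≠ 1) : rankB s z i = classRank s (fun j => j % 3 ≠ 1) i := by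
  rw [rankB, pairRank_eq_card, classRank]
  congr 1
  refine Finset.filter_congr fun j hj => ?_
  have hj' := Finset.mem_range.1 hj
  have hzi : s.getD i 0 < z := by
    rw [List.getD_eq_getElem _ _ hi]
    exact hz _ (List.getElem_mem hi)
  rw [if_neg h3]
  by_cases hj3 : j % 3 = 1
  · simp only [hj3, if_true, ne_eq, not_true_eq_false, false_and, iff_false]
    omega
  · rw [if_neg hj3, pairRank_lt hj', smpRank_lt hs (by omega) (by omega),
      ← drop_lt_drop hs (j + 1), ← drop_lt_drop hs]
    simp [hj3]

/-- Residues 1 and 2 are the sample positions; the first component `1` places the others behind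
them. -/
theorem rankC_eq (hs : ∀ a ∈ s, 0 < a) {i : ℕ}
    (h3 : i % 3 ≠ 0) : rankC s i = classRank s (fun j => j % 3 ≠ 0) i := by
  rw [rankC, pairRank_eq_card, classRank]
  congr 1
  refine Finset.filter_congr fun j hj => ?_
  rw [if_neg h3]
  by_cases hj3 : j % 3 = 0
  · simp [hj3]
  · rw [if_neg hj3, smpRank_lt hs (by omega) (by omega)]
    simp [hj3]

/-- Ranks within a larger class already order the positions of a single residue, so ranking these
ranks once more, with the other residues placed last, gives the rank inside that residue. -/
theorem single_eq {p : ℕ → Prop} [DecidablePred p] {c : ℕ} {r : ℕ → ℕ}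
    (hr : ∀ i < s.length, p i → r i = classRank s p i) (hp : ∀ j, j % 3 = c → p j) {i : ℕ}
    (hi : i < s.length) (hc : i % 3 = c) :
    single s c r i = classRank s (fun j => j % 3 = c) i := by
  rw [single, pairRank_eq_card, classRank]
  congr 1
  refine Finset.filter_congr fun j hj => ?_
  have hj' := Finset.mem_range.1 hj
  rw [if_pos hc]
  by_cases hj3 : j % 3 = c
  · have key : ∀ a b, a < s.length → b < s.length → p a → p b →
        s.drop a < s.drop b → classRank s p a < classRank s p b := by
      intro a b ha hb pa pb hab
      refine Finset.card_lt_card (Finset.ssubset_iff_of_subset (fun k hk => ?_) |>.2 ⟨a, ?_, ?_⟩)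
      · simp only [Finset.mem_filter] at hk ⊢
        exact ⟨hk.1, hk.2.1, hk.2.2.trans hab⟩
      · simp [ha, pa, hab]
      · simp
    rw [if_pos hj3, hr j hj' (hp j hj3), hr i hi (hp i hc)]
    simp only [lt_irrefl, true_and, false_or, hj3]
    refine ⟨fun h => ?_, key j i hj' hi (hp j hj3) (hp i hc)⟩
    by_contra hn
    rcases (not_lt.1 hn).lt_or_eq with h' | h'
    · exact absurd (key i j hi hj' (hp i hc) (hp j hj3) h') (by omega)
    · have : classRank s p i = classRank s p j := by unfold classRank; rw [h']
      omega
  · simp [hj3]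

/-- The rank of a suffix from the ranks within the classes modulo 3. -/
theorem sufRank_eq (hs : ∀ a ∈ s, 0 < a) {z : ℕ} (hz : ∀ a ∈ s, a < z) {i : ℕ}
    (hi : i < s.length) : sufRank s i =
      if i % 3 = 0 then rankA s z i + rankB s z i - single s 0 (rankA s z) i
      else if i % 3 = 1 then rankA s z i + rankC s i - single s 1 (rankA s z) i
      else rankB s z i + rankC s i - single s 2 (rankB s z) i := by
  have hA : ∀ i < s.length, i % 3 ≠ 2 → rankA s z i = classRank s (fun j => j % 3 ≠ 2) i :=
    fun i hi => rankA_eq hs hz hi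
  have hB : ∀ i < s.length, i % 3 ≠ 1 → rankB s z i = classRank s (fun j => j % 3 ≠ 1) i :=
    fun i hi => rankB_eq hs hz hi
  split_ifs with h0 h1
  · rw [hA i hi (by omega), hB i hi (by omega), single_eq hA (by omega) hi h0,
      classRank_add (fun j => by omega) fun j => by omega]
  · rw [hA i hi (by omega), rankC_eq hs (by omega), single_eq hA (by omega) hi h1,
      classRank_add (fun j => by omega) fun j => by omega]
  · rw [hB i hi (by omega), rankC_eq hs (by omega), single_eq hB (by omega) hi (by omega),
      classRank_add (fun j => by omega) fun j => by omega]

/-- Triples determine the order of the suffixes of a string of length at most three. -/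
theorem sufRank_eq_triRank (hs : ∀ a ∈ s, 0 < a) (h3 : s.length ≤ 3) {i : ℕ} (hi : i < s.length) :
    sufRank s i = triRank s i := by
  have : triRank s i = rankOf s.length (triRank s) i := by
    conv_lhs => rw [triRank, pairRank]
    refine rankOf_congr fun j hj => ?_
    rw [Prod.Lex.toLex_lt_toLex]
    exact (pairRank_lt (X := fun j => s.getD j 0)
      (Y := pairRank s.length (fun j => s.getD (j + 1) 0) fun j => s.getD (j + 2) 0) hj).symm
  rw [this, sufRank]
  refine rankOf_congr fun j hj => ?_
  rw [drop_lt_drop_triple hs hj hi, List.drop_eq_nil_of_le (by omega : s.length ≤ i + 3)]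
  simp

/-- The number of reductions until the length is at most three. -/
def depth (N : ℕ) : ℕ := if _h : 3 < N then depth (reduceLen N) + 1 else 0
termination_by N
decreasing_by unfold reduceLen; omega

/-- The total length of the strings, each counted with one more symbol. -/
def totalLen (N : ℕ) : ℕ := N + 1 + if _h : 3 < N then totalLen (reduceLen N) else 0
termination_by N
decreasing_by unfold reduceLen; omega

/-- A reduction leaves about two thirds of the length, so the sum is geometric. The additive
constants are absorbed from length 7 on, and the shorter lengths are computed. -/
theorem totalLen_le (N : ℕ) : totalLen N ≤ 9 * (N + 1) := by
  induction N using Nat.strong_induction_on with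
  | _ N ih =>
    rw [totalLen]
    split_ifs with h
    · have hlt : reduceLen N < N := by unfold reduceLen; omega
      rcases lt_or_ge N 7 with h7 | h7
      · have h3 : totalLen 3 = 4 := by rw [totalLen]; simp
        have h4 : totalLen 4 = 9 := by rw [totalLen]; simp [reduceLen, h3]
        have h5 : totalLen 5 = 15 := by rw [totalLen]; simp [reduceLen, h4]
        interval_cases N <;> simp [reduceLen, h3, h4, h5]
      · have := ih _ hlt
        have : reduceLen N = (N + 1) / 3 + 1 + N / 3 := rfl
        omega
    · omega

end SuffixSort

/-! ### Programs for one reduction step of suffix sorting -/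

namespace WordRAM

open SuffixSort

/-- Rank the pairs of values of two expressions for `i < len`, and write the ranks to `o`. -/
def rankInto (e f : Expr) (o : Arr) : Prog :=
  .seq (.map .i (.var .len) .fst e) <| .seq (.map .i (.var .len) .snd f) <|
  .seq rankPairs <| .map .i (.var .len) o (.get .rnk (.var .i))

structure RankState (h : Store) (o : Arr) (N : ℕ) (F G : ℕ → ℕ) (g : Store) : Prop where
  v : ∀ r, 1 ≤ r.level → g.v r = h.v r
  m : g.v .m = h.v .m
  kb : g.v .kb = h.v .kb
  arr : ∀ a, 1 ≤ a.level → a ≠ o → g.arr a = h.arr a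
  io : g.io = h.io
  val : ∀ k < N, g.arr o k = pairRank N F G k

/-- The stores in which the expressions of `rankInto` are evaluated. -/
structure EvalState (h : Store) (k : ℕ) (g : Store) : Prop where
  idx : g.v .i = k
  v : ∀ r, r ≠ .i → g.v r = h.v r
  arr : ∀ a, 1 ≤ a.level → g.arr a = h.arr a

theorem rankInto_spec {M : Machine} {h : Store} {e f : Expr} {o : Arr} {N K : ℕ} (F G : ℕ → ℕ)
    (hlen : h.v .len = N) (hm : h.v .m = N) (hkb : h.v .kb = K) (hNL : N ≤ M.L) (hKL : K ≤ M.L)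
    (ho : 1 ≤ o.level) (hF : ∀ k < N, F k < K) (hG : ∀ k < N, G k < K)
    (he : ∀ k < N, ∀ g, EvalState h k g → e.Ok M g ∧ e.eval g = F k)
    (hf : ∀ k < N, ∀ g, EvalState h k g → f.Ok M g ∧ f.eval g = G k) :
    Reach M (rankInto e f o) (500 * (N + K + 1) + N * (e.cost + f.cost + 60) + 30) h
      (RankState h o N F G) := by
  have lvl : ∀ {a b : Arr}, 1 ≤ a.level → b.level = 0 → a ≠ b := by
    rintro a b h1 h2 rfl; omega
  apply Reach.le
  · apply Reach.seq
    refine .map N F hNL (fun k g hg => ⟨trivial, by simp [hg.v, hlen]⟩)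
      (fun k hk g hg => he k hk g ⟨hg.idx, hg.v, fun a ha => hg.arr a (lvl ha rfl)⟩) fun g₁ h₁ => ?_
    apply Reach.seq
    refine .map N G hNL (fun k g hg => ⟨trivial, by simp [hg.v, h₁.v, hlen]⟩)
      (fun k hk g hg => hf k hk g ⟨hg.idx, fun r hr => (hg.v r hr).trans (h₁.v r hr),
        fun a ha => (hg.arr a (lvl ha rfl)).trans (h₁.arr a (lvl ha rfl))⟩) fun g₂ h₂ => ?_
    apply Reach.seq
    have F₂ : ∀ k < N, g₂.arr .fst k = F k := fun k hk => by rw [h₂.arr _ (by simp), h₁.lt k hk]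
    refine (rankPairs_spec (N := N) (K := K) (by simp [h₂.v, h₁.v, hm])
      (by simp [h₂.v, h₁.v, hkb]) hNL hKL (fun q hq => by rw [F₂ q hq]; exact hF q hq)
      (fun q hq => by rw [h₂.lt q hq]; exact hG q hq)).mono le_rfl fun g₃ ⟨f₃, m₃, kb₃, r₃⟩ => ?_
    refine .map N (pairRank N F G) hNL (fun k g hg => ⟨trivial, ?_⟩) (fun k hk g hg => ⟨?_, ?_⟩)
      fun g hg => ⟨fun r hr => ?_, ?_, ?_, fun a ha hao => ?_, ?_, hg.lt⟩
    · simp [hg.v, f₃.v .len (by decide), h₂.v, h₁.v, hlen]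
    · simp [hg.idx]; omega
    · simp only [Expr.eval, hg.idx]
      rw [hg.arr .rnk (lvl ho rfl).symm, r₃ k hk]
      exact pairRank_congr F₂ h₂.lt hk
    · have hri : r ≠ .i := by rintro rfl; exact absurd hr (by decide)
      rw [hg.v r hri, f₃.v r hr, h₂.v r hri, h₁.v r hri]
    · rw [hg.v _ (by simp), m₃, hm]
    · rw [hg.v _ (by simp), kb₃, hkb]
    · rw [hg.arr a hao, f₃.arr a ha, h₂.arr a (lvl ha rfl), h₁.arr a (lvl ha rfl)]
    · rw [hg.io, f₃.io, h₂.io, h₁.io]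
  · simp only [Expr.cost]
    ring_nf
    omega

/-- The store holds the current string `s`. -/
structure Loaded (M : Machine) (s : List ℕ) (g : Store) : Prop where
  len : g.v .len = s.length
  str : ∀ k < s.length, g.arr .str (g.v .b + k) = s.getD k 0
  room : g.v .b + s.length ≤ M.L
  room' : 8 * (s.length + 2) + 1 ≤ M.L
  pos : ∀ a ∈ s, 0 < a
  bound : ∀ a ∈ s, a < 8 * (s.length + 2)

theorem Loaded.getD_lt {M : Machine} {s : List ℕ} {g : Store} (h : Loaded M s g) (k : ℕ) :
    s.getD k 0 < 8 * (s.length + 2) := by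
  rcases lt_or_ge k s.length with hk | hk
  · rw [List.getD_eq_getElem _ _ hk]
    exact h.bound _ (List.getElem_mem hk)
  · rw [List.getD_eq_default _ _ hk]
    omega

theorem Loaded.of_eq {M : Machine} {s : List ℕ} {g g' : Store} (h : Loaded M s g)
    (hl : g'.v .len = g.v .len) (hb : g'.v .b = g.v .b) (hs : g'.arr .str = g.arr .str) :
    Loaded M s g' :=
  ⟨hl.trans h.len, fun k hk => by rw [hb, hs, h.str k hk], by rw [hb]; exact h.room, h.room', h.pos,
    h.bound⟩

/-- The symbol at position `i + k` of the current string, or `0`. -/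
def strAt (k : ℕ) : Expr :=
  .ifLt (.bin .add (.var .i) (.lit k)) (.var .len)
    (.get .str (.bin .add (.var .b) (.bin .add (.var .i) (.lit k)))) (.lit 0)

theorem strAt_spec {M : Machine} {s : List ℕ} {h g : Store} (hs : Loaded M s h) {i k : ℕ}
    (hi : i < s.length) (hk : k ≤ 2) (hg : EvalState h i g) :
    (strAt k).Ok M g ∧ (strAt k).eval g = s.getD (i + k) 0 := by
  have hB := M.addr
  have h1 := hs.room
  have h2 := hs.room'
  have hb := hg.v .b (by simp)
  have hl := (hg.v .len (by simp)).trans hs.len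
  have ha := hg.arr .str (by decide)
  constructor
  · simp only [strAt, Expr.Ok, Expr.eval, Op.eval, hg.idx, hb, hl, true_and]
    exact ⟨⟨by omega, by omega⟩, fun _ => ⟨⟨⟨by omega, by omega⟩, by omega⟩, by omega⟩,
      fun _ => by omega⟩
  · simp only [strAt, Expr.eval, Op.eval, hg.idx, hb, hl, ha]
    split_ifs with hlt
    · exact hs.str _ hlt
    · rw [List.getD_eq_default _ _ (not_lt.1 hlt)]

/-- The key bound is one more than the bound for symbols, so that the oversized symbol `z = kb - 1`
is itself an admissible key. -/
def setup : Prog :=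
  .seq (.set .m (.var .len)) <| .set .kb <|
    .bin .add (.bin .mul (.lit 8) (.bin .add (.var .len) (.lit 2))) (.lit 1)

theorem setup_spec {M : Machine} {s : List ℕ} {h : Store} (hs : Loaded M s h) :
    Reach M setup setup.cost h fun g => Frame 1 h g ∧ g.v .m = s.length ∧
      g.v .kb = 8 * (s.length + 2) + 1 := by
  have hB := M.addr
  have h2 := hs.room'
  refine Reach.of_wp _ ?_
  simp only [setup, Prog.wp, Expr.Ok, Expr.eval, Op.eval, Store.setV, Function.update_apply,
    reduceCtorEq, if_false, if_true, hs.len, true_and]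
  exact ⟨⟨⟨by omega, by omega, by omega⟩, by omega, by omega⟩,
    ((Frame.refl 1 h).setV (r := .m) (by decide) _).setV (r := .kb) (by decide) _, trivial⟩

/-- Rank the triples of the current string. -/
def triples : Prog :=
  .seq setup <| .seq (rankInto (strAt 1) (strAt 2) .rA) <|
    rankInto (strAt 0) (.get .rA (.var .i)) .rA

/-- A triple is ranked as a pair: its first symbol, and the rank of the pair of the other two. -/
theorem triples_spec {M : Machine} {s : List ℕ} {h : Store} (hs : Loaded M s h) :
    Reach M triples (20000 * (s.length + 1)) h fun g =>
      (∀ r, 1 ≤ r.level → g.v r = h.v r) ∧ (∀ a, 1 ≤ a.level → a ≠ .rA → g.arr a = h.arr a) ∧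
      g.io = h.io ∧ ∀ k < s.length, g.arr .rA k = triRank s k := by
  have hroom := hs.room
  have hroom' := hs.room'
  have hNL : s.length ≤ M.L := by omega
  apply Reach.le
  · apply Reach.seq
    refine (setup_spec hs).mono le_rfl fun g₁ ⟨f₁, m₁, kb₁⟩ => ?_
    have hs₁ : Loaded M s g₁ := hs.of_eq (f₁.v _ (by decide)) (f₁.v _ (by decide))
      (f₁.arr _ (by decide))
    apply Reach.seq
    refine (rankInto_spec (fun j => s.getD (j + 1) 0) (fun j => s.getD (j + 2) 0) hs₁.len m₁ kb₁
      hNL hroom' (by decide)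
      (fun k _ => (hs.getD_lt _).trans (by omega)) (fun k _ => (hs.getD_lt _).trans (by omega))
      (fun k hk g hg => strAt_spec hs₁ hk (by omega) hg)
      (fun k hk g hg => strAt_spec hs₁ hk (by omega) hg)).mono le_rfl fun g₂ h₂ => ?_
    have hs₂ : Loaded M s g₂ := hs₁.of_eq (h₂.v _ (by decide)) (h₂.v _ (by decide))
      (h₂.arr _ (by decide) (by simp))
    refine (rankInto_spec (fun j => s.getD j 0)
      (pairRank s.length (fun j => s.getD (j + 1) 0) fun j => s.getD (j + 2) 0)
      hs₂.len (h₂.m.trans m₁) (h₂.kb.trans kb₁) hNL hroom' (by decide)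
      (fun k _ => (hs.getD_lt _).trans (by omega)) (fun k _ => (pairRank_le k).trans_lt (by omega))
      (fun k hk g hg => strAt_spec hs₂ hk (by omega) hg)
      (fun k hk g hg => ?_)).mono le_rfl fun g₃ h₃ => ?_
    · simp only [Expr.Ok, Expr.eval, hg.idx, hg.arr .rA (by decide), h₂.val k hk, true_and, and_true]
      omega
    · refine ⟨fun r hr => ?_, fun a ha hao => ?_, ?_, h₃.val⟩
      · rw [h₃.v r hr, h₂.v r hr, f₁.v r hr]
      · rw [h₃.arr a ha hao, h₂.arr a ha hao, f₁.arr a ha]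
      · rw [h₃.io, h₂.io, f₁.io]
  · simp only [Expr.cost, Prog.cost, setup, strAt]
    ring_nf
    omega

/-- From the ranks `srk` of the suffixes of the reduced string compute those of the current
string. -/
def expand : Prog :=
  let mod3 : Expr := .bin .mod (.var .i) (.lit 3)
  let div3 : Expr := .bin .div (.var .i) (.lit 3)
  let z : Expr := .bin .sub (.var .kb) (.lit 1)
  let sgl (c : ℕ) (r o : Arr) : Prog :=
    rankInto (.ifEq mod3 (.lit c) (.lit 0) (.lit 1)) (.get r (.var .i)) o
  let comb (a b d : Arr) : Expr :=
    .bin .sub (.bin .add (.get a (.var .i)) (.get b (.var .i))) (.get d (.var .i))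
  .seq setup <|
  .seq (.set .c (.bin .add (.bin .div (.bin .add (.var .len) (.lit 1)) (.lit 3)) (.lit 1))) <|
  .seq (.map .i (.bin .add (.var .len) (.lit 2)) .smp
    (.ifLt (.var .i) (.var .len)
      (.ifEq mod3 (.lit 0) (.lit 0)
        (.ifEq mod3 (.lit 1) (.bin .add (.get .srk div3) (.lit 1))
          (.bin .add (.get .srk (.bin .add (.var .c) div3)) (.lit 1))))
      (.lit 0))) <|
  .seq (rankInto (.ifEq mod3 (.lit 2) z (strAt 0))
    (.get .smp (.bin .add (.var .i) (.lit 1))) .rA) <|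
  .seq (rankInto (strAt 1) (.get .smp (.bin .add (.var .i) (.lit 2))) .rB) <|
  .seq (rankInto (.ifEq mod3 (.lit 1) z (strAt 0)) (.get .rB (.var .i)) .rB) <|
  .seq (rankInto (.ifEq mod3 (.lit 0) (.lit 1) (.lit 0)) (.get .smp (.var .i)) .rC) <|
  .seq (sgl 0 .rA .dA) <| .seq (sgl 1 .rA .dB) <| .seq (sgl 2 .rB .dC) <|
  .map .i (.var .len) .srk
    (.ifEq mod3 (.lit 0) (comb .rA .rB .dA) (.ifEq mod3 (.lit 1) (comb .rA .rC .dB)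
      (comb .rB .rC .dC)))

/-- The program computes the ingredients of `sufRank_eq`: the sample ranks, the ranks in the three
unions of two residue classes, and the ranks in the single classes, each by a constant number of
pair rankings. -/
theorem expand_spec {M : Machine} {s : List ℕ} {h : Store} (hs : Loaded M s h)
    (hr : ∀ k < reduceLen s.length, h.arr .srk k = sufRank (reduce s) k) :
    Reach M expand (100000 * (s.length + 1)) h fun g =>
      (∀ r, 1 ≤ r.level → r ≠ .c → g.v r = h.v r) ∧ (∀ a, a = .str ∨ a = .lens ∨ a = .bases ∨
        2 ≤ a.level → g.arr a = h.arr a) ∧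
      g.io = h.io ∧ ∀ k < s.length, g.arr .srk k = sufRank s k := by
  have hB := M.addr
  have hroom := hs.room
  have hroom' := hs.room'
  have hNL : s.length ≤ M.L := by omega
  have hrl : reduceLen s.length ≤ s.length + 1 := by unfold reduceLen; omega
  have hsmp : ∀ k, smpRank s k < 8 * (s.length + 2) + 1 := fun k =>
    (smpRank_le s k).trans_lt (by omega)
  let z := 8 * (s.length + 2)
  have hz : ∀ a ∈ s, a < z := hs.bound
  have hsz : ∀ k, s.getD k 0 < z + 1 := fun k => (hs.getD_lt k).trans (by omega)
  apply Reach.le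
  · apply Reach.seq
    refine (setup_spec hs).mono le_rfl fun g₁ ⟨f₁, m₁, kb₁⟩ => ?_
    have hs₁ : Loaded M s g₁ := hs.of_eq (f₁.v _ (by decide)) (f₁.v _ (by decide))
      (f₁.arr _ (by decide))
    apply Reach.seq
    refine Reach.of_wp _ ?_
    simp only [Prog.wp, Expr.Ok, Expr.eval, Op.eval, hs₁.len, true_and]
    refine ⟨⟨⟨⟨by omega, by omega⟩, by omega, by omega⟩, by omega, by omega⟩, ?_⟩
    generalize hg₂ : g₁.setV .c ((s.length + 1) / 3 + 1) = g₂
    have hs₂ : Loaded M s g₂ := by subst hg₂; exact hs₁.of_eq (by simp) (by simp) rfl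
    have v₂ : ∀ r, r ≠ .c → g₂.v r = g₁.v r := by subst hg₂; intro r hr; simp [hr]
    have c₂ : g₂.v .c = (s.length + 1) / 3 + 1 := by subst hg₂; simp
    have a₂ : g₂.arr = g₁.arr := by subst hg₂; rfl
    have io₂ : g₂.io = g₁.io := by subst hg₂; rfl
    have m₂ : g₂.v .m = s.length := (v₂ _ (by simp)).trans m₁
    have kb₂ : g₂.v .kb = z + 1 := (v₂ _ (by simp)).trans kb₁
    apply Reach.seq
    -- Two entries beyond the end are filled as well, with `0`, because ranks at distance one and
    -- two are read for every position.
    refine .map (s.length + 2) (smpRank s) (by omega) (fun k g hg => ?_) (fun k hk g hg => ?_)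
      fun g₃ h₃ => ?_
    · have := (hg.v .len (by simp)).trans hs₂.len
      simp only [Expr.Ok, Expr.eval, Op.eval, this]
      exact ⟨⟨trivial, by omega, by omega⟩, trivial⟩
    · have hl := (hg.v .len (by simp)).trans hs₂.len
      have hc := (hg.v .c (by simp)).trans c₂
      have hsrk : ∀ j < reduceLen s.length, g.arr .srk j = sufRank (reduce s) j := by
        intro j hj
        rw [hg.arr _ (by simp), a₂, f₁.arr _ (by decide), hr j hj]
      have hle : ∀ j, sufRank (reduce s) j ≤ s.length + 1 := fun j =>
        (rankOf_le _).trans (by rw [length_reduce]; exact hrl)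
      have hslot : ∀ h3 : k % 3 ≠ 0, k < s.length → slot s.length k < reduceLen s.length :=
        fun h3 hk => slot_lt hk h3
      have h1 : k < s.length → k % 3 = 1 → g.arr .srk (k / 3) = sufRank (reduce s) (k / 3) := by
        intro hk h3
        have := hslot (by omega) hk
        rw [slot, if_pos h3] at this
        exact hsrk _ this
      have h2 : k < s.length → k % 3 = 2 → g.arr .srk ((s.length + 1) / 3 + 1 + k / 3) =
          sufRank (reduce s) ((s.length + 1) / 3 + 1 + k / 3) := by
        intro hk h3
        have := hslot (by omega) hk
        rw [slot, if_neg (by omega)] at this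
        exact hsrk _ this
      have h1' := hle (k / 3)
      have h2' := hle ((s.length + 1) / 3 + 1 + k / 3)
      constructor
      · simp only [Expr.Ok, Expr.eval, Op.eval, hg.idx, hl, hc, true_and]
        refine ⟨fun hk => ⟨⟨by omega, by omega⟩, by omega, fun _ => by omega, fun _ =>
          ⟨⟨by omega, by omega⟩, by omega, fun h3 => ⟨⟨⟨by omega, by omega⟩, by omega⟩, by omega, ?_⟩,
          fun h3 => ⟨⟨⟨⟨by omega, by omega⟩, by omega⟩, by omega⟩, by omega, ?_⟩⟩⟩, fun _ => by omega⟩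
        · rw [h1 hk h3]; omega
        · rw [h2 hk (by omega)]; omega
      · simp only [Expr.eval, Op.eval, hg.idx, hl, hc, smpRank, slot]
        by_cases hk : k < s.length
        · have : k % 3 = 0 ∨ k % 3 = 1 ∨ k % 3 = 2 := by omega
          rcases this with h3 | h3 | h3
          · simp [h3]
          · simp [hk, h3, h1 hk h3]
          · simp [hk, h3, h2 hk h3]
        · simp [hk]
    have hs₃ : Loaded M s g₃ := hs₂.of_eq (h₃.v _ (by simp)) (h₃.v _ (by simp))
      (h₃.arr _ (by simp))
    have m₃ : g₃.v .m = s.length := (h₃.v _ (by simp)).trans m₂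
    have kb₃ : g₃.v .kb = z + 1 := (h₃.v _ (by simp)).trans kb₂
    apply Reach.seq
    refine (rankInto_spec (fun j => if j % 3 = 2 then z else s.getD j 0)
      (fun j => smpRank s (j + 1)) hs₃.len m₃ kb₃ hNL hroom' (by decide)
      (fun k _ => by split_ifs; exacts [by omega, hsz k]) (fun k _ => hsmp _)
      (fun k hk g hg => ?_) (fun k hk g hg => ?_)).mono le_rfl fun gA hA => ?_
    · have hst := strAt_spec hs₃ hk (Nat.zero_le 2) hg
      simp only [Expr.Ok, Expr.eval, Op.eval, hg.idx, (hg.v .kb (by simp)).trans kb₃, hst.2, add_zero,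
        add_tsub_cancel_right, true_and, and_true]
      exact ⟨⟨by omega, by omega⟩, by omega, fun _ => ⟨by omega, by omega⟩, fun _ => hst.1⟩
    · simp only [Expr.Ok, Expr.eval, Op.eval, hg.idx, hg.arr .smp (by decide), true_and]
      exact ⟨⟨⟨by omega, by omega⟩, by omega⟩, h₃.lt _ (by omega)⟩
    have hsA : Loaded M s gA := hs₃.of_eq (hA.v _ (by decide)) (hA.v _ (by decide))
      (hA.arr _ (by decide) (by simp))
    have smpA : gA.arr .smp = g₃.arr .smp := hA.arr _ (by decide) (by simp)
    apply Reach.seq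
    refine (rankInto_spec (fun j => s.getD (j + 1) 0)
      (fun j => smpRank s (j + 2)) hsA.len (hA.m.trans m₃) (hA.kb.trans kb₃) hNL hroom' (by decide)
      (fun k _ => hsz _) (fun k _ => hsmp _)
      (fun k hk g hg => strAt_spec hsA hk (by omega) hg)
      (fun k hk g hg => ?_)).mono le_rfl fun gB' hB' => ?_
    · simp only [Expr.Ok, Expr.eval, Op.eval, hg.idx, hg.arr .smp (by decide), smpA, true_and]
      exact ⟨⟨⟨by omega, by omega⟩, by omega⟩, h₃.lt _ (by omega)⟩
    have hsB' : Loaded M s gB' := hsA.of_eq (hB'.v _ (by decide)) (hB'.v _ (by decide))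
      (hB'.arr _ (by decide) (by simp))
    have kbB' := hB'.kb.trans (hA.kb.trans kb₃)
    apply Reach.seq
    refine (rankInto_spec (fun j => if j % 3 = 1 then z else s.getD j 0)
      (pairRank s.length (fun j => s.getD (j + 1) 0) fun j => smpRank s (j + 2)) hsB'.len
      (hB'.m.trans (hA.m.trans m₃)) kbB' hNL hroom' (by decide)
      (fun k _ => by split_ifs; exacts [by omega, hsz k])
      (fun k _ => (pairRank_le k).trans_lt (by omega))
      (fun k hk g hg => ?_) (fun k hk g hg => ?_)).mono le_rfl fun gB hB => ?_
    · have hst := strAt_spec hsB' hk (Nat.zero_le 2) hg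
      simp only [Expr.Ok, Expr.eval, Op.eval, hg.idx, (hg.v .kb (by simp)).trans kbB', hst.2,
        add_zero, add_tsub_cancel_right, true_and, and_true]
      exact ⟨⟨by omega, by omega⟩, by omega, fun _ => ⟨by omega, by omega⟩, fun _ => hst.1⟩
    · simp only [Expr.Ok, Expr.eval, hg.idx, hg.arr .rB (by decide), true_and]
      exact ⟨by omega, hB'.val k hk⟩
    have hsB : Loaded M s gB := hsB'.of_eq (hB.v _ (by decide)) (hB.v _ (by decide))
      (hB.arr _ (by decide) (by simp))
    have mB := hB.m.trans (hB'.m.trans (hA.m.trans m₃))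
    have kbB := hB.kb.trans kbB'
    apply Reach.seq
    refine (rankInto_spec (fun j => if j % 3 = 0 then 1 else 0) (smpRank s) hsB.len
      mB kbB hNL hroom' (by decide)
      (fun k _ => by split_ifs <;> omega) (fun k _ => hsmp _)
      (fun k hk g hg => ?_) (fun k hk g hg => ?_)).mono le_rfl fun gC hC => ?_
    · simp only [Expr.Ok, Expr.eval, Op.eval, hg.idx, true_and, and_true]
      exact ⟨⟨by omega, by omega⟩, by omega, fun _ => by omega, fun _ => by omega⟩
    · simp only [Expr.Ok, Expr.eval, hg.idx, hg.arr .smp (by decide), true_and,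
        hB.arr .smp (by decide) (by simp), hB'.arr .smp (by decide) (by simp), smpA]
      exact ⟨by omega, h₃.lt _ (by omega)⟩
    have rA_C : ∀ k < s.length, gC.arr .rA k = rankA s z k := by
      intro k hk
      rw [hC.arr _ (by decide) (by simp), hB.arr _ (by decide) (by simp),
        hB'.arr _ (by decide) (by simp), hA.val k hk]
      rfl
    have rB_C : ∀ k < s.length, gC.arr .rB k = rankB s z k := by
      intro k hk
      rw [hC.arr _ (by decide) (by simp), hB.val k hk]
      rfl
    have hsC : Loaded M s gC := hsB.of_eq (hC.v _ (by decide)) (hC.v _ (by decide))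
      (hC.arr _ (by decide) (by simp))
    -- The three rankings within a single residue class differ only in their arrays, hence a common
    -- specification.
    have sgl : ∀ (c : ℕ) (r o : Arr) (g₀ : Store) (R : ℕ → ℕ), c ≤ 2 → 1 ≤ r.level → 1 ≤ o.level →
        g₀.v .len = s.length → g₀.v .m = s.length → g₀.v .kb = z + 1 →
        (∀ k < s.length, g₀.arr r k = R k) → (∀ k, R k ≤ s.length) →
        Reach M (rankInto (.ifEq (.bin .mod (.var .i) (.lit 3)) (.lit c) (.lit 0) (.lit 1))
          (.get r (.var .i)) o) (500 * (s.length + (z + 1) + 1) + s.length * 80 + 30) g₀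
          (RankState g₀ o s.length (fun j => if j % 3 = c then 0 else 1) R) := by
      intro c r o g₀ R hc hr ho hlen hm hkb hR hRle
      refine (rankInto_spec (fun j => if j % 3 = c then 0 else 1) R hlen hm hkb hNL hroom' ho
        (fun k _ => by split_ifs <;> omega) (fun k _ => (hRle k).trans_lt (by omega))
        (fun k hk g hg => ?_) (fun k hk g hg => ?_)).le ?_
      · simp only [Expr.Ok, Expr.eval, Op.eval, hg.idx, true_and, and_true]
        exact ⟨⟨by omega, by omega⟩, by omega, fun _ => by omega, fun _ => by omega⟩
      · simp only [Expr.Ok, Expr.eval, hg.idx, hg.arr r hr, true_and]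
        exact ⟨by omega, hR k hk⟩
      · simp only [Expr.cost]
        omega
    apply Reach.seq
    refine (sgl 0 .rA .dA gC (rankA s z) (by omega) (by decide) (by decide) hsC.len
      (hC.m.trans mB) (hC.kb.trans kbB) rA_C fun k => pairRank_le k).mono le_rfl fun gD hD => ?_
    apply Reach.seq
    refine (sgl 1 .rA .dB gD (rankA s z) (by omega) (by decide) (by decide)
      ((hD.v _ (by decide)).trans hsC.len)
      (hD.m.trans (hC.m.trans mB)) (hD.kb.trans (hC.kb.trans kbB))
      (fun k hk => by rw [hD.arr _ (by decide) (by simp), rA_C k hk])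
      fun k => pairRank_le k).mono le_rfl fun gE hE => ?_
    apply Reach.seq
    refine (sgl 2 .rB .dC gE (rankB s z) (by omega) (by decide) (by decide)
      ((hE.v _ (by decide)).trans ((hD.v _ (by decide)).trans hsC.len))
      (hE.m.trans (hD.m.trans (hC.m.trans mB))) (hE.kb.trans (hD.kb.trans (hC.kb.trans kbB)))
      (fun k hk => by
        rw [hE.arr _ (by decide) (by simp), hD.arr _ (by decide) (by simp), rB_C k hk])
      fun k => pairRank_le k).mono le_rfl fun gF hF => ?_
    have vals : ∀ k < s.length, gF.arr .rA k = rankA s z k ∧ gF.arr .rB k = rankB s z k ∧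
        gF.arr .rC k = rankC s k ∧ gF.arr .dA k = single s 0 (rankA s z) k ∧
        gF.arr .dB k = single s 1 (rankA s z) k ∧ gF.arr .dC k = single s 2 (rankB s z) k := by
      intro k hk
      refine ⟨?_, ?_, ?_, ?_, ?_, ?_⟩
      · rw [hF.arr _ (by decide) (by simp), hE.arr _ (by decide) (by simp),
          hD.arr _ (by decide) (by simp), rA_C k hk]
      · rw [hF.arr _ (by decide) (by simp), hE.arr _ (by decide) (by simp),
          hD.arr _ (by decide) (by simp), rB_C k hk]
      · rw [hF.arr _ (by decide) (by simp), hE.arr _ (by decide) (by simp),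
          hD.arr _ (by decide) (by simp), hC.val k hk]
        rfl
      · rw [hF.arr _ (by decide) (by simp), hE.arr _ (by decide) (by simp), hD.val k hk]
        rfl
      · rw [hF.arr _ (by decide) (by simp), hE.val k hk]
        rfl
      · rw [hF.val k hk]
        rfl
    have lenF : gF.v .len = s.length := by
      rw [hF.v _ (by decide), hE.v _ (by decide), hD.v _ (by decide), hsC.len]
    refine .map s.length (sufRank s) hNL (fun k g hg => ⟨trivial, by simp [hg.v, lenF]⟩)
      (fun k hk g hg => ?_) fun g hg => ⟨fun r hr hrc => ?_, fun a ha => ?_, ?_, hg.lt⟩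
    · obtain ⟨e1, e2, e3, e4, e5, e6⟩ := vals k hk
      have le1 : rankA s z k ≤ s.length := pairRank_le k
      have le2 : rankB s z k ≤ s.length := pairRank_le k
      have le3 : rankC s k ≤ s.length := pairRank_le k
      rw [sufRank_eq hs.pos hz hk]
      simp only [Expr.Ok, Expr.eval, Op.eval, hg.idx, hg.arr .rA (by simp), hg.arr .rB (by simp),
        hg.arr .rC (by simp), hg.arr .dA (by simp), hg.arr .dB (by simp), hg.arr .dC (by simp), e1, e2,
        e3, e4, e5, e6, true_and, and_true]
      exact ⟨⟨by omega, by omega⟩, by omega, fun _ => ⟨⟨by omega, by omega, by omega⟩, by omega, by omega⟩, fun _ => ⟨⟨by omega, by omega⟩, by omega,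
        fun _ => ⟨⟨by omega, by omega, by omega⟩, by omega, by omega⟩,
        fun _ => ⟨⟨by omega, by omega, by omega⟩, by omega, by omega⟩⟩⟩
    · have hri : r ≠ .i := by rintro rfl; exact absurd hr (by decide)
      rw [hg.v r hri, hF.v r hr, hE.v r hr, hD.v r hr, hC.v r hr, hB.v r hr, hB'.v r hr, hA.v r hr,
        h₃.v r hri, v₂ r hrc, f₁.v r hr]
    · have ha1 : 1 ≤ a.level := by
        rcases ha with rfl | rfl | rfl | ha
        exacts [by decide, by decide, by decide, by omega]
      have hne : a ≠ .srk ∧ a ≠ .dC ∧ a ≠ .dB ∧ a ≠ .dA ∧ a ≠ .rC ∧ a ≠ .rB ∧ a ≠ .rA ∧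
          a ≠ .smp := by
        rcases ha with rfl | rfl | rfl | ha
        · simp
        · simp
        · simp
        · refine ⟨?_, ?_, ?_, ?_, ?_, ?_, ?_, ?_⟩ <;> rintro rfl <;> exact absurd ha (by decide)
      obtain ⟨n1, n2, n3, n4, n5, n6, n7, n8⟩ := hne
      rw [hg.arr a n1, hF.arr a ha1 n2, hE.arr a ha1 n3, hD.arr a ha1 n4, hC.arr a ha1 n5,
        hB.arr a ha1 n6, hB'.arr a ha1 n6, hA.arr a ha1 n7, h₃.arr a n8, a₂, f₁.arr a ha1]
    · rw [hg.io, hF.io, hE.io, hD.io, hC.io, hB.io, hB'.io, hA.io, h₃.io, io₂, f₁.io]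
  · simp only [Expr.cost, Prog.cost, setup, strAt, z]
    ring_nf
    omega

end WordRAM

/-! ### The levels of the recursion -/

namespace SuffixSort

/-- The string after `k` reductions. -/
def level (y : List ℕ) (k : ℕ) : List ℕ := reduce^[k] y

/-- The position of the string after `k` reductions behind the previous ones. -/
def offset (y : List ℕ) (k : ℕ) : ℕ := ∑ j ∈ Finset.range k, (level y j).length

theorem level_succ (y : List ℕ) (k : ℕ) : level y (k + 1) = reduce (level y k) :=
  Function.iterate_succ_apply' _ _ _

theorem level_reduce (y : List ℕ) (k : ℕ) : level (reduce y) k = level y (k + 1) :=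
  (Function.iterate_succ_apply _ _ _).symm

/-- Lengths of reductions depend on the length only, so the numerical recursions `depth` and
`totalLen` describe the actual sequence of strings. -/
theorem sum_level (N : ℕ) : ∀ y : List ℕ, y.length = N →
    (∑ k ∈ Finset.range (depth N + 1), ((level y k).length + 1)) = totalLen N ∧
    (∀ k < depth N, 3 < (level y k).length) ∧ (level y (depth N)).length ≤ 3 := by
  induction N using Nat.strong_induction_on with
  | _ N ih =>
    intro y hy
    rw [depth, totalLen]
    split_ifs with h
    · have hlt : reduceLen N < N := by unfold reduceLen; omega
      obtain ⟨h1, h2, h3⟩ := ih _ hlt (reduce y) (by rw [length_reduce, hy])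
      simp only [level_reduce] at h1 h2 h3
      refine ⟨?_, fun k hk => ?_, h3⟩
      · rw [Finset.sum_range_succ', h1]
        simp [level, hy, add_comm]
      · cases k with
        | zero => simpa [level, hy] using h
        | succ k => exact h2 k (by omega)
    · refine ⟨by simp [level, hy], by simp, by simpa [level, hy] using h⟩

theorem level_pos {y : List ℕ} (hy : ∀ a ∈ y, 0 < a) : ∀ k, ∀ a ∈ level y k, 0 < a
  | 0 => hy
  | k + 1 => fun a ha => by rw [level_succ] at ha; exact pos_of_mem_reduce ha

theorem lt_of_mem_reduce {s : List ℕ} {a : ℕ} (h : a ∈ reduce s) : a < s.length + 3 := by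
  simp only [reduce, List.mem_map, List.mem_range] at h
  obtain ⟨q, -, rfl⟩ := h
  have h1 : triRank s (3 * q + 1) ≤ s.length := pairRank_le _
  have h2 : triRank s (3 * (q - ((s.length + 1) / 3 + 1)) + 2) ≤ s.length := pairRank_le _
  split_ifs <;> omega

/-- Names in a reduced string are below the old length plus 3, and one reduction shrinks the length
only by a bounded factor. A linear bound for the symbols therefore persists, which keeps counting
sort linear on every level. -/
theorem level_bound {y : List ℕ} (hy : ∀ a ∈ y, a < 8 * (y.length + 2)) :
    ∀ k, ∀ a ∈ level y k, a < 8 * ((level y k).length + 2)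
  | 0 => hy
  | k + 1 => fun a ha => by
    rw [level_succ] at ha ⊢
    have := lt_of_mem_reduce ha
    rw [length_reduce]
    unfold reduceLen
    omega

/-- All levels together fit into linear space. The summand `k` comes from the extra symbol per level
in `totalLen`; it also bounds the height of the stack. -/
theorem offset_add_le {y : List ℕ} {k : ℕ} (hk : k ≤ depth y.length) :
    offset y k + (level y k).length + k ≤ 9 * (y.length + 1) := by
  obtain ⟨h1, -, -⟩ := sum_level _ y rfl
  have h2 := totalLen_le y.length
  have h3 : (∑ j ∈ Finset.range (k + 1), ((level y j).length + 1)) ≤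
      ∑ j ∈ Finset.range (depth y.length + 1), ((level y j).length + 1) :=
    Finset.sum_le_sum_of_subset (Finset.range_mono (by omega))
  have h4 : (∑ j ∈ Finset.range (k + 1), ((level y j).length + 1)) =
      offset y k + (level y k).length + (k + 1) := by
    rw [Finset.sum_add_distrib, Finset.sum_range_succ]
    simp [offset]
  omega

theorem length_level_le {y : List ℕ} : ∀ {k : ℕ}, k ≤ depth y.length →
    (level y k).length ≤ y.length
  | 0, _ => le_rfl
  | k + 1, hk => by
    obtain ⟨-, h2, -⟩ := sum_level _ y rfl
    have h3 := h2 k hk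
    have h4 := length_level_le (y := y) (k := k) (by omega)
    rw [level_succ, length_reduce]
    unfold reduceLen
    omega

end SuffixSort

/-! ### Suffix sorting with an explicit stack -/

namespace WordRAM

open SuffixSort

/-- Write the reduced string behind the current one and make it the current string. -/
def descend : Prog :=
  .seq (.put .lens (.var .dep) (.var .len)) <|
  .seq (.put .bases (.var .dep) (.var .b)) <|
  .seq triples <|
  .seq (.set .c (.bin .div (.bin .add (.var .len) (.lit 1)) (.lit 3))) <|
  .seq (.set .m (.bin .add (.bin .add (.var .c) (.lit 1)) (.bin .div (.var .len) (.lit 3)))) <|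
  .seq (.set .b (.bin .add (.var .b) (.var .len))) <|
  .seq (.for .i (.var .m) (.put .str (.bin .add (.var .b) (.var .i))
    (.ifLt (.var .i) (.var .c)
      (.bin .add (.get .rA (.bin .add (.bin .mul (.lit 3) (.var .i)) (.lit 1))) (.lit 2))
      (.ifEq (.var .i) (.var .c) (.lit 1)
        (.bin .add (.get .rA (.bin .add (.bin .mul (.lit 3)
          (.bin .sub (.var .i) (.bin .add (.var .c) (.lit 1)))) (.lit 2))) (.lit 2)))))) <|
  .seq (.set .len (.var .m)) <| .set .dep (.bin .add (.var .dep) (.lit 1))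

structure Descended (s : List ℕ) (h g : Store) : Prop where
  frame : Frame 2 h g
  len : g.v .len = reduceLen s.length
  b : g.v .b = h.v .b + s.length
  dep : g.v .dep = h.v .dep + 1
  old : ∀ k < h.v .b + s.length, g.arr .str k = h.arr .str k
  new : ∀ k < reduceLen s.length, g.arr .str (h.v .b + s.length + k) = (reduce s).getD k 0
  lens : g.arr .lens = Function.update (h.arr .lens) (h.v .dep) s.length
  bases : g.arr .bases = Function.update (h.arr .bases) (h.v .dep) (h.v .b)

theorem descend_spec {M : Machine} {s : List ℕ} {h : Store} (hs : Loaded M s h)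
    (h3 : 3 < s.length) (hdep : h.v .dep < M.L)
    (hroom : h.v .b + s.length + reduceLen s.length ≤ M.L) :
    Reach M descend (30000 * (s.length + 1)) h (Descended s h) := by
  have hB := M.addr
  have hrl : reduceLen s.length = (s.length + 1) / 3 + 1 + s.length / 3 := rfl
  apply Reach.le
  · apply Reach.seq
    refine Reach.of_wp _ ⟨trivial, hdep, trivial, ?_⟩
    apply Reach.seq
    refine Reach.of_wp _ ⟨trivial, hdep, trivial, ?_⟩
    generalize hg₀ : Store.setA (Store.setA h _ _) _ _ = g₀
    have v₀ : g₀.v = h.v := by subst hg₀; rfl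
    have io₀ : g₀.io = h.io := by subst hg₀; rfl
    have lens₀ : g₀.arr .lens = Function.update (h.arr .lens) (h.v .dep) s.length := by
      subst hg₀; simp [hs.len]
    have bases₀ : g₀.arr .bases = Function.update (h.arr .bases) (h.v .dep) (h.v .b) := by
      subst hg₀; simp
    have a₀ : ∀ a, a ≠ .lens → a ≠ .bases → g₀.arr a = h.arr a := by
      subst hg₀; intro a h1 h2; simp [h1, h2]
    clear hg₀
    apply Reach.seq
    refine (triples_spec (hs.of_eq (by rw [v₀]) (by rw [v₀]) (a₀ _ (by simp) (by simp)))).mono le_rfl fun g₁ ⟨v₁, a₁, io₁, r₁⟩ => ?_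
    have len₁ : g₁.v .len = s.length := by rw [v₁ _ (by decide), v₀, hs.len]
    have b₁ : g₁.v .b = h.v .b := by rw [v₁ _ (by decide), v₀]
    have dep₁ : g₁.v .dep = h.v .dep := by rw [v₁ _ (by decide), v₀]
    have str₁ : g₁.arr .str = h.arr .str := by rw [a₁ _ (by decide) (by simp), a₀ _ (by simp) (by simp)]
    have fr₁ : Frame 2 h g₁ := by
      refine ⟨fun r hr => by rw [v₁ r (by omega), v₀], fun a ha => ?_, io₁.trans io₀⟩
      rw [a₁ a (by omega) (by rintro rfl; exact absurd ha (by decide))]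
      rw [a₀ a] <;> (rintro rfl; exact absurd ha (by decide))
    apply Reach.seq
    refine Reach.of_wp (.set _ _) ?_
    simp only [Prog.wp, Expr.Ok, Expr.eval, Op.eval, len₁, true_and]
    refine ⟨⟨⟨by omega, by omega⟩, by omega, by omega⟩, ?_⟩
    apply Reach.seq
    refine Reach.of_wp (.set _ _) ?_
    simp only [Prog.wp, Expr.Ok, Expr.eval, Op.eval, Store.setV, Function.update_self,
      Function.update_apply, reduceCtorEq, if_false, len₁, true_and]
    refine ⟨⟨⟨by omega, by omega⟩, ⟨by omega, by omega⟩, by omega⟩, ?_⟩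
    apply Reach.seq
    refine Reach.of_wp (.set _ _) ?_
    simp only [Prog.wp, Expr.Ok, Expr.eval, Op.eval, Store.setV,
      Function.update_apply, reduceCtorEq, if_false, len₁, b₁, true_and]
    refine ⟨by omega, ?_⟩
    rw [← hrl]
    generalize hg₂ : ({ v := _, arr := g₁.arr, io := g₁.io } : Store) = g₂
    have v₂ : ∀ r, r ≠ .c → r ≠ .m → r ≠ .b → g₂.v r = g₁.v r := by
      subst hg₂; intro r h1 h2 h3; simp [h1, h2, h3]
    have c₂ : g₂.v .c = (s.length + 1) / 3 := by subst hg₂; simp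
    have m₂ : g₂.v .m = reduceLen s.length := by subst hg₂; simp
    have b₂ : g₂.v .b = h.v .b + s.length := by subst hg₂; simp
    have a₂ : g₂.arr = g₁.arr := by subst hg₂; rfl
    have fr₂ : Frame 2 h g₂ := by
      refine ⟨fun r hr => ?_, fun a ha => by rw [a₂, fr₁.arr a ha], by subst hg₂; exact fr₁.io⟩
      rw [v₂ r, fr₁.v r hr] <;> (rintro rfl; exact absurd hr (by decide))
    clear hg₂
    apply Reach.seq
    refine .for (fun k g => Frame 2 h g ∧ (∀ r, r ≠ .i → g.v r = g₂.v r) ∧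
      (∀ a, a ≠ .str → g.arr a = g₂.arr a) ∧
      (∀ j < h.v .b + s.length, g.arr .str j = h.arr .str j) ∧
      ∀ j < k, g.arr .str (h.v .b + s.length + j) = (reduce s).getD j 0) (reduceLen s.length) _
      (by omega) ?_ ?_ (fun k hk g hI hi => Reach.of_wp _ ?_) fun g hI hi => ?_
    · refine ⟨fr₂.setV (by decide) _, fun r hr => by simp [hr], fun _ _ => rfl, fun j hj => ?_, by simp⟩
      simp [a₂, str₁]
    · exact fun k hk g hI hi => ⟨trivial, by simp [hI.2.1, m₂]⟩
    · obtain ⟨hf, hv, ha, hold, hnew⟩ := hI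
      have hc := (hv .c (by simp)).trans c₂
      have hb := (hv .b (by simp)).trans b₂
      have rA : ∀ j < s.length, g.arr .rA j = triRank s j := fun j hj => by
        rw [ha _ (by simp), a₂, r₁ j hj]
      have hle : ∀ j, triRank s j ≤ s.length := fun j => pairRank_le j
      have hl1 := hle (3 * k + 1)
      have hl2 := hle (3 * (k - ((s.length + 1) / 3 + 1)) + 2)
      have hnewk := getD_reduce hk
      simp only [Prog.wp, Expr.Ok, Expr.eval, Op.eval, hi, hc, hb, true_and]
      refine ⟨by omega, by omega, ⟨fun hlt => ?_, fun hge => ⟨fun _ => by omega, fun hne => ?_⟩⟩, ?_⟩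
      · rw [rA _ (by omega)]; omega
      · rw [rA _ (by omega)]; omega
      · refine ⟨by simp [hi], (hf.setA (by decide) _).setV (by decide) _,
          fun r hr => by simp [hr, hv r hr], fun a has => by simp [has, ha a has], fun j hj => ?_,
          fun j hj => ?_⟩
        · have : j ≠ h.v .b + s.length + k := by omega
          simp [this, hold j hj]
        · simp only [Store.setA, Store.setV, Function.update_self]
          rcases (Nat.lt_succ_iff.1 hj).lt_or_eq with hj | rfl
          · rw [Function.update_of_ne (by omega), hnew j hj]
          · rw [Function.update_self, hnewk]
            split_ifs with h1 h2
            · rw [rA _ (by omega)]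
            · rfl
            · rw [rA _ (by omega)]
    · obtain ⟨hf, hv, ha, hold, hnew⟩ := hI
      have hd := (hv .dep (by simp)).trans ((v₂ .dep (by simp) (by simp) (by simp)).trans dep₁)
      refine Reach.of_wp (.seq _ _) ?_
      simp only [Prog.wp, Expr.Ok, Expr.eval, Op.eval, true_and]
      refine ⟨⟨by omega, by simp [hd]; omega⟩, (hf.setV (by decide) _).setV (by decide) _, ?_, ?_, ?_,
        hold, hnew, ?_, ?_⟩
      · simp [hv, m₂]
      · simp [hv, b₂]
      · simp [hd]
      · change g.arr .lens = _
        rw [ha _ (by simp), a₂, a₁ _ (by decide) (by simp), lens₀]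
      · change g.arr .bases = _
        rw [ha _ (by simp), a₂, a₁ _ (by decide) (by simp), bases₀]
  · simp only [Expr.cost, Prog.cost]
    ring_nf
    omega

/-- Take the previous string from the stack and compute the ranks of its suffixes. -/
def ascend : Prog :=
  .seq (.set .dep (.bin .sub (.var .dep) (.lit 1))) <|
  .seq (.set .len (.get .lens (.var .dep))) <| .seq (.set .b (.get .bases (.var .dep))) expand

/-- Suffix sorting: for the string of length `size` in `str` write the ranks of the suffixes to
`srk`. -/
def sufSort : Prog :=
  .seq (.set .len (.var .size)) <| .seq (.set .b (.lit 0)) <| .seq (.set .dep (.lit 0)) <|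
  .seq (.whileLt (.lit 3) (.var .len) descend) <| .seq triples <|
  .seq (.map .i (.var .len) .srk (.get .rA (.var .i))) <| .whileLt (.lit 0) (.var .dep) ascend

/-- The strings of the levels up to `d` are stored, and the positions of the first `e` ones. -/
structure Stack (y : List ℕ) (d e : ℕ) (g : Store) : Prop where
  str : ∀ j ≤ d, ∀ k < (level y j).length, g.arr .str (offset y j + k) = (level y j).getD k 0
  saved : ∀ j < e, g.arr .lens j = (level y j).length ∧ g.arr .bases j = offset y j

theorem Stack.of_eq {y : List ℕ} {d e : ℕ} {g g' : Store} (h : Stack y d e g)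
    (hs : g'.arr .str = g.arr .str) (hl : g'.arr .lens = g.arr .lens)
    (hb : g'.arr .bases = g.arr .bases) : Stack y d e g' :=
  ⟨fun j hj k hk => by rw [hs, h.str j hj k hk], fun j hj => by rw [hl, hb]; exact h.saved j hj⟩

/-- Work linear in the length of each level is linear in total; the 3 pays for a loop test. -/
theorem sum_cost_le (y : List ℕ) (c : ℕ) :
    (∑ k ∈ Finset.range (depth y.length), (c * ((level y k).length + 1) + 3)) ≤
      (c + 3) * (9 * (y.length + 1)) := by
  obtain ⟨h1, -, -⟩ := sum_level _ y rfl
  calc _ ≤ ∑ k ∈ Finset.range (depth y.length), (c + 3) * ((level y k).length + 1) :=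
        Finset.sum_le_sum fun k _ => by ring_nf; omega
    _ = (c + 3) * ∑ k ∈ Finset.range (depth y.length), ((level y k).length + 1) :=
        (Finset.mul_sum _ _ _).symm
    _ ≤ (c + 3) * totalLen y.length := by
        rw [← h1]
        exact Nat.mul_le_mul_left _ (Finset.sum_le_sum_of_subset (Finset.range_mono (by omega)))
    _ ≤ _ := Nat.mul_le_mul_left _ (totalLen_le _)

/-- The first loop descends: before iteration `k` the current string is level `k`, and all levels so
far are stored one behind the other. The last level has at most three symbols, and there the triples
give the ranks. The second loop ascends by `expand`. Arrays of size `20 * (n + 1)` hold the stack,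
of total length at most `9 * (n + 1)`, and the `8 * (n + 2) + 1` counters of counting sort. -/
theorem sufSort_spec {M : Machine} {y : List ℕ} {h : Store} (hsize : h.v .size = y.length)
    (hstr : ∀ k < y.length, h.arr .str k = y.getD k 0) (hpos : ∀ a ∈ y, 0 < a)
    (hbound : ∀ a ∈ y, a < 8 * (y.length + 2)) (hL : 20 * (y.length + 1) ≤ M.L) :
    Reach M sufSort (2000000 * (y.length + 1)) h fun g =>
      Frame 2 h g ∧ ∀ k < y.length, g.arr .srk k = sufRank y k := by
  have hB := M.addr
  obtain ⟨-, hlong, hshort⟩ := sum_level _ y rfl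
  have hoff := fun k (hk : k ≤ depth y.length) => offset_add_le hk
  have hlen := fun k (hk : k ≤ depth y.length) => length_level_le hk
  have loaded : ∀ k ≤ depth y.length, ∀ d e, k ≤ d → ∀ g, Stack y d e g → g.v .b = offset y k →
      g.v .len = (level y k).length → Loaded M (level y k) g := by
    intro k hk d e hd g hst hb hl
    have h1 := hoff k hk
    have h2 := hlen k hk
    exact ⟨hl, fun j hj => by rw [hb, hst.str k hd j hj], by rw [hb]; omega, by omega,
      level_pos hpos k, level_bound hbound k⟩
  have hsucc : ∀ k, offset y (k + 1) = offset y k + (level y k).length := fun k =>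
    Finset.sum_range_succ _ _
  apply Reach.le
  · apply Reach.seq
    refine Reach.of_wp (.set _ _) ⟨trivial, ?_⟩
    apply Reach.seq
    refine Reach.of_wp (.set _ _) ⟨by simp only [Expr.Ok]; omega, ?_⟩
    apply Reach.seq
    refine Reach.of_wp (.set _ _) ⟨by simp only [Expr.Ok]; omega, ?_⟩
    apply Reach.seq
    refine .whileLt (fun k g => Frame 2 h g ∧ Stack y k k g ∧ g.v .dep = k ∧ g.v .b = offset y k ∧
      g.v .len = (level y k).length) (depth y.length)
      (fun k => 30000 * ((level y k).length + 1)) ?_ ?_ ?_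
    · rintro k hk g ⟨hf, hst, hd, hb, hl⟩
      have h3 := hlong k hk
      have h4 := hoff (k + 1) hk
      have h5 := hsucc k
      have h6 : (level y (k + 1)).length = reduceLen (level y k).length := by
        rw [level_succ, length_reduce]
      refine ⟨by simp only [Expr.Ok]; omega, trivial, by simp only [Expr.eval]; omega, ?_⟩
      refine (descend_spec (loaded k hk.le k k le_rfl g hst hb hl) h3 (by omega) (by omega)).mono le_rfl
        fun g' hg' => ⟨hf.trans hg'.frame, ⟨fun j hj i hi => ?_, fun j hj => ?_⟩, ?_, ?_, ?_⟩
      · rcases hj.eq_or_lt with rfl | hj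
        · rw [level_succ] at hi ⊢
          rw [h5, ← hb]
          exact hg'.new i (by rwa [length_reduce] at hi)
        -- Earlier levels end before the place where the new string is written.
        · have : offset y j + (level y j).length ≤ offset y k + (level y k).length := by
            rw [← hsucc, ← hsucc]
            exact Finset.sum_le_sum_of_subset (Finset.range_mono (by omega))
          rw [hg'.old _ (by omega), hst.str j (by omega) i hi]
      · rw [hg'.lens, hg'.bases, hd, hb]
        rcases (Nat.lt_succ_iff.1 hj).eq_or_lt with rfl | hj
        · simp
        · simp [hj.ne, hst.saved j hj]
      · rw [hg'.dep, hd]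
      · rw [hg'.b, hb, h5]
      · rw [hg'.len, h6]
    · rintro g ⟨hf, hst, hd, hb, hl⟩
      refine ⟨by simp only [Expr.Ok]; omega, trivial, by simp only [Expr.eval]; omega, ?_⟩
      have hs := loaded _ le_rfl _ _ le_rfl g hst hb hl
      have hroom := hs.room
      apply Reach.seq
      refine (triples_spec hs).mono (Nat.mul_le_mul_left 20000 (Nat.add_le_add_right
        (hlen _ le_rfl) 1)) fun g₁ ⟨v₁, a₁, io₁, r₁⟩ => ?_
      apply Reach.seq
      refine .map (level y (depth y.length)).length (sufRank (level y (depth y.length)))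
        (by omega) (fun k g hg => ⟨trivial, ?_⟩) (fun k hk g hg => ⟨?_, ?_⟩) fun g₂ h₂ => ?_
      · simp [hg.v, v₁ .len (by decide), hl]
      · simp only [Expr.Ok, Expr.eval, hg.idx, true_and]; omega
      · simp only [Expr.eval, hg.idx]
        rw [hg.arr _ (by simp), r₁ k hk, sufRank_eq_triRank hs.pos hshort hk]
      · have hf₂ : Frame 2 h g₂ := hf.trans <| by
          refine ⟨fun r hr => ?_, fun a ha => ?_, h₂.io.trans io₁⟩
          · rw [h₂.v r (by rintro rfl; exact absurd hr (by decide)), v₁ r (by omega)]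
          · rw [h₂.arr a (by rintro rfl; exact absurd ha (by decide)), a₁ a (by omega)
              (by rintro rfl; exact absurd ha (by decide))]
        -- After `t` ascents, `srk` holds the ranks for level `depth - t`; the stored strings and
        -- lengths are only read.
        refine Reach.whileLt (fun t g => Frame 2 h g ∧ Stack y (depth y.length) (depth y.length) g ∧
          g.v .dep = depth y.length - t ∧ ∀ k < (level y (depth y.length - t)).length,
            g.arr .srk k = sufRank (level y (depth y.length - t)) k) (depth y.length)
          (fun t => 100000 * ((level y (depth y.length - 1 - t)).length + 1) + 20) ?_ ?_ ?_
        · rintro t ht g ⟨hf, hst, hd, hsrk⟩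
          obtain ⟨d, hd'⟩ : ∃ d, depth y.length - t = d + 1 := ⟨depth y.length - t - 1, by omega⟩
          have e1 : depth y.length - 1 - t = d := by omega
          have e2 : depth y.length - (t + 1) = d := by omega
          rw [hd'] at hd hsrk
          simp only [e1, e2]
          have h4 := hoff d (by omega)
          refine ⟨by simp only [Expr.Ok]; omega, trivial, by simp only [Expr.eval]; omega, ?_⟩
          obtain ⟨sl, sb⟩ := hst.saved d (by omega)
          apply Reach.le
          · apply Reach.seq
            refine Reach.of_wp (.set _ _) ?_
            simp only [Prog.wp, Expr.Ok, Expr.eval, Op.eval, hd, add_tsub_cancel_right, true_and]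
            refine ⟨⟨by omega, by omega⟩, ?_⟩
            apply Reach.seq
            refine Reach.of_wp (.set _ _) ?_
            simp only [Prog.wp, Expr.Ok, Expr.eval, Store.setV, Function.update_self, true_and, sl]
            refine ⟨by omega, ?_⟩
            apply Reach.seq
            refine Reach.of_wp (.set _ _) ?_
            simp only [Prog.wp, Expr.Ok, Expr.eval, Store.setV, Function.update_self,
              Function.update_apply, reduceCtorEq, if_false, true_and, sb]
            refine ⟨by omega, ?_⟩
            generalize hg₂ : ({ v := _, arr := g.arr, io := g.io } : Store) = g₃
            have v₃ : ∀ r, r ≠ .dep → r ≠ .len → r ≠ .b → g₃.v r = g.v r := by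
              subst hg₂; intro r h1 h2 h3; simp [h1, h2, h3]
            have dep₃ : g₃.v .dep = d := by subst hg₂; simp
            have len₃ : g₃.v .len = (level y d).length := by subst hg₂; simp
            have b₃ : g₃.v .b = offset y d := by subst hg₂; simp
            have a₃ : g₃.arr = g.arr := by subst hg₂; rfl
            have io₃ : g₃.io = g.io := by subst hg₂; rfl
            clear hg₂
            have hst₃ : Stack y (depth y.length) (depth y.length) g₃ :=
              hst.of_eq (by rw [a₃]) (by rw [a₃]) (by rw [a₃])
            refine (expand_spec (loaded d (by omega) _ _ (by omega) g₃ hst₃ b₃ len₃) fun k hk => ?_).mono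
              le_rfl fun g₄ ⟨v₄, a₄, io₄, r₄⟩ => ⟨?_, ?_, ?_, r₄⟩
            · rw [a₃, hsrk k (by rw [level_succ, length_reduce]; exact hk), level_succ]
            · refine hf.trans ⟨fun r hr => ?_, fun a ha => ?_, io₄.trans io₃⟩
              · rw [v₄ r (by omega) (by rintro rfl; exact absurd hr (by decide)), v₃ r] <;>
                  (rintro rfl; exact absurd hr (by decide))
              · rw [a₄ a (by omega), a₃]
            · exact hst₃.of_eq (a₄ _ (by simp)) (a₄ _ (by simp)) (a₄ _ (by simp))
            · rw [v₄ _ (by decide) (by simp), dep₃]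
          · simp only [Expr.cost, Prog.cost]
            omega
        · rintro g ⟨hf, -, hd, hsrk⟩
          rw [Nat.sub_self] at hd hsrk
          exact ⟨by simp only [Expr.Ok]; omega, trivial, by simp only [Expr.eval]; omega, hf, hsrk⟩
        · have stk : ∀ a, 1 ≤ a.level → a ≠ .rA → a ≠ .srk → g₂.arr a = g.arr a := fun a h1 h2 h3 => by
            rw [h₂.arr a h3, a₁ a h1 h2]
          refine ⟨hf₂, hst.of_eq (stk _ (by decide) (by simp) (by simp))
            (stk _ (by decide) (by simp) (by simp)) (stk _ (by decide) (by simp) (by simp)), ?_, ?_⟩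
          · rw [h₂.v _ (by simp), v₁ _ (by decide), hd, Nat.sub_zero]
          · rw [Nat.sub_zero]; exact h₂.lt
    · refine ⟨((Frame.refl 2 h).setV (by decide) _).setV (by decide) _ |>.setV (by decide) _,
        ⟨fun j hj k hk => ?_, by simp⟩, by simp, by simp [offset], by simp [level, hsize]⟩
      obtain rfl : j = 0 := by omega
      simpa [offset, level] using hstr k hk
  · have s1 := sum_cost_le y 30000
    have s2 : (∑ k ∈ Finset.range (depth y.length),
        (100000 * ((level y (depth y.length - 1 - k)).length + 1) + 20 + 3)) ≤
        100023 * (9 * (y.length + 1)) := by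
      -- The ascents meet the levels in reverse order.
      rw [Finset.sum_range_reflect (fun k => 100000 * ((level y k).length + 1) + 20 + 3)]
      refine le_trans (Finset.sum_le_sum fun k _ => ?_) (sum_cost_le y 100020)
      omega
    have e3 : (1 + 1 + 1 : ℕ) = 3 := rfl
    simp only [Expr.cost, Prog.cost, e3]
    have h0 := hshort
    have h1 := hlen _ le_rfl
    omega

end WordRAM

/-! ### Suffixes of parameterized strings in layers -/

namespace PString

variable {P : Finset ℕ} {x : List ℕ}

/-- The position `p` is the previous occurrence of the symbol at position `j`. -/
def IsLast (x : List ℕ) (j p : ℕ) : Prop :=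
  p < j ∧ x.getD p 0 = x.getD j 0 ∧ ∀ k, p < k → k < j → x.getD k 0 ≠ x.getD j 0

/-- The parameterized symbols at the positions `i, …, j - 1`. -/
def seen (P : Finset ℕ) (x : List ℕ) (i j : ℕ) : Finset ℕ :=
  ((Finset.Ico i j).image fun k => x.getD k 0) ∩ P

theorem mem_seen {i j a : ℕ} : a ∈ seen P x i j ↔ (∃ k, i ≤ k ∧ k < j ∧ x.getD k 0 = a) ∧ a ∈ P := by
  simp [seen, and_assoc]

theorem isLast_or_fresh (x : List ℕ) (j : ℕ) :
    (∃ p, IsLast x j p) ∨ ∀ k < j, x.getD k 0 ≠ x.getD j 0 := by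
  by_cases h : ∃ k < j, x.getD k 0 = x.getD j 0
  · left
    let S := (Finset.range j).filter fun k => x.getD k 0 = x.getD j 0
    have hS : S.Nonempty := by
      obtain ⟨k, hk, he⟩ := h
      exact ⟨k, by simp [S, hk, -List.getD_eq_getElem?_getD, he]⟩
    have hm := S.max'_mem hS
    simp only [S, Finset.mem_filter, Finset.mem_range] at hm
    refine ⟨S.max' hS, hm.1, hm.2, fun k hk hkj he => absurd (S.le_max' k ?_) (not_le.2 hk)⟩
    simp [S, hkj, -List.getD_eq_getElem?_getD, he]
  · right
    intro k hk he
    exact h ⟨k, hk, he⟩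

theorem length_prev (P : Finset ℕ) (x : List ℕ) : (prev P x).length = x.length := by
  simp [prev]

theorem mem_earlier {i k a : ℕ} (hi : i < x.length) :
    k ∈ earlier x i a ↔ k < i ∧ x.getD k 0 = a := by
  simp only [earlier, Finset.mem_filter, Finset.mem_range]
  refine and_congr_right fun hk => ?_
  rw [List.getD_eq_getElem _ _ (hk.trans hi), List.getElem?_eq_getElem (hk.trans hi), Option.some_inj]

theorem getD_prev {j : ℕ} (hj : j < x.length) : (prev P x).getD j 0 =
    if x.getD j 0 ∈ P then
      if h : (earlier x j (x.getD j 0)).Nonempty then j - (earlier x j (x.getD j 0)).max' h else 0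
    else x.getD j 0 := by
  rw [List.getD_eq_getElem _ _ (by rwa [length_prev]), List.getD_eq_getElem _ _ hj]
  simp [prev]

theorem prev_static {j : ℕ} (hj : j < x.length) (h : x.getD j 0 ∉ P) :
    (prev P x).getD j 0 = x.getD j 0 := by
  rw [getD_prev hj, if_neg h]

theorem prev_last {j p : ℕ} (hj : j < x.length) (h : x.getD j 0 ∈ P) (hp : IsLast x j p) :
    (prev P x).getD j 0 = j - p := by
  have hmem : p ∈ earlier x j (x.getD j 0) := (mem_earlier hj).2 ⟨hp.1, hp.2.1⟩
  rw [getD_prev hj, if_pos h, dif_pos ⟨p, hmem⟩]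
  congr 1
  refine le_antisymm (Finset.max'_le _ _ _ fun k hk => not_lt.1 fun hlt => ?_)
    (Finset.le_max' _ _ hmem)
  rw [mem_earlier hj] at hk
  exact hp.2.2 k hlt hk.1 hk.2

theorem prev_fresh {j : ℕ} (hj : j < x.length) (h : x.getD j 0 ∈ P)
    (hp : ∀ k < j, x.getD k 0 ≠ x.getD j 0) : (prev P x).getD j 0 = 0 := by
  rw [getD_prev hj, if_pos h, dif_neg]
  rintro ⟨k, hk⟩
  rw [mem_earlier hj] at hk
  exact hp k hk.1 hk.2

theorem getD_drop (x : List ℕ) (i k : ℕ) : (x.drop i).getD k 0 = x.getD (i + k) 0 := by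
  simp

/-- The code of the symbol at position `j`, and the number of distinct parameterized symbols since
its previous occurrence. -/
structure CodeAt (P : Finset ℕ) (x : List ℕ) (c e : ℕ → ℕ) (j : ℕ) : Prop where
  static : x.getD j 0 ∉ P →
    c j = x.length + rankOf x.length (fun k => x.getD k 0) j ∧ e j = 0
  last : ∀ p, x.getD j 0 ∈ P → IsLast x j p → c j = j - p ∧ e j = (seen P x p j).card
  fresh : x.getD j 0 ∈ P → (∀ k < j, x.getD k 0 ≠ x.getD j 0) → c j = 0 ∧ e j = x.length + 2

theorem card_seen_le (P : Finset ℕ) (x : List ℕ) (i j : ℕ) : (seen P x i j).card ≤ j - i := by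
  refine (Finset.card_le_card Finset.inter_subset_left).trans (Finset.card_image_le.trans ?_)
  simp

theorem card_seen_mono {i j i' j' : ℕ} (hi : i' ≤ i) (hj : j ≤ j') :
    (seen P x i j).card ≤ (seen P x i' j').card := by
  refine Finset.card_le_card fun a ha => ?_
  rw [mem_seen] at ha ⊢
  obtain ⟨⟨k, h1, h2, h3⟩, h4⟩ := ha
  exact ⟨⟨k, by omega, by omega, h3⟩, h4⟩

theorem seen_succ {i j : ℕ} (hij : i ≤ j) : seen P x i (j + 1) =
    if x.getD j 0 ∈ P then insert (x.getD j 0) (seen P x i j) else seen P x i j := by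
  rw [seen, ← Finset.insert_Ico_right_eq_Ico_add_one hij, Finset.image_insert]
  split_ifs with h
  · rw [Finset.insert_inter_of_mem h, seen]
  · rw [Finset.insert_inter_of_notMem h, seen]

/-- The symbol at position `j` is the first occurrence in `x[i..n]` if its number is larger than
the number of parameterized symbols in between. -/
theorem CodeAt.lt_iff {c e : ℕ → ℕ} {i j : ℕ} (h : CodeAt P x c e j) (hj : j < x.length)
    (hij : i ≤ j) : (seen P x i j).card < e j ↔
      x.getD j 0 ∈ P ∧ ∀ k, i ≤ k → k < j → x.getD k 0 ≠ x.getD j 0 := by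
  by_cases hP : x.getD j 0 ∈ P
  · rcases isLast_or_fresh x j with ⟨p, hp⟩ | hf
    · rw [(h.last p hP hp).2]
      constructor
      -- An occurrence at or after `i` would put the last occurrence `p` inside the suffix, and then
      -- the symbols seen since `i` would be at least as many as those seen since `p`.
      · refine fun hlt => ⟨hP, fun k hk hkj he => ?_⟩
        have hkp : k ≤ p := not_lt.1 fun hlt => hp.2.2 k hlt hkj he
        exact absurd (card_seen_mono (P := P) (x := x) (hk.trans hkp) (le_refl j)) (not_le.2 hlt)
      · rintro ⟨-, hno⟩
        have hpi : p < i := not_le.1 fun hle => hno p hle hp.1 hp.2.1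
        -- If `p` lies before `i`, the range from `p` has everything that the range from `i` has,
        -- and the symbol at `j` in addition.
        refine Finset.card_lt_card (Finset.ssubset_iff_of_subset (fun a ha => ?_) |>.2
          ⟨x.getD j 0, ?_, ?_⟩)
        · rw [mem_seen] at ha ⊢
          obtain ⟨⟨k, h1, h2, h3⟩, h4⟩ := ha
          exact ⟨⟨k, by omega, by omega, h3⟩, h4⟩
        · exact mem_seen.2 ⟨⟨p, le_rfl, hp.1, hp.2.1⟩, hP⟩
        · rw [mem_seen]
          rintro ⟨⟨k, h1, h2, h3⟩, -⟩
          exact hno k h1 h2 h3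
    · rw [(h.fresh hP hf).2]
      have := card_seen_le P x i j
      exact ⟨fun _ => ⟨hP, fun k _ hk => hf k hk⟩, fun _ => by omega⟩
  · rw [(h.static hP).2]
    exact ⟨fun h => absurd h (Nat.not_lt_zero _), fun h => absurd h.1 hP⟩

/-- The counter is updated by the same test that decides about zeros. So a scan of the suffix can
maintain it without knowing where the suffix starts. -/
theorem CodeAt.card_seen_succ {c e : ℕ → ℕ} {i j : ℕ} (h : CodeAt P x c e j) (hj : j < x.length)
    (hij : i ≤ j) : (seen P x i (j + 1)).card =
      if (seen P x i j).card < e j then (seen P x i j).card + 1 else (seen P x i j).card := by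
  simp only [h.lt_iff hj hij]
  rw [seen_succ hij]
  by_cases hP : x.getD j 0 ∈ P
  · rw [if_pos hP]
    split_ifs with hc
    · refine Finset.card_insert_of_notMem ?_
      rw [mem_seen]
      rintro ⟨⟨k, h1, h2, h3⟩, -⟩
      exact hc.2 k h1 h2 h3
    · rw [Finset.insert_eq_of_mem]
      rw [mem_seen]
      by_contra hno
      exact hc ⟨hP, fun k h1 h2 h3 => hno ⟨⟨k, h1, h2, h3⟩, hP⟩⟩
  · rw [if_neg hP, if_neg fun hc => hP hc.1]

/-- Cutting off a prefix changes the encoding only at symbols whose previous occurrence was cut off,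
and it makes them `0`; all other distances are unaffected by the shift. -/
theorem CodeAt.prev_drop {c e : ℕ → ℕ} {i j : ℕ} (h : CodeAt P x c e j) (hj : j < x.length)
    (hij : i ≤ j) : (prev P (x.drop i)).getD (j - i) 0 =
      if (seen P x i j).card < e j then 0 else (prev P x).getD j 0 := by
  simp only [h.lt_iff hj hij]
  have hj' : j - i < (x.drop i).length := by rw [List.length_drop]; omega
  have hget : (x.drop i).getD (j - i) 0 = x.getD j 0 := by
    rw [getD_drop, Nat.add_sub_cancel' hij]
  by_cases hP : x.getD j 0 ∈ P
  · split_ifs with hc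
    · refine prev_fresh hj' (by rwa [hget]) fun k hk => ?_
      rw [hget, getD_drop]
      exact hc.2 _ (by omega) (by omega)
    · rcases isLast_or_fresh x j with ⟨p, hp⟩ | hf
      · have hip : i ≤ p := by
          by_contra hlt
          exact hc ⟨hP, fun k h1 h2 => hp.2.2 k (by omega) h2⟩
        rw [prev_last hj hP hp, prev_last (p := p - i) hj' (by rwa [hget])]
        · have := hp.1
          omega
        · refine ⟨by have := hp.1; omega, ?_, fun k h1 h2 => ?_⟩
          · rw [hget, getD_drop, Nat.add_sub_cancel' hip, hp.2.1]
          · rw [hget, getD_drop]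
            exact hp.2.2 _ (by omega) (by omega)
      · exact absurd ⟨hP, fun k _ hk => hf k hk⟩ hc
  · rw [if_neg fun hc => hP hc.1, prev_static hj hP, prev_static hj' (by rwa [hget]), hget]

/-- The string of the values `g` from position `j` on, of length `m`, where the value at a position
`k` with `e k > r` is replaced by `0`, and `r` is increased by one after such a position. -/
def layer (e g : ℕ → ℕ) : ℕ → ℕ → ℕ → List ℕ
  | 0, _, _ => []
  | m + 1, r, j =>
    if r < e j then 0 :: layer e g m (r + 1) (j + 1) else g j :: layer e g m r (j + 1)

theorem length_layer (e g : ℕ → ℕ) : ∀ m r j, (layer e g m r j).length = m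
  | 0, _, _ => rfl
  | m + 1, r, j => by
    rw [layer]
    split_ifs <;> simp [length_layer e g m]

theorem drop_eq_cons {l : List ℕ} {k : ℕ} (hk : k < l.length) :
    l.drop k = l.getD k 0 :: l.drop (k + 1) := by
  rw [List.drop_eq_getElem_cons hk, List.getD_eq_getElem _ _ hk]

/-- The starting position `i` enters the rest of an encoded suffix only through the number of
parameterized symbols seen so far. -/
theorem layer_eq_drop {c e : ℕ → ℕ} (h : ∀ j < x.length, CodeAt P x c e j) (i : ℕ) :
    ∀ m j, i ≤ j → j + m = x.length →
      layer e (fun k => (prev P x).getD k 0) m (seen P x i j).card j =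
        (prev P (x.drop i)).drop (j - i) := by
  intro m
  induction m with
  | zero =>
    intro j hij hj
    rw [layer, List.drop_eq_nil_of_le]
    rw [length_prev, List.length_drop]
    omega
  | succ m ih =>
    intro j hij hj
    have hj' : j < x.length := by omega
    have h1 := (h j hj').card_seen_succ hj' hij
    have h2 := (h j hj').prev_drop hj' hij
    have h3 := ih (j + 1) (by omega) (by omega)
    rw [drop_eq_cons (by rw [length_prev, List.length_drop]; omega), h2,
      show j - i + 1 = j + 1 - i by omega, ← h3, h1, layer]
    split_ifs <;> rfl

theorem layer_zero {c e : ℕ → ℕ} (h : ∀ j < x.length, CodeAt P x c e j) {j : ℕ}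
    (hj : j ≤ x.length) :
    layer e (fun k => (prev P x).getD k 0) (x.length - j) 0 j = prev P (x.drop j) := by
  simpa [seen] using layer_eq_drop h j (x.length - j) j le_rfl (by omega)

/-- If zeros are only written where `g` is `0` anyway, the layer is a plain piece of `g`, whatever
the thresholds are. -/
theorem layer_congr {e e' g : ℕ → ℕ} {n : ℕ} (m : ℕ) : ∀ r r' j, j + m = n →
    (∀ k < n, r < e k → g k = 0) → (∀ k < n, r' < e' k → g k = 0) →
    layer e g m r j = layer e' g m r' j := by
  induction m with
  | zero => intros; rfl
  | succ m ih =>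
    intro r r' j hj h h'
    have hr : ∀ k < n, r + 1 < e k → g k = 0 := fun k hk hlt => h k hk (by omega)
    have hr' : ∀ k < n, r' + 1 < e' k → g k = 0 := fun k hk hlt => h' k hk (by omega)
    rw [layer, layer]
    have h1 := h j (by omega)
    have h2 := h' j (by omega)
    split_ifs with c1 c2 c2
    · rw [ih _ _ _ (by omega) hr hr']
    · rw [ih _ _ _ (by omega) hr h', h1 c1]
    · rw [ih _ _ _ (by omega) h hr', h2 c2]
    · rw [ih _ _ _ (by omega) h h']

/-! ### Reducing a layer to ordinary suffix sorting -/

/-- The string in which the rest of the layer after the next zero is represented by one symbol. -/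
def layerString (n r z : ℕ) (e c s : ℕ → ℕ) : List ℕ :=
  (List.range n).map fun j => if r < e j then s (j + 1) else z + c j

theorem length_layerString (n r z : ℕ) (e c s : ℕ → ℕ) :
    (layerString n r z e c s).length = n := by simp [layerString]

theorem getD_layerString {n r z j : ℕ} {e c s : ℕ → ℕ} (hj : j < n) :
    (layerString n r z e c s).getD j 0 = if r < e j then s (j + 1) else z + c j := by
  simp [layerString, hj]

/-- At two zeros, different symbols `s` decide exactly as the rests of the layer do, and equal ones
occur only at the same position, where both comparisons are trivial. A zero against a nonzero value
is decided by the gap at `z`. Two nonzero values compare by their codes, and only if these are equal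
does the induction continue. -/
theorem layerString_lt {n r z : ℕ} {e g c s : ℕ → ℕ} (hsz : ∀ j < n, r < e j → s (j + 1) < z)
    (hs : ∀ j < n, ∀ k < n, r < e j → r < e k → (s (j + 1) < s (k + 1) ↔
      layer e g (n - (j + 1)) (r + 1) (j + 1) < layer e g (n - (k + 1)) (r + 1) (k + 1)))
    (hinj : ∀ j < n, ∀ k < n, r < e j → r < e k → s (j + 1) = s (k + 1) → j = k)
    (hc : ∀ j < n, ∀ k < n, c j < c k ↔ g j < g k)
    (hg : ∀ j < n, ∀ k < n, r < e j → ¬ r < e k → 0 < g k) :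
    ∀ m j k, j + m = n → k ≤ n →
      ((layerString n r z e c s).drop j < (layerString n r z e c s).drop k ↔
        layer e g (n - j) r j < layer e g (n - k) r k) := by
  intro m
  induction m with
  | zero =>
    intro j k hj hk
    obtain rfl : j = n := by omega
    rw [List.drop_eq_nil_of_le (by rw [length_layerString]), Nat.sub_self, layer]
    rcases hk.eq_or_lt with rfl | hk
    · rw [List.drop_eq_nil_of_le (by rw [length_layerString]), Nat.sub_self, layer]
    · rw [drop_eq_cons (by rwa [length_layerString])]
      obtain ⟨d, hd⟩ : ∃ d, j - k = d + 1 := ⟨j - k - 1, by omega⟩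
      rw [hd, layer]
      split_ifs <;> simp
  | succ m ih =>
    intro j k hj hk
    have hjn : j < n := by omega
    obtain ⟨d, hd⟩ : ∃ d, n - j = d + 1 := ⟨n - j - 1, by omega⟩
    have hd1 : n - (j + 1) = d := by omega
    rcases hk.eq_or_lt with hk | hk
    · rw [hk, List.drop_eq_nil_of_le (as := layerString n r z e c s) (i := n)
        (by rw [length_layerString]), Nat.sub_self, layer.eq_1 e g r n]
      exact iff_of_false (List.not_lt_nil _) (List.not_lt_nil _)
    obtain ⟨d', hd'⟩ : ∃ d, n - k = d + 1 := ⟨n - k - 1, by omega⟩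
    have hd1' : n - (k + 1) = d' := by omega
    have h1 := hs j hjn k hk
    have h2 := ih (j + 1) (k + 1) (by omega) hk
    rw [hd1, hd1'] at h1 h2
    rw [drop_eq_cons (by rwa [length_layerString]),
      drop_eq_cons (k := k) (by rwa [length_layerString]), hd, hd', layer, layer,
      getD_layerString hjn, getD_layerString hk, List.cons_lt_cons_iff, h2]
    have hz1 := hsz j hjn
    have hz2 := hsz k hk
    by_cases c1 : r < e j <;> by_cases c2 : r < e k <;>
      simp only [c1, c2, if_true, if_false, List.cons_lt_cons_iff]
    · by_cases he : s (j + 1) = s (k + 1)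
      · obtain rfl : j = k := hinj _ hjn _ hk c1 c2 he
        obtain rfl : d = d' := by omega
        simp
      · simp [he, h1 c1 c2]
    · have := hg j hjn k hk c1 c2
      have := hz1 c1
      simp only [*, true_or, iff_true]
      left; omega
    · have := hg k hk j hjn c2 c1
      have := hz2 c2
      refine iff_of_false ?_ ?_ <;> rintro (h | h) <;> omega
    · have h3 := hc j hjn k hk
      have h4 := hc k hk j hjn
      have h5 : z + c j = z + c k ↔ g j = g k := by omega
      rw [h5, add_lt_add_iff_left, h3]

/-- The ranks of the strings of a layer. -/
def layerRank (P : Finset ℕ) (x : List ℕ) (e : ℕ → ℕ) (r j : ℕ) : ℕ :=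
  rankOf x.length (fun k => layer e (fun i => (prev P x).getD i 0) (x.length - k) r k) j

/-- Distances are below `n`, static codes start at `n`, and static symbols themselves exceed `n`;
hence small codes reproduce the order of the encoding. -/
theorem CodeAt.lt_code {c e : ℕ → ℕ} (h : ∀ j < x.length, CodeAt P x c e j)
    (hP : ∀ a ∈ x, a ∉ P → x.length < a) : ∀ j < x.length, ∀ k < x.length,
      c j < c k ↔ (prev P x).getD j 0 < (prev P x).getD k 0 := by
  have param : ∀ j < x.length, x.getD j 0 ∈ P → c j = (prev P x).getD j 0 ∧ c j < x.length := by
    intro j hj hx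
    rcases isLast_or_fresh x j with ⟨p, hp⟩ | hf
    · rw [prev_last hj hx hp, ((h j hj).last p hx hp).1]
      exact ⟨rfl, by omega⟩
    · rw [prev_fresh hj hx hf, ((h j hj).fresh hx hf).1]
      exact ⟨rfl, by omega⟩
  have static : ∀ j < x.length, x.getD j 0 ∉ P → (prev P x).getD j 0 = x.getD j 0 ∧
      c j = x.length + rankOf x.length (fun k => x.getD k 0) j ∧ x.length < x.getD j 0 := by
    intro j hj hx
    refine ⟨prev_static hj hx, ((h j hj).static hx).1, hP _ ?_ hx⟩
    rw [List.getD_eq_getElem _ _ hj]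
    exact List.getElem_mem hj
  intro j hj k hk
  by_cases h1 : x.getD j 0 ∈ P <;> by_cases h2 : x.getD k 0 ∈ P
  · rw [(param j hj h1).1, (param k hk h2).1]
  · obtain ⟨a1, a2⟩ := param j hj h1
    obtain ⟨b1, b2, b3⟩ := static k hk h2
    omega
  · obtain ⟨a1, a2⟩ := param k hk h2
    obtain ⟨b1, b2, b3⟩ := static j hj h1
    omega
  · obtain ⟨a1, a2, -⟩ := static j hj h1
    obtain ⟨b1, b2, -⟩ := static k hk h2
    rw [a1, b1, a2, b2, add_lt_add_iff_left, rankOf_lt_rankOf hj]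

theorem CodeAt.code_lt {c e : ℕ → ℕ} {j : ℕ} (h : CodeAt P x c e j) (hj : j < x.length) :
    c j < 2 * x.length := by
  by_cases hx : x.getD j 0 ∈ P
  · rcases isLast_or_fresh x j with ⟨p, hp⟩ | hf
    · rw [(h.last p hx hp).1]; omega
    · rw [(h.fresh hx hf).1]; omega
  · rw [(h.static hx).1]
    have := rankOf_lt (κ := fun k => x.getD k 0) hj
    omega

/-- Once the counter has reached the number of all parameterized symbols, only first occurrences in
the whole string pass the test. -/
theorem prev_eq_zero_of_lt {c e : ℕ → ℕ} {r : ℕ} (h : ∀ j < x.length, CodeAt P x c e j)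
    (hr : (seen P x 0 x.length).card ≤ r) {j : ℕ} (hj : j < x.length) (hlt : r < e j) :
    (prev P x).getD j 0 = 0 := by
  have h1 : (seen P x 0 j).card < e j := ((card_seen_mono le_rfl hj.le).trans hr).trans_lt hlt
  rw [(h j hj).lt_iff hj (Nat.zero_le _)] at h1
  exact prev_fresh hj h1.1 fun k hk => h1.2 k (Nat.zero_le _) hk

open SuffixSort in
/-- The suffix ranks of the plain string are those of the last layer. -/
theorem sufRank_base {c e : ℕ → ℕ} {r : ℕ} (h : ∀ j < x.length, CodeAt P x c e j)
    (hP : ∀ a ∈ x, a ∉ P → x.length < a) (hr : (seen P x 0 x.length).card ≤ r) {k : ℕ}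
    (hk : k < x.length) :
    sufRank (layerString x.length 0 1 (fun _ => 0) c fun _ => 0) k = layerRank P x e r k := by
  unfold sufRank layerRank
  rw [length_layerString]
  refine rankOf_congr fun j hj => ?_
  have := layerString_lt (n := x.length) (r := 0) (z := 1) (e := fun _ => 0) (s := fun _ => 0)
    (g := fun i => (prev P x).getD i 0) (by simp) (by simp) (by simp) (CodeAt.lt_code h hP)
    (by simp) (x.length - j) j k (by omega) hk.le
  -- With threshold `0` everywhere nothing is replaced, and in the last layer only zeros are
  -- replaced by zeros.
  rw [this, layer_congr (x.length - j) 0 r j (by omega) (by simp)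
      fun k hk => prev_eq_zero_of_lt h hr hk,
    layer_congr (x.length - k) 0 r k (by omega) (by simp) fun k hk => prev_eq_zero_of_lt h hr hk]

/-- The length of a string of a layer determines its position. This makes ranks within a layer
injective. -/
theorem length_eq_of_layer {e g : ℕ → ℕ} {n r r' j k : ℕ} (hj : j ≤ n) (hk : k ≤ n)
    (h : layer e g (n - j) r j = layer e g (n - k) r' k) : j = k := by
  have := congrArg List.length h
  rw [length_layer, length_layer] at this
  omega

/-- The symbol that represents the rest of a layer. -/
def restCode (n : ℕ) (R : ℕ → ℕ) (j : ℕ) : ℕ := if j < n then R j + 2 else 1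

open SuffixSort in
/-- The ranks of a layer are the suffix ranks of a string that is made from the ranks of the next
layer. -/
theorem sufRank_layer {c e : ℕ → ℕ} {r : ℕ} (h : ∀ j < x.length, CodeAt P x c e j)
    (hP : ∀ a ∈ x, a ∉ P → x.length < a) (hr : r ≤ x.length) {k : ℕ} (hk : k < x.length) :
    sufRank (layerString x.length r (x.length + 3) e c
      (restCode x.length (layerRank P x e (r + 1)))) k = layerRank P x e r k := by
  unfold sufRank
  conv_rhs => unfold layerRank
  rw [length_layerString]
  refine rankOf_congr fun j hj => ?_
  have hlt : ∀ j < x.length, layerRank P x e (r + 1) j < x.length := fun j hj => rankOf_lt hj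
  refine layerString_lt (fun j hj _ => ?_) (fun j hj k hk _ _ => ?_) (fun j hj k hk _ _ => ?_)
    (CodeAt.lt_code h hP) (fun j hj k hk _ h2 => ?_) (x.length - j) j k (by omega) hk.le
  · have := hlt (j + 1)
    unfold restCode
    split_ifs <;> omega
  · unfold restCode
    split_ifs with h1 h2 h2
    · rw [add_lt_add_iff_right, layerRank, layerRank, rankOf_lt_rankOf h1]
    · rw [show x.length - (k + 1) = 0 by omega, layer.eq_1]
      exact iff_of_false (by omega) (List.not_lt_nil _)
    · obtain ⟨d, hd⟩ : ∃ d, x.length - (k + 1) = d + 1 := ⟨x.length - (k + 1) - 1, by omega⟩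
      rw [show x.length - (j + 1) = 0 by omega, layer.eq_1, hd, layer]
      refine iff_of_true (by omega) ?_
      split_ifs <;> exact List.nil_lt_cons _ _
    · rw [show x.length - (k + 1) = 0 by omega, show x.length - (j + 1) = 0 by omega]
      simp [layer]
  · unfold restCode
    split_ifs with h1 h2 h2 <;> intro he
    · rw [add_left_inj, layerRank, layerRank, rankOf_inj h1 h2] at he
      have := length_eq_of_layer h1.le h2.le he
      omega
    · omega
    · omega
    · omega
  -- A position that is not zeroed has a positive value: a first occurrence has threshold `n + 2`,
  -- larger than `r`, so it would be zeroed; distances and static symbols are positive.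
  · by_cases hx : x.getD k 0 ∈ P
    · rcases isLast_or_fresh x k with ⟨p, hp⟩ | hf
      · rw [prev_last hk hx hp]
        have := hp.1
        omega
      · have := ((h k hk).fresh hx hf).2
        omega
    · rw [prev_static hk hx]
      have := hP (x.getD k 0) (by rw [List.getD_eq_getElem _ _ hk]; exact List.getElem_mem hk) hx
      omega

theorem layerRank_surj (P : Finset ℕ) (x : List ℕ) (e : ℕ → ℕ) (r : ℕ) :
    ∀ p < x.length, ∃ j < x.length, layerRank P x e r j = p :=
  rankOf_surj fun _ hi _ hj h => length_eq_of_layer hi.le hj.le h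

/-- Encoded suffixes have different lengths, hence are distinct, so counting smaller strings in the
set is counting starting positions. -/
theorem isNthSmallest_iff {c e : ℕ → ℕ} (h : ∀ j < x.length, CodeAt P x c e j) {i j : ℕ}
    (hj : j < x.length) :
    IsNthSmallest (prevSuffixes P x) i (prev P (suffixFrom x (j + 1))) ↔
      layerRank P x e 0 j + 1 = i := by
  have hinj : Set.InjOn (fun k => prev P (suffixFrom x (k + 1))) (Finset.range x.length) := by
    intro a ha b hb hab
    have := congrArg List.length hab
    simp only [Finset.coe_range, Set.mem_Iio, suffixFrom, length_prev, List.length_drop] at *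
    omega
  have himage : prevSuffixes P x =
      (Finset.range x.length).image fun k => prev P (suffixFrom x (k + 1)) := by
    ext u
    simp only [prevSuffixes, Finset.mem_image, Finset.mem_Icc, Finset.mem_range]
    constructor
    · rintro ⟨k, hk, rfl⟩
      exact ⟨k - 1, by omega, by rw [Nat.sub_add_cancel hk.1]⟩
    · rintro ⟨k, hk, rfl⟩
      exact ⟨k + 1, by omega, rfl⟩
  have hcard : ((prevSuffixes P x).filter fun v => v < prev P (suffixFrom x (j + 1))).card =
      layerRank P x e 0 j := by
    rw [himage, Finset.filter_image, Finset.card_image_of_injOn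
      (hinj.mono (Finset.coe_subset.2 (Finset.filter_subset _ _))), layerRank, rankOf]
    congr 1
    ext k
    simp only [Finset.mem_filter, Finset.mem_range]
    refine and_congr_right fun hk => ?_
    rw [layer_zero h hj.le, layer_zero h hk.le]
    rfl
  rw [IsNthSmallest, hcard, and_iff_right]
  rw [himage]
  exact Finset.mem_image_of_mem _ (Finset.mem_range.2 hj)

theorem isPSA_of_layerRank {c e : ℕ → ℕ} (h : ∀ j < x.length, CodeAt P x c e j) {A : ℕ → ℕ}
    (hA : ∀ j < x.length, A (layerRank P x e 0 j + 1) = j + 1) : IsPSA P x A := by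
  intro i hi j
  rw [Finset.mem_Icc] at hi
  constructor
  · rintro rfl
    obtain ⟨k, hk, he⟩ := layerRank_surj P x e 0 (i - 1) (by omega)
    have hAi : A i = k + 1 := by rw [← hA k hk, he, Nat.sub_add_cancel hi.1]
    rw [hAi, isNthSmallest_iff h hk, Finset.mem_Icc]
    omega
  · rintro ⟨hj, hn⟩
    rw [Finset.mem_Icc] at hj
    obtain ⟨k, rfl⟩ : ∃ k, j = k + 1 := ⟨j - 1, by omega⟩
    rw [isNthSmallest_iff h (by omega)] at hn
    rw [← hn, hA k (by omega)]

theorem card_seen_eq_numParams (P : Finset ℕ) (x : List ℕ) :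
    (seen P x 0 x.length).card = numParams P x := by
  congr 1
  ext a
  rw [mem_seen, Finset.mem_inter, List.mem_toFinset, List.mem_iff_getElem]
  refine and_congr_left fun _ => ⟨?_, ?_⟩
  · rintro ⟨k, -, hk, rfl⟩
    exact ⟨k, hk, by rw [List.getD_eq_getElem _ _ hk]⟩
  · rintro ⟨k, hk, rfl⟩
    exact ⟨k, Nat.zero_le _, hk, by rw [List.getD_eq_getElem _ _ hk]⟩

end PString

/-! ### The table of last occurrences -/

namespace PString

variable {P : Finset ℕ} {x : List ℕ}

/-- A table of the parameterized symbols before position `j` and their last positions. -/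
structure Table (P : Finset ℕ) (x : List ℕ) (j c : ℕ) (sym last : ℕ → ℕ) : Prop where
  mem : ∀ t < c, sym t ∈ P
  lt : ∀ t < c, last t < j
  eq : ∀ t < c, x.getD (last t) 0 = sym t
  ne : ∀ t < c, ∀ k, last t < k → k < j → x.getD k 0 ≠ sym t
  surj : ∀ k < j, x.getD k 0 ∈ P → ∃ t < c, sym t = x.getD k 0
  inj : ∀ t < c, ∀ t' < c, sym t = sym t' → t = t'

namespace Table

variable {j c : ℕ} {sym last : ℕ → ℕ}

theorem zero (P : Finset ℕ) (x : List ℕ) (sym last : ℕ → ℕ) : Table P x 0 0 sym last := by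
  constructor <;> intros <;> omega

/-- A parameterized symbol occurs in `x[p..j-1]` iff its last position before `j` is at least `p`.
One scan of the table thus yields a threshold. -/
theorem card_filter (h : Table P x j c sym last) (p : ℕ) :
    ((Finset.range c).filter fun t => p ≤ last t).card = (seen P x p j).card := by
  rw [← Finset.card_image_of_injOn (s := (Finset.range c).filter fun t => p ≤ last t) (f := sym)]
  · congr 1
    ext a
    simp only [Finset.mem_image, Finset.mem_filter, Finset.mem_range, mem_seen]
    constructor
    · rintro ⟨t, ⟨ht, hp⟩, rfl⟩
      exact ⟨⟨last t, hp, h.lt t ht, h.eq t ht⟩, h.mem t ht⟩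
    · rintro ⟨⟨k, h1, h2, rfl⟩, h4⟩
      obtain ⟨t, ht, he⟩ := h.surj k h2 h4
      refine ⟨t, ⟨ht, h1.trans (not_lt.1 fun hlt => h.ne t ht k hlt h2 he.symm)⟩, he⟩
  · intro t ht t' ht' he
    simp only [Finset.coe_filter, Finset.mem_range, Set.mem_ofPred_eq] at ht ht'
    exact h.inj t ht.1 t' ht'.1 he

theorem card_eq (h : Table P x j c sym last) : c = (seen P x 0 j).card := by
  rw [← h.card_filter 0]
  simp

theorem static (h : Table P x j c sym last) (hx : x.getD j 0 ∉ P) :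
    Table P x (j + 1) c sym last where
  mem := h.mem
  lt t ht := (h.lt t ht).trans (Nat.lt_succ_self j)
  eq := h.eq
  ne t ht k hk hkj he := by
    rcases (Nat.lt_succ_iff.1 hkj).eq_or_lt with rfl | hlt
    · exact hx (he ▸ h.mem t ht)
    · exact h.ne t ht k hk hlt he
  surj k hk hP := by
    rcases (Nat.lt_succ_iff.1 hk).eq_or_lt with rfl | hlt
    · exact absurd hP hx
    · exact h.surj k hlt hP
  inj := h.inj

theorem isLast (h : Table P x j c sym last) {f : ℕ} (hf : f < c) (hs : sym f = x.getD j 0) :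
    IsLast x j (last f) :=
  ⟨h.lt f hf, (h.eq f hf).trans hs, fun k h1 h2 => hs ▸ h.ne f hf k h1 h2⟩

theorem old (h : Table P x j c sym last) {f : ℕ} (hf : f < c) (hs : sym f = x.getD j 0) :
    Table P x (j + 1) c sym (Function.update last f j) where
  mem := h.mem
  lt t ht := by
    rw [Function.update_apply]
    split_ifs
    · omega
    · exact (h.lt t ht).trans (Nat.lt_succ_self j)
  eq t ht := by
    rw [Function.update_apply]
    split_ifs with htf
    · rw [htf, hs]
    · exact h.eq t ht
  ne t ht k hk hkj he := by
    rw [Function.update_apply] at hk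
    split_ifs at hk with htf
    · omega
    · rcases (Nat.lt_succ_iff.1 hkj).eq_or_lt with rfl | hlt
      · exact htf (h.inj t ht f hf (he.symm.trans hs.symm))
      · exact h.ne t ht k hk hlt he
  surj k hk hP := by
    rcases (Nat.lt_succ_iff.1 hk).eq_or_lt with rfl | hlt
    · exact ⟨f, hf, hs⟩
    · exact h.surj k hlt hP
  inj := h.inj

theorem fresh_of_ne (h : Table P x j c sym last) (hx : x.getD j 0 ∈ P)
    (hne : ∀ t < c, sym t ≠ x.getD j 0) : ∀ k < j, x.getD k 0 ≠ x.getD j 0 := by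
  intro k hk he
  obtain ⟨t, ht, hs⟩ := h.surj k hk (he ▸ hx)
  exact hne t ht (hs.trans he)

theorem fresh (h : Table P x j c sym last) (hx : x.getD j 0 ∈ P)
    (hne : ∀ t < c, sym t ≠ x.getD j 0) :
    Table P x (j + 1) (c + 1) (Function.update sym c (x.getD j 0)) (Function.update last c j) := by
  have old : ∀ t < c + 1, t ≠ c → t < c := fun t h1 h2 => by omega
  refine ⟨fun t ht => ?_, fun t ht => ?_, fun t ht => ?_, fun t ht k hk hkj he => ?_,
    fun k hk hP => ?_, fun t ht t' ht' he => ?_⟩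
  · by_cases htc : t = c
    · rwa [htc, Function.update_self]
    · rw [Function.update_of_ne htc]; exact h.mem t (old t ht htc)
  · by_cases htc : t = c
    · rw [htc, Function.update_self]; omega
    · rw [Function.update_of_ne htc]; exact (h.lt t (old t ht htc)).trans (Nat.lt_succ_self j)
  · by_cases htc : t = c
    · rw [htc, Function.update_self, Function.update_self]
    · rw [Function.update_of_ne htc, Function.update_of_ne htc]; exact h.eq t (old t ht htc)
  · by_cases htc : t = c
    · rw [htc, Function.update_self] at hk; omega
    · rw [Function.update_of_ne htc] at hk he
      rcases (Nat.lt_succ_iff.1 hkj).eq_or_lt with rfl | hlt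
      · exact hne t (old t ht htc) he.symm
      · exact h.ne t (old t ht htc) k hk hlt he
  · rcases (Nat.lt_succ_iff.1 hk).eq_or_lt with rfl | hlt
    · exact ⟨c, by omega, by rw [Function.update_self]⟩
    · obtain ⟨t, ht, he⟩ := h.surj k hlt hP
      exact ⟨t, by omega, by rw [Function.update_of_ne (by omega), he]⟩
  · by_cases htc : t = c <;> by_cases htc' : t' = c
    · omega
    · rw [htc, Function.update_self, Function.update_of_ne htc'] at he
      exact absurd he.symm (hne t' (old t' ht' htc'))
    · rw [htc', Function.update_self, Function.update_of_ne htc] at he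
      exact absurd he (hne t (old t ht htc))
    · rw [Function.update_of_ne htc, Function.update_of_ne htc'] at he
      exact h.inj t (old t ht htc) t' (old t' ht' htc') he

end Table

end PString

namespace WordRAM

open PString

variable {M : Machine}

/-! ### Sorting the symbols -/

def Expr.power (e : Expr) : ℕ → Expr
  | 0 => .lit 1
  | t + 1 => .bin .mul (e.power t) e

theorem Expr.cost_power (e : Expr) : ∀ t, (e.power t).cost = t * (e.cost + 1) + 1
  | 0 => by simp [power]
  | t + 1 => by rw [power, cost, cost_power e t]; ring

theorem Expr.power_spec {e : Expr} {h : Store} (he : e.Ok M h) {t : ℕ}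
    (hB : ∀ s ≤ t, e.eval h ^ s < M.B) :
    (e.power t).Ok M h ∧ (e.power t).eval h = e.eval h ^ t := by
  induction t with
  | zero => simpa [power] using hB
  | succ t ih =>
    obtain ⟨h1, h2⟩ := ih fun s hs => hB s (by omega)
    refine ⟨⟨h1, he, ?_⟩, ?_⟩
    · simpa only [Op.eval, h2, ← pow_succ] using hB _ le_rfl
    · rw [power, eval, Op.eval, h2, pow_succ]

/-- Digit `t` of the symbol at position `i`, in base `size + 2`. -/
def digit (t : ℕ) : Expr :=
  .bin .mod (.bin .div (.get .txt (.var .i)) ((Expr.bin .add (.var .size) (.lit 2)).power t))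
    (.bin .add (.var .size) (.lit 2))

/-- Sort the positions by the last `t` digits of their symbols. -/
def radix : ℕ → Prog
  | 0 => .map .i (.var .size) .srt (.lit 0)
  | t + 1 => .seq (radix t) (rankInto (digit t) (.get .srt (.var .i)) .srt)

structure RadixState (x : List ℕ) (t : ℕ) (g : Store) : Prop where
  size : g.v .size = x.length
  len : g.v .len = x.length
  m : g.v .m = x.length
  kb : g.v .kb = x.length + 2
  txt : ∀ k < x.length, g.arr .txt k = x.getD k 0
  srt : ∀ k < x.length,
    g.arr .srt k = rankOf x.length (fun j => x.getD j 0 % (x.length + 2) ^ t) k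

/-- Numbers compare by their leading digit and then by the remainder, and the remainder may be
replaced by its rank. -/
theorem pairRank_digit (X : ℕ → ℕ) {N b : ℕ} (hb : 0 < b) (t k : ℕ) :
    pairRank N (fun j => X j / b ^ t % b) (rankOf N fun j => X j % b ^ t) k =
      rankOf N (fun j => X j % b ^ (t + 1)) k := by
  refine rankOf_congr fun j hj => ?_
  have hp : 0 < b ^ t := pow_pos hb t
  rw [Prod.Lex.toLex_lt_toLex, Nat.mod_pow_succ, Nat.mod_pow_succ, rankOf_lt_rankOf hj]
  simp only
  have h1 := Nat.mod_lt (X j) hp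
  have h2 := Nat.mod_lt (X k) hp
  generalize X j / b ^ t % b = u at *
  generalize X k / b ^ t % b = v at *
  generalize X j % b ^ t = r at *
  generalize X k % b ^ t = s at *
  generalize b ^ t = q at *
  rcases lt_trichotomy u v with h | rfl | h
  · have : q * (u + 1) ≤ q * v := Nat.mul_le_mul_left q h
    rw [mul_add, mul_one] at this
    exact iff_of_true (Or.inl h) (by omega)
  · simp
  · have : q * (v + 1) ≤ q * u := Nat.mul_le_mul_left q h
    rw [mul_add, mul_one] at this
    exact iff_of_false (by omega) (by omega)

/-- Each pass ranks pairs of a digit and an earlier rank. Both are below `n + 2`, so a pass takes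
linear time up to the cost of computing the powers, which depends on `R` only. -/
theorem radix_spec {x : List ℕ} {h : Store} {R : ℕ} (hB : (x.length + 2) ^ R < M.B)
    (hL : 20 * (x.length + 1) ≤ M.L) (hsize : h.v .size = x.length) (hlen : h.v .len = x.length)
    (hm : h.v .m = x.length) (hkb : h.v .kb = x.length + 2)
    (htxt : ∀ k < x.length, h.arr .txt k = x.getD k 0)
    (hx : ∀ k < x.length, x.getD k 0 < (x.length + 2) ^ R) :
    ∀ {t : ℕ}, t ≤ R → Reach M (radix t) ((t + 1) * ((5000 + 4 * R) * (x.length + 1))) h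
      (RadixState x t) := by
  have hA := M.addr
  intro t
  induction t with
  | zero =>
    intro _
    apply Reach.le
    · refine .map x.length (fun _ => 0) (by omega) (fun k g hg => ⟨trivial, by simp [hg.v, hsize]⟩)
        (fun k hk g hg => ⟨by simp only [Expr.Ok]; omega, rfl⟩) fun g hg => ?_
      refine ⟨by simp [hg.v, hsize], by simp [hg.v, hlen], by simp [hg.v, hm], by simp [hg.v, hkb],
        fun k hk => by rw [hg.arr _ (by simp), htxt k hk], fun k hk => ?_⟩
      rw [hg.lt k hk]
      simp [rankOf, Nat.mod_one]
    · simp only [Expr.cost]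
      nlinarith
  | succ t ih =>
    intro ht
    apply Reach.le
    · apply Reach.seq
      refine (ih (by omega)).mono le_rfl fun g hg => ?_
      refine (rankInto_spec (N := x.length) (K := x.length + 2)
        (fun j => x.getD j 0 / (x.length + 2) ^ t % (x.length + 2))
        (rankOf x.length fun j => x.getD j 0 % (x.length + 2) ^ t) hg.len hg.m hg.kb (by omega)
        (by omega) (by decide) (fun k hk => Nat.mod_lt _ (by omega))
        (fun k hk => (rankOf_lt hk).trans (by omega)) (fun k hk g' hg' => ?_)
        (fun k hk g' hg' => ?_)).mono le_rfl fun g' hg' => ?_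
      · have hs : g'.v .size = x.length := by rw [hg'.v _ (by simp), hg.size]
        have hbase : (Expr.bin .add (.var .size) (.lit 2)).eval g' = x.length + 2 := by simp [hs]
        have hbase' : (Expr.bin .add (.var .size) (.lit 2)).Ok M g' := by simp [hs]; omega
        obtain ⟨p1, p2⟩ := Expr.power_spec hbase' (t := t) fun s hs => by
          rw [hbase]
          exact (Nat.pow_le_pow_right (by omega) (by omega)).trans_lt hB
        rw [hbase] at p2
        have ht' : g'.arr .txt k = x.getD k 0 := by rw [hg'.arr _ (by decide), hg.txt k hk]
        have hdiv := Nat.div_le_self (x.getD k 0) ((x.length + 2) ^ t)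
        have hxk := hx k hk
        have hmod := Nat.mod_lt (x.getD k 0 / (x.length + 2) ^ t) (show 0 < x.length + 2 by omega)
        constructor
        · rw [digit, Expr.Ok, Expr.Ok, Expr.eval, Op.eval, Op.eval, hbase, p2, Expr.eval, Expr.eval,
            hg'.idx, ht']
          refine ⟨⟨⟨trivial, ?_⟩, p1, by omega⟩, hbase', by omega⟩
          rw [Expr.eval, hg'.idx]
          omega
        · rw [digit, Expr.eval, Op.eval, hbase, Expr.eval, Op.eval, p2, Expr.eval, Expr.eval,
            hg'.idx, ht']
      · simp only [Expr.Ok, Expr.eval, hg'.idx, true_and]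
        exact ⟨by omega, by rw [hg'.arr _ (by decide), hg.srt k hk]⟩
      · refine ⟨(hg'.v _ (by decide)).trans hg.size, (hg'.v _ (by decide)).trans hg.len,
          hg'.m.trans hg.m, hg'.kb.trans hg.kb, fun k hk => ?_, fun k hk => ?_⟩
        · rw [hg'.arr _ (by decide) (by simp), hg.txt k hk]
        · rw [hg'.val k hk, pairRank_digit _ (by omega)]
    · have hc : (digit t).cost = 4 * t + 13 := by
        simp only [digit, Expr.cost, Expr.cost_power]
        ring
      have h1 : x.length * ((digit t).cost + (Expr.get Arr.srt (.var .i)).cost + 60) ≤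
          x.length * (4 * R + 80) :=
        Nat.mul_le_mul_left _ (by rw [hc]; simp only [Expr.cost]; omega)
      have h2 : (t + 1 + 1) * ((5000 + 4 * R) * (x.length + 1)) =
        (t + 1) * ((5000 + 4 * R) * (x.length + 1)) + (x.length * (4 * R + 80) + x.length * 4920 +
          4 * R + 5000) := by ring
      omega

/-- Copy the input, sort its symbols, and compute the bound of the parameterized alphabet. -/
def load (c₁ R : ℕ) : Prog :=
  .seq (.map .j (.var .size) .txt (.inp (.bin .add (.var .j) (.lit 1)))) <|
  .seq (.set .len (.var .size)) <| .seq (.set .m (.var .size)) <|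
  .seq (.set .kb (.bin .add (.var .size) (.lit 2))) <|
  .seq (radix R) (.set .th ((Expr.var .size).power c₁))

theorem load_spec {x : List ℕ} {h : Store} {c₁ R : ℕ} (hB : (x.length + 2) ^ R < M.B)
    (hR : c₁ ≤ R) (hn : M.n = x.length)
    (hL : 20 * (x.length + 1) ≤ M.L) (hsize : h.v .size = x.length)
    (hio : ∀ k < x.length, h.io (k + 1) = x.getD k 0)
    (hx : ∀ k < x.length, x.getD k 0 < (x.length + 2) ^ R) :
    Reach M (load c₁ R) ((R + 2) * ((5000 + 4 * R) * (x.length + 1))) h fun g =>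
      g.v .size = x.length ∧ g.v .th = x.length ^ c₁ ∧
      (∀ k < x.length, g.arr .txt k = x.getD k 0) ∧
      ∀ k < x.length, g.arr .srt k = rankOf x.length (fun j => x.getD j 0) k := by
  have hA := M.addr
  apply Reach.le
  · apply Reach.seq
    refine .map x.length (fun k => x.getD k 0) (by omega)
      (fun k g hg => ⟨trivial, by simp [hg.v, hsize]⟩) (fun k hk g hg => ⟨?_, ?_⟩) fun g hg => ?_
    · simp only [Expr.Ok, Expr.eval, Op.eval, hg.idx, true_and, hn]
      omega
    · simp only [Expr.eval, Op.eval, hg.idx, hg.io, hio k hk]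
    have hs : g.v .size = x.length := by rw [hg.v _ (by simp), hsize]
    apply Reach.seq
    refine Reach.of_wp (.set _ _) ?_
    simp only [Prog.wp, Expr.Ok, Expr.eval, true_and]
    apply Reach.seq
    refine Reach.of_wp (.set _ _) ?_
    simp only [Prog.wp, Expr.Ok, Expr.eval, true_and]
    apply Reach.seq
    refine Reach.of_wp (.set _ _) ?_
    simp only [Prog.wp, Expr.Ok, Expr.eval, Op.eval, true_and]
    refine ⟨by simp [hs]; omega, ?_⟩
    have htxt := hg.lt
    generalize hg₁ : Store.setV (Store.setV _ _ _) _ _ = g₁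
    apply Reach.seq
    refine (radix_spec (x := x) (h := g₁) (t := R) hB hL (by subst hg₁; simp [hs])
      (by subst hg₁; simp [hs]) (by subst hg₁; simp [hs]) (by subst hg₁; simp [hs])
      (by subst hg₁; exact htxt) hx le_rfl).mono le_rfl fun g' hg' => ?_
    refine Reach.of_wp (.set _ _) ?_
    have h1 : (Expr.var .size).eval g' = x.length := hg'.size
    obtain ⟨h2, h3⟩ := Expr.power_spec (M := M) (e := .var .size) (h := g') trivial (t := c₁)
      fun s hs => by
        rw [h1]
        exact ((Nat.pow_le_pow_left (by omega) _).trans (Nat.pow_le_pow_right (by omega)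
          (hs.trans hR))).trans_lt hB
    refine ⟨h2, by simp [hg'.size], by simp [h3, hg'.size], fun k hk => hg'.txt k hk,
      fun k hk => ?_⟩
    -- All symbols have at most `R` digits, so reduction modulo `(n + 2) ^ R` changes nothing.
    refine (hg'.srt k hk).trans (rankOf_congr fun j hj => ?_)
    rw [Nat.mod_eq_of_lt (hx j hj), Nat.mod_eq_of_lt (hx k hk)]
  · simp only [Expr.cost, Prog.cost, Expr.cost_power]
    have h2 : (R + 2) * ((5000 + 4 * R) * (x.length + 1)) =
      (R + 1) * ((5000 + 4 * R) * (x.length + 1)) + (5000 * x.length + 4 * (R * x.length) +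
        4 * R + 5000) := by ring
    have h3 : x.length * (1 + 1 + 1 + 1 + 1 + 13) = 18 * x.length := by ring
    omega

end WordRAM

namespace PString

theorem CodeAt.congr {P : Finset ℕ} {x : List ℕ} {c e c' e' : ℕ → ℕ} {j : ℕ}
    (h : CodeAt P x c e j) (hc : c' j = c j) (he : e' j = e j) : CodeAt P x c' e' j :=
  ⟨fun h' => by rw [hc, he]; exact h.static h', fun p h' => by rw [hc, he]; exact h.last p h',
    fun h' => by rw [hc, he]; exact h.fresh h'⟩

theorem IsLast.unique {x : List ℕ} {j p p' : ℕ} (h : IsLast x j p) (h' : IsLast x j p') :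
    p = p' := by
  rcases lt_trichotomy p p' with hlt | he | hlt
  · exact absurd h'.2.1 (h.2.2 p' hlt h'.1)
  · exact he
  · exact absurd h.2.1 (h'.2.2 p hlt h.1)

end PString

namespace WordRAM

open PString

variable {M : Machine}

/-! ### Encoding the symbols -/

/-- Find the symbol `q` in the table. -/
def find : Prog :=
  .seq (.set .f (.var .cnt)) <| .for .t (.var .cnt) <|
    .ifEq (.get .sym (.var .t)) (.var .q) (.set .f (.var .t)) .skip

theorem find_spec {h : Store} {c : ℕ} (hc : h.v .cnt = c) (hL : c ≤ M.L) :
    Reach M find (c * 30 + 20) h fun g => (∀ r, r ≠ .t → r ≠ .f → g.v r = h.v r) ∧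
      g.arr = h.arr ∧ ((g.v .f = c ∧ ∀ t < c, h.arr .sym t ≠ h.v .q) ∨
        (g.v .f < c ∧ h.arr .sym (g.v .f) = h.v .q)) := by
  have hA := M.addr
  apply Reach.le
  · apply Reach.seq
    refine Reach.of_wp (.set _ _) ?_
    simp only [Prog.wp, Expr.Ok, Expr.eval, true_and]
    refine .for (fun k g => (∀ r, r ≠ .t → r ≠ .f → g.v r = h.v r) ∧
      g.arr = h.arr ∧ ((g.v .f = c ∧ ∀ t < k, h.arr .sym t ≠ h.v .q) ∨
        (g.v .f < c ∧ h.arr .sym (g.v .f) = h.v .q))) c _ (by omega) ?_ ?_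
      (fun k hk g hg hi => Reach.of_wp _ ?_) fun g hg hi => hg
    · exact ⟨fun r h1 h2 => by simp [h1, h2], rfl, Or.inl ⟨by simp [hc], by simp⟩⟩
    · exact fun k hk g hg hi => ⟨trivial, by simp [hg.1, hc]⟩
    · obtain ⟨h1, h2, h3⟩ := hg
      have hq := h1 .q (by simp) (by simp)
      simp only [Prog.wp, Expr.Ok, Expr.eval, hi, true_and, h2, hq]
      refine ⟨by omega, fun he => ⟨by simp [hi], ⟨fun r h4 h5 => by simp [h4, h5, h1], h2, Or.inr
        ⟨by simpa using hk, by simpa using he⟩⟩⟩,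
        fun he => ⟨fun r h4 h5 => by simp [h4, h1 r h4 h5], h2, ?_⟩⟩
      rcases h3 with ⟨h3, h4⟩ | h3
      · refine Or.inl ⟨by simpa using h3, fun t ht => ?_⟩
        rcases (Nat.lt_succ_iff.1 ht).eq_or_lt with rfl | hlt
        · exact he
        · exact h4 t hlt
      · exact Or.inr (by simpa using h3)
  · simp only [Expr.cost, Prog.cost]
    omega

/-- Count the symbols whose last position is not before that of symbol number `f`. -/
def count : Prog :=
  .seq (.set .d (.lit 0)) <| .for .t (.var .cnt) <|
    .ifLt (.get .last (.var .t)) (.get .last (.var .f)) .skip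
      (.set .d (.bin .add (.var .d) (.lit 1)))

theorem count_spec {h : Store} {c : ℕ} (hc : h.v .cnt = c) (hL : c ≤ M.L) (hf : h.v .f < c) :
    Reach M count (c * 40 + 20) h fun g => (∀ r, r ≠ .t → r ≠ .d → g.v r = h.v r) ∧
      g.arr = h.arr ∧ g.v .d =
        ((Finset.range c).filter fun t => h.arr .last (h.v .f) ≤ h.arr .last t).card := by
  have hA := M.addr
  apply Reach.le
  · apply Reach.seq
    refine Reach.of_wp (.set _ _) ?_
    simp only [Prog.wp, Expr.Ok, Expr.eval]
    refine ⟨by omega, ?_⟩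
    refine .for (fun k g => (∀ r, r ≠ .t → r ≠ .d → g.v r = h.v r) ∧
      g.arr = h.arr ∧ g.v .d =
        ((Finset.range k).filter fun t => h.arr .last (h.v .f) ≤ h.arr .last t).card) c _
      (by omega) ?_ ?_ (fun k hk g hg hi => Reach.of_wp _ ?_) fun g hg hi => hg
    · exact ⟨fun r h1 h2 => by simp [h1, h2], rfl, by simp⟩
    · exact fun k hk g hg hi => ⟨trivial, by simp [hg.1, hc]⟩
    · obtain ⟨h1, h2, h3⟩ := hg
      have hf' := h1 .f (by simp) (by simp)
      have hle := card_filter_range_le k fun t => h.arr .last (h.v .f) ≤ h.arr .last t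
      have hs := card_filter_range_succ k fun t => h.arr .last (h.v .f) ≤ h.arr .last t
      simp only [Prog.wp, Expr.Ok, Expr.eval, Op.eval, hi, true_and, h2, hf', h3]
      refine ⟨by omega, by omega, fun hlt => ⟨fun r h4 h5 => by simp [h4, h1 r h4 h5], h2, ?_⟩,
        fun hlt => ⟨⟨by omega, by omega⟩, by simp [hi],
          ⟨fun r h4 h5 => by simp [h4, h5, h1], h2, ?_⟩⟩⟩
      · rw [hs, if_neg (not_le.2 hlt)]
        simpa using h3
      · rw [hs, if_pos (not_lt.1 hlt)]
        simp
  · simp only [Expr.cost, Prog.cost]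
    omega

/-- Encode the symbol at position `j`. -/
def encodeAt : Prog :=
  .seq (.set .q (.get .txt (.var .j))) <| .ifLt (.var .th) (.var .q)
    (.seq (.put .cod (.var .j) (.bin .add (.var .size) (.get .srt (.var .j))))
      (.put .exi (.var .j) (.lit 0))) <|
    .seq find <| .ifLt (.var .f) (.var .cnt)
      (.seq count <|
        .seq (.put .cod (.var .j) (.bin .sub (.var .j) (.get .last (.var .f)))) <|
        .seq (.put .exi (.var .j) (.var .d)) (.put .last (.var .f) (.var .j)))
      (.seq (.put .cod (.var .j) (.lit 0)) <|
        .seq (.put .exi (.var .j) (.bin .add (.var .size) (.lit 2))) <|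
        .seq (.put .sym (.var .cnt) (.var .q)) <|
        .seq (.put .last (.var .cnt) (.var .j)) (.set .cnt (.bin .add (.var .cnt) (.lit 1))))

def encode : Prog := .seq (.set .cnt (.lit 0)) (.for .j (.var .size) encodeAt)

structure EncodeState (P : Finset ℕ) (x : List ℕ) (th j : ℕ) (g : Store) : Prop where
  size : g.v .size = x.length
  th : g.v .th = th
  txt : ∀ k < x.length, g.arr .txt k = x.getD k 0
  srt : ∀ k < x.length, g.arr .srt k = rankOf x.length (fun j => x.getD j 0) k
  table : Table P x j (g.v .cnt) (g.arr .sym) (g.arr .last)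
  code : ∀ k < j, CodeAt P x (g.arr .cod) (g.arr .exi) k

/-- Before each position the table has at most `π` entries. It is scanned once to find the symbol
and, if the symbol is old, once more to count. -/
theorem encodeAt_spec {P : Finset ℕ} {x : List ℕ} {th j : ℕ} {g : Store}
    (hP : ∀ a, a ∈ P ↔ a ≤ th) (hL : 20 * (x.length + 1) ≤ M.L) (hg : EncodeState P x th j g)
    (hj : j < x.length) (hi : g.v .j = j) :
    Reach M encodeAt (100 * (numParams P x + 2)) g fun g' =>
      g'.v .j = j ∧ EncodeState P x th (j + 1) g' := by
  have hA := M.addr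
  have hc1 : g.v .cnt ≤ numParams P x := by
    rw [hg.table.card_eq, ← card_seen_eq_numParams]
    exact card_seen_mono le_rfl hj.le
  have hc2 : g.v .cnt ≤ j := by
    rw [hg.table.card_eq]
    exact card_seen_le P x 0 j
  have hs := hg.size
  have hsrt := hg.srt j hj
  have hrk := rankOf_lt (κ := fun j => x.getD j 0) hj
  -- Only entry `j` of the two arrays is written, so the codes of earlier positions persist.
  have code : ∀ {c e : ℕ → ℕ} (u v : ℕ), c = Function.update (g.arr .cod) j u →
      e = Function.update (g.arr .exi) j v →
      CodeAt P x (fun _ => u) (fun _ => v) j → ∀ k < j + 1, CodeAt P x c e k := by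
    rintro c e u v rfl rfl h k hk
    rcases (Nat.lt_succ_iff.1 hk).eq_or_lt with rfl | hlt
    · exact h.congr (by simp) (by simp)
    · exact (hg.code k hlt).congr (by simp [hlt.ne]) (by simp [hlt.ne])
  apply Reach.le
  · apply Reach.seq
    refine Reach.of_wp (.set _ _) ?_
    simp only [Prog.wp, Expr.Ok, Expr.eval, hi, true_and, hg.txt j hj]
    refine ⟨by omega, ?_⟩
    generalize hg₁ : Store.setV _ _ _ = g₁
    have v₁ : ∀ r, r ≠ .q → g₁.v r = g.v r := by subst hg₁; intro r hr; simp [hr]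
    have q₁ : g₁.v .q = x.getD j 0 := by subst hg₁; simp
    have a₁ : g₁.arr = g.arr := by subst hg₁; rfl
    clear hg₁
    have j₁ : g₁.v .j = j := by rw [v₁ _ (by simp), hi]
    have s₁ : g₁.v .size = x.length := by rw [v₁ _ (by simp), hs]
    have t₁ : g₁.v .th = th := by rw [v₁ _ (by simp), hg.th]
    apply Reach.ifLt
    · trivial
    · trivial
    · intro hlt
      refine Reach.of_wp _ ?_
      simp only [Expr.eval, t₁, q₁] at hlt
      have hx : x.getD j 0 ∉ P := by rw [hP]; omega
      simp only [Prog.wp, Expr.Ok, Expr.eval, Op.eval, j₁, s₁, a₁, hsrt, true_and, Store.setA]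
      refine ⟨by omega, ⟨by omega, by omega⟩, by omega, by omega, ?_⟩
      refine ⟨s₁, t₁, hg.txt, hg.srt, ?_, ?_⟩
      · rw [v₁ _ (by simp)]
        exact hg.table.static hx
      · exact code _ _ rfl rfl ⟨fun _ => ⟨rfl, rfl⟩, fun _ h' => absurd h' hx,
          fun h' => absurd h' hx⟩
    · intro hge
      simp only [Expr.eval, t₁, q₁] at hge
      have hx : x.getD j 0 ∈ P := by rw [hP]; omega
      apply Reach.seq
      refine (find_spec (c := g.v .cnt) (v₁ _ (by simp)) (by omega)).mono le_rfl
        fun g₂ ⟨v₂, a₂, f₂⟩ => ?_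
      rw [a₁, q₁] at f₂
      have j₂ : g₂.v .j = j := by rw [v₂ _ (by simp) (by simp), j₁]
      have s₂ : g₂.v .size = x.length := by rw [v₂ _ (by simp) (by simp), s₁]
      have t₂ : g₂.v .th = th := by rw [v₂ _ (by simp) (by simp), t₁]
      have q₂ : g₂.v .q = x.getD j 0 := by rw [v₂ _ (by simp) (by simp), q₁]
      have c₂ : g₂.v .cnt = g.v .cnt := by rw [v₂ _ (by simp) (by simp), v₁ _ (by simp)]
      rw [a₁] at a₂
      apply Reach.ifLt
      · trivial
      · trivial
      · intro hlt
        simp only [Expr.eval, c₂] at hlt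
        have hf := f₂.resolve_left fun h => by omega
        have hlast := hg.table.isLast hf.1 hf.2
        have hlt := hg.table.lt _ hf.1
        apply Reach.seq
        refine (count_spec c₂ (by omega) hf.1).mono le_rfl fun g₃ ⟨v₃, a₃, d₃⟩ => Reach.of_wp _ ?_
        rw [a₂, hg.table.card_filter] at d₃
        rw [a₂] at a₃
        have j₃ : g₃.v .j = j := by rw [v₃ _ (by simp) (by simp), j₂]
        have f₃ : g₃.v .f = g₂.v .f := v₃ _ (by simp) (by simp)
        simp only [Prog.wp, Expr.Ok, Expr.eval, Op.eval, j₃, a₃, f₃, d₃, true_and, Store.setA]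
        refine ⟨by omega, ⟨by omega, by omega⟩, by omega, by omega, ?_⟩
        refine ⟨(v₃ _ (by simp) (by simp)).trans s₂, (v₃ _ (by simp) (by simp)).trans t₂,
          hg.txt, hg.srt, ?_, ?_⟩
        · rw [v₃ _ (by simp) (by simp), c₂]
          exact hg.table.old hf.1 hf.2
        · refine code _ _ rfl rfl ⟨fun h => absurd hx h, fun p _ hp => ?_, fun _ h => ?_⟩
          · rw [hlast.unique hp]
            exact ⟨rfl, rfl⟩
          · exact absurd hlast.2.1 (h _ hlast.1)
      · intro hge
        refine Reach.of_wp _ ?_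
        simp only [Expr.eval, c₂] at hge
        have hf := f₂.resolve_right fun h => by omega
        have hfresh := hg.table.fresh_of_ne hx hf.2
        simp only [Prog.wp, Expr.Ok, Expr.eval, Op.eval, j₂, a₂, s₂, q₂, c₂, true_and, Store.setA,
          Store.setV]
        refine ⟨by omega, by omega, by omega, ⟨by omega, by omega⟩, by omega, by omega,
          ⟨by omega, by omega⟩, by simp [j₂], ?_⟩
        refine ⟨s₂, t₂, hg.txt, hg.srt, ?_, ?_⟩
        · exact hg.table.fresh hx hf.2
        · exact code _ _ rfl rfl ⟨fun h => absurd hx h,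
            fun p _ hp => absurd hp.2.1 (hfresh _ hp.1), fun _ _ => ⟨rfl, rfl⟩⟩
  · simp only [Expr.cost, Prog.cost]
    omega

theorem encode_spec {P : Finset ℕ} {x : List ℕ} {th : ℕ} {h : Store}
    (hP : ∀ a, a ∈ P ↔ a ≤ th) (hL : 20 * (x.length + 1) ≤ M.L) (hsize : h.v .size = x.length)
    (hth : h.v .th = th) (htxt : ∀ k < x.length, h.arr .txt k = x.getD k 0)
    (hsrt : ∀ k < x.length, h.arr .srt k = rankOf x.length (fun j => x.getD j 0) k) :
    Reach M encode (x.length * (100 * (numParams P x + 3)) + 20) h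
      (EncodeState P x th x.length) := by
  have hA := M.addr
  apply Reach.le
  · apply Reach.seq
    refine Reach.of_wp (.set _ _) ?_
    simp only [Prog.wp, Expr.Ok, Expr.eval]
    refine ⟨by omega, ?_⟩
    refine .for (EncodeState P x th) x.length (100 * (numParams P x + 2)) (by omega) ?_ ?_
      (fun k hk g hg hi => ?_) fun g hg hi => hg
    · exact ⟨by simp [hsize], by simp [hth], htxt, hsrt, by simpa using Table.zero _ _ _ _,
        by simp⟩
    · exact fun k hk g hg hi => ⟨trivial, hg.size⟩
    · refine (encodeAt_spec hP hL hg hk hi).mono le_rfl fun g' ⟨h1, h2⟩ => ⟨h1, ?_⟩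
      exact ⟨h2.size, h2.th, h2.txt, h2.srt, h2.table, h2.code⟩
  · simp only [Expr.cost, Prog.cost]
    have h1 : x.length * (100 * (numParams P x + 2) + 1 + 6) ≤
      x.length * (100 * (numParams P x + 3)) := Nat.mul_le_mul_left _ (by omega)
    omega

end WordRAM

namespace WordRAM

open PString SuffixSort

variable {M : Machine}

/-! ### Sorting the suffixes -/

/-- Sort the suffixes of the string with the symbols `e`. -/
def sortString (e : Expr) : Prog := .seq (.map .j (.var .size) .str e) sufSort

theorem sortString_spec {h : Store} {e : Expr} {y : List ℕ} (hsize : h.v .size = y.length)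
    (he : ∀ k < y.length, ∀ g : Store, g.v .j = k → (∀ r, r ≠ .j → g.v r = h.v r) →
      (∀ a, a ≠ .str → g.arr a = h.arr a) → e.Ok M g ∧ e.eval g = y.getD k 0)
    (hpos : ∀ a ∈ y, 0 < a) (hbound : ∀ a ∈ y, a < 8 * (y.length + 2))
    (hL : 20 * (y.length + 1) ≤ M.L) :
    Reach M (sortString e) ((2000020 + e.cost) * (y.length + 1)) h fun g =>
      (∀ r, 2 ≤ r.level → r ≠ .j → g.v r = h.v r) ∧ (∀ a, 2 ≤ a.level → g.arr a = h.arr a) ∧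
      ∀ k < y.length, g.arr .srk k = sufRank y k := by
  apply Reach.le
  · apply Reach.seq
    refine .map y.length (fun k => y.getD k 0) (by omega)
      (fun k g hg => ⟨trivial, by simp [hg.v, hsize]⟩) (fun k hk g hg => he k hk g hg.idx hg.v hg.arr)
      fun g hg => ?_
    refine (sufSort_spec (M := M) ((hg.v _ (by simp)).trans hsize) hg.lt hpos hbound hL).mono le_rfl
      fun g' ⟨hf, hs⟩ => ⟨fun r hr hj => ?_, fun a ha => ?_, hs⟩
    · rw [hf.v r hr, hg.v r hj]
    · rw [hf.arr a ha, hg.arr a (by rintro rfl; exact absurd ha (by decide))]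
  · simp only [Expr.cost]
    have h1 : (2000020 + e.cost) * (y.length + 1) =
      y.length * (e.cost + 1 + 13) + (2000006 * y.length + 2000020 + e.cost) := by ring
    omega

/-- The symbol at position `j` of the string for the current layer. -/
def layerSymbol : Expr :=
  .ifLt (.bin .sub (.var .cnt) (.bin .add (.var .lay) (.lit 1))) (.get .exi (.var .j))
    (.ifLt (.bin .add (.var .j) (.lit 1)) (.var .size)
      (.bin .add (.get .srk (.bin .add (.var .j) (.lit 1))) (.lit 2)) (.lit 1))
    (.bin .add (.bin .add (.var .size) (.lit 3)) (.get .cod (.var .j)))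

def sortLayers : Prog :=
  .seq (sortString (.bin .add (.lit 1) (.get .cod (.var .j)))) <|
    .for .lay (.var .cnt) (sortString layerSymbol)

structure LayerState (P : Finset ℕ) (x : List ℕ) (r : ℕ) (g : Store) : Prop where
  size : g.v .size = x.length
  cnt : g.v .cnt = numParams P x
  code : ∀ k < x.length, CodeAt P x (g.arr .cod) (g.arr .exi) k
  srk : ∀ k < x.length, g.arr .srk k = layerRank P x (g.arr .exi) r k

theorem numParams_le (P : Finset ℕ) (x : List ℕ) : numParams P x ≤ x.length := by
  rw [← card_seen_eq_numParams]
  exact card_seen_le P x 0 _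

/-- Positivity and a linear bound for the symbols are what the suffix sorter requires of its input.
-/
theorem layerString_bounds {n r z : ℕ} {e c s : ℕ → ℕ} (hs : ∀ j < n, 0 < s (j + 1))
    (hs' : ∀ j < n, s (j + 1) < 8 * (n + 2)) (hz : 0 < z) (hz' : z ≤ n + 3)
    (hc : ∀ j < n, c j < 2 * n) :
    (∀ a ∈ layerString n r z e c s, 0 < a) ∧
      ∀ a ∈ layerString n r z e c s, a < 8 * ((layerString n r z e c s).length + 2) := by
  rw [length_layerString]
  constructor <;> intro a ha <;> simp only [layerString, List.mem_map, List.mem_range] at ha <;>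
    obtain ⟨j, hj, rfl⟩ := ha <;> have h1 := hs j hj <;> have h2 := hs' j hj <;>
    have h3 := hc j hj <;> split_ifs <;> omega

/-- The initial sorting gives the ranks of layer `π`; each iteration passes from layer `r + 1` to
layer `r`, ending with layer `0`. Layer `π` is sorted without any substitution. -/
theorem sortLayers_spec {P : Finset ℕ} {x : List ℕ} {th : ℕ} {h : Store}
    (hP : ∀ a ∈ x, a ∉ P → x.length < a) (hL : 20 * (x.length + 1) ≤ M.L)
    (hh : EncodeState P x th x.length h) :
    Reach M sortLayers ((numParams P x + 1) * (2000100 * (x.length + 1))) h (LayerState P x 0) := by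
  have hA := M.addr
  have hπ := numParams_le P x
  have hcnt : h.v .cnt = numParams P x := by rw [hh.table.card_eq, card_seen_eq_numParams]
  apply Reach.le
  · apply Reach.seq
    obtain ⟨b1, b2⟩ := layerString_bounds (n := x.length) (r := 0) (z := 1) (e := fun _ => 0)
      (c := h.arr .cod) (s := fun _ => 1) (fun _ _ => one_pos) (fun _ _ => by omega) one_pos
      (by omega) fun j hj => (hh.code j hj).code_lt hj
    refine (sortString_spec (M := M)
      (y := layerString x.length 0 1 (fun _ => 0) (h.arr .cod) fun _ => 1)
      (by rw [length_layerString, hh.size]) (fun k hk g hj hv ha => ?_) b1 b2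
      (by rwa [length_layerString])).mono le_rfl fun g ⟨hv, ha, hs⟩ => ?_
    · rw [length_layerString] at hk
      have hc := (hh.code k hk).code_lt hk
      rw [getD_layerString hk, if_neg (Nat.not_lt_zero _)]
      simp only [Expr.Ok, Expr.eval, Op.eval, hj, ha _ (show Arr.cod ≠ .str by simp), true_and]
      exact ⟨⟨by omega, by omega, by omega⟩, trivial⟩
    rw [length_layerString] at hs
    refine .for (fun k => LayerState P x (numParams P x - k)) (numParams P x)
      (2000080 * (x.length + 1)) (by omega) ?_ ?_ (fun k hk g hg hi => ?_) fun g hg hi => ?_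
    · have hexi := ha .exi (by decide)
      have hcod := ha .cod (by decide)
      refine ⟨(hv _ (by decide) (by simp)).trans hh.size,
        (hv _ (by decide) (by simp)).trans hcnt, fun k hk => ?_, fun k hk => ?_⟩
      · exact (hh.code k hk).congr (by simp [hcod]) (by simp [hexi])
      · refine (hs k hk).trans ?_
        rw [Nat.sub_zero, ← card_seen_eq_numParams]
        simp only [Store.setV, hexi]
        rw [← sufRank_base hh.code hP le_rfl hk]
        simp [layerString]
    · exact fun k hk g hg hi => ⟨trivial, hg.cnt⟩
    · obtain ⟨r, hr⟩ : ∃ r, numParams P x - k = r + 1 := ⟨numParams P x - k - 1, by omega⟩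
      have hr' : numParams P x - (k + 1) = r := by omega
      rw [hr] at hg
      have hRlt : ∀ j < x.length, layerRank P x (g.arr .exi) (r + 1) j < x.length :=
        fun j hj => rankOf_lt hj
      have hpos : ∀ j, 0 < restCode x.length (layerRank P x (g.arr .exi) (r + 1)) j := by
        intro j; unfold restCode; split_ifs <;> omega
      have hlt : ∀ j, restCode x.length (layerRank P x (g.arr .exi) (r + 1)) j < x.length + 2 := by
        intro j
        have := hRlt j
        unfold restCode; split_ifs <;> omega
      obtain ⟨b1, b2⟩ := layerString_bounds (n := x.length) (r := r) (z := x.length + 3)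
        (e := g.arr .exi) (c := g.arr .cod)
        (s := restCode x.length (layerRank P x (g.arr .exi) (r + 1))) (fun j _ => hpos _)
        (fun j _ => (hlt _).trans (by omega)) (by omega) le_rfl
        fun j hj => (hg.code j hj).code_lt hj
      refine (sortString_spec (M := M) (y := layerString x.length r (x.length + 3) (g.arr .exi)
        (g.arr .cod) (restCode x.length (layerRank P x (g.arr .exi) (r + 1))))
        (by rw [length_layerString, hg.size]) (fun j hj g' hj' hv ha => ?_) b1 b2
        (by rwa [length_layerString])).mono ?_ fun g' ⟨hv, ha, hs⟩ => ?_
      · rw [length_layerString] at hj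
        have hc := (hg.code j hj).code_lt hj
        have hR := hRlt (j + 1)
        have hsrk := hg.srk (j + 1)
        have hlay : g'.v .lay = k := (hv _ (by simp)).trans hi
        have hcnt' : g'.v .cnt = numParams P x := (hv _ (by simp)).trans hg.cnt
        have hsize : g'.v .size = x.length := (hv _ (by simp)).trans hg.size
        rw [getD_layerString hj, restCode]
        simp only [layerSymbol, Expr.Ok, Expr.eval, Op.eval, hj', hlay, hcnt', hsize,
          ha _ (show Arr.cod ≠ .str by simp), ha _ (show Arr.exi ≠ .str by simp),
          ha _ (show Arr.srk ≠ .str by simp), true_and, hr']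
        refine ⟨⟨⟨⟨by omega, by omega⟩, by omega⟩, by omega,
          fun _ => ⟨⟨by omega, by omega⟩, fun hlt => ?_, fun _ => by omega⟩,
          fun _ => ⟨⟨by omega, by omega⟩, by omega, by omega⟩⟩, ?_⟩
        · rw [hsrk hlt]
          have := hR hlt
          exact ⟨⟨⟨by omega, by omega⟩, by omega⟩, by omega, by omega⟩
        -- The array `srk` still holds the ranks of layer `r + 1`; behind the last position the rest
        -- is empty and has code `1`.
        · refine if_congr Iff.rfl ?_ rfl
          split_ifs with hlt
          · rw [hsrk hlt]
          · rfl
      · rw [length_layerString]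
        exact Nat.mul_le_mul_right _ (by simp [layerSymbol])
      · rw [length_layerString] at hs
        have hexi := ha .exi (by decide)
        have hcod := ha .cod (by decide)
        refine ⟨(hv _ (by decide) (by simp)).trans hi, (hv _ (by decide) (by simp)).trans hg.size,
          (hv _ (by decide) (by simp)).trans hg.cnt, fun j hj => ?_, fun j hj => ?_⟩
        · exact (hg.code j hj).congr (by simp [hcod]) (by simp [hexi])
        · refine (hs j hj).trans ?_
          rw [hr', sufRank_layer hg.code hP (by omega) hj]
          simp only [Store.setV, hexi]
    · rwa [Nat.sub_self] at hg
  · simp only [length_layerString, Expr.cost]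
    have h1 : (numParams P x + 1) * (2000100 * (x.length + 1)) =
      numParams P x * (2000080 * (x.length + 1) + 1 + 6) +
        (numParams P x * 13 + numParams P x * x.length * 20 + 2000100 * x.length + 2000100) := by
      ring
    omega

/-! ### Output and the complete program -/

/-- Write the inverse of the permutation `srk`. -/
def output : Prog :=
  .for .j (.var .size) <|
    .out (.bin .add (.get .srk (.var .j)) (.lit 1)) (.bin .add (.var .j) (.lit 1))

theorem output_spec {n : ℕ} {R : ℕ → ℕ} {h : Store} (hn : M.n = n) (hL : n ≤ M.L)
    (hsize : h.v .size = n) (hsrk : ∀ k < n, h.arr .srk k = R k) (hR : ∀ k < n, R k < n)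
    (hinj : ∀ j < n, ∀ k < n, R j = R k → j = k) :
    Reach M output (40 * (n + 1)) h fun g => ∀ k < n, g.io (R k + 1) = k + 1 := by
  have hA := M.addr
  apply Reach.le
  · refine .for (fun k g => g.v .size = n ∧ g.arr = h.arr ∧ ∀ j < k, g.io (R j + 1) = j + 1) n _
      (by omega) ⟨by simp [hsize], rfl, by simp⟩ (fun k hk g hg hi => ⟨trivial, hg.1⟩)
      (fun k hk g hg hi => Reach.of_wp _ ?_) fun g hg hi => hg.2.2
    obtain ⟨h1, h2, h3⟩ := hg
    have := hR k hk
    simp only [Prog.wp, Expr.Ok, Expr.eval, Op.eval, hi, h2, hsrk k hk, true_and]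
    refine ⟨⟨by omega, by omega, by omega⟩, by omega, ⟨by omega, by omega⟩, hi, h1, h2,
      fun j hj => ?_⟩
    simp only [Store.setV, Store.setCell, Function.update_apply]
    rcases (Nat.lt_succ_iff.1 hj).eq_or_lt with rfl | hlt
    · simp
    · rw [if_neg fun he => hlt.ne (hinj j (by omega) k hk (by omega)), h3 j hlt]
  · simp only [Expr.cost, Prog.cost]
    omega

/-- The parameterized suffix array. -/
def paramSuffixArray (c₁ R : ℕ) : Prog := .seq (load c₁ R) <| .seq encode <| .seq sortLayers output

/-- The factor in the running time. -/
def timeFactor (R : ℕ) : ℕ := (R + 2) * (5000 + 4 * R) + 3000000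

theorem paramSuffixArray_spec {P : Finset ℕ} {x : List ℕ} {h : Store} {c₁ R : ℕ}
    (hP : ∀ a, a ∈ P ↔ a ≤ x.length ^ c₁) (hc₁ : 1 ≤ c₁) (hR : c₁ ≤ R)
    (hB : (x.length + 2) ^ R < M.B) (hn : M.n = x.length) (hL : 20 * (x.length + 1) ≤ M.L)
    (hsize : h.v .size = x.length) (hio : ∀ k < x.length, h.io (k + 1) = x.getD k 0)
    (hx : ∀ k < x.length, x.getD k 0 < (x.length + 2) ^ R) :
    Reach M (paramSuffixArray c₁ R)
      (timeFactor R * ((numParams P x + 1) * (x.length + 1))) h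
      fun g => IsPSA P x g.io := by
  have hPx : ∀ a ∈ x, a ∉ P → x.length < a := by
    intro a ha hna
    rw [hP, not_le] at hna
    exact (Nat.le_self_pow (by omega) _).trans_lt hna
  apply Reach.le
  · apply Reach.seq
    refine (load_spec hB hR hn hL hsize hio hx).mono le_rfl fun g₁ ⟨h1, h2, h3, h4⟩ => ?_
    apply Reach.seq
    refine (encode_spec hP hL h1 h2 h3 h4).mono le_rfl fun g₂ hg₂ => ?_
    apply Reach.seq
    refine (sortLayers_spec hPx hL hg₂).mono le_rfl fun g₃ hg₃ => ?_
    refine (output_spec hn (by omega) hg₃.size hg₃.srk (fun k hk => rankOf_lt hk)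
      fun j hj k hk he => length_eq_of_layer hj.le hk.le ((rankOf_inj hj hk).1 he)).mono le_rfl
      fun g hg => isPSA_of_layerRank hg₃.code hg
  · have h1 : timeFactor R * ((numParams P x + 1) * (x.length + 1)) =
      (R + 2) * ((5000 + 4 * R) * (x.length + 1)) +
      (R + 2) * ((5000 + 4 * R) * (x.length + 1)) * numParams P x +
      3000000 * ((numParams P x + 1) * (x.length + 1)) := by rw [timeFactor]; ring
    have h2 : 3000000 * ((numParams P x + 1) * (x.length + 1)) =
      (numParams P x + 1) * (2000100 * (x.length + 1)) + (x.length * (100 * (numParams P x + 3))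
        + 40 * (x.length + 1) + 20) + (999560 * x.length + 999840 +
          999800 * (numParams P x * x.length) + 999900 * numParams P x) := by ring
    rw [h1, h2]
    omega

end WordRAM

/-! ### The final constants -/

theorem two_pow_mul_le {b : ℕ} (hb : 2 ≤ b) (e : ℕ) : 2 ^ e * b ≤ b ^ (e + 1) := by
  rw [pow_succ]
  exact Nat.mul_le_mul_right _ (Nat.pow_le_pow_left hb e)

/-- Since `1000 < 2 ^ 19`, twenty additional factors `n + 2` in the word size absorb the constants
in the addresses. -/
theorem mul_lt_pow_twenty {b : ℕ} (hb : 2 ≤ b) : 1000 * b < b ^ 20 :=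
  lt_of_lt_of_le (Nat.mul_lt_mul_of_pos_right (by norm_num) (by omega)) (two_pow_mul_le hb 19)

open PString WordRAM in
theorem theorem1 (c₁ c₂ : ℕ) (hc₁ : 1 ≤ c₁) (hc₂ : 1 ≤ c₂) :
    -- a program and constants that depend on `c₁` and `c₂` only
    ∃ (prog : WordRAM.Cmd) (k C : ℕ), max c₁ c₂ ≤ k ∧
      ∀ (n : ℕ) (x : List ℕ), x.length = n →
        (∀ a ∈ x, a ∈ PString.paramAlphabet n c₁ ∪ PString.staticAlphabet n c₁ c₂) →
        -- every word size of at least `k * log₂ (n + 2)` bits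
        ∀ w : ℕ, (n + 2) ^ k ≤ 2 ^ w →
          -- memory of `C * (n + 1)` words, including input and output
          ∃ (t : ℕ) (s : WordRAM.State),
            WordRAM.Exec w (C * (n + 1)) prog (WordRAM.initial x) t s ∧
            t ≤ C * (n * max 1 (PString.numParams (PString.paramAlphabet n c₁) x) + 1) ∧
            PString.IsPSA (PString.paramAlphabet n c₁) x s.mem := by
  -- With this exponent `(n + 2) ^ R` exceeds all symbols of both alphabets.
  obtain ⟨R, hR⟩ : ∃ R, R = c₁ + c₂ := ⟨_, rfl⟩
  obtain ⟨K, hKR⟩ : ∃ K, K = timeFactor R := ⟨_, rfl⟩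
  have hK : 1000 ≤ K := by rw [hKR, timeFactor]; omega
  -- Compiled code expects `n` in register 1. The exponent `R + 20` pays for the symbols and for the
  -- addresses; the factor 3 in `3 * K + 1` comes from `(π + 1)(n + 1) ≤ 3 (n max(1, π) + 1)`, and
  -- the added 1 pays for the copying instruction.
  refine ⟨.seq (.move 1 0) (paramSuffixArray c₁ R).comp, R + 20, 3 * K + 1, by omega,
    fun n x hxn hx w hw => ?_⟩
  subst hxn
  have hpR : 1 ≤ (x.length + 2) ^ R := Nat.one_le_pow _ _ (by omega)
  obtain ⟨B, hB⟩ : ∃ B, B = (x.length + 2) ^ (R + 20) := ⟨_, rfl⟩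
  have hlt : 1000 * (x.length + 2) * (x.length + 2) ^ R < B := by
    rw [hB, add_comm R, pow_add]
    exact Nat.mul_lt_mul_of_pos_right (mul_lt_pow_twenty (by omega)) hpR
  have hmul : 1000 * (x.length + 2) < B := (Nat.le_mul_of_pos_right _ hpR).trans_lt hlt
  have hRB : (x.length + 2) ^ R < B := (Nat.le_mul_of_pos_left _ (by omega)).trans_lt hlt
  rw [← hB] at hw
  clear hB hlt
  have haddr : x.length + 33 + 32 * (20 * (x.length + 1)) ≤ B := by clear hK; omega
  have hspace : x.length + 1 + 32 * (20 * (x.length + 1)) ≤ (3 * K + 1) * (x.length + 1) :=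
    le_trans (show _ ≤ 641 * (x.length + 1) by ring_nf; rfl)
      (Nat.mul_le_mul_right _ (by linarith))
  let M : Machine :=
    { w := w
      S := (3 * K + 1) * (x.length + 1)
      n := x.length
      L := 20 * (x.length + 1)
      B := B
      space := hspace
      addr := haddr
      word := hw }
  let h : Store :=
    { v := fun r => if r = .size then x.length else 0
      arr := fun _ _ => 0
      io := (initial x).mem }
  have hrep : Rep x.length h ((initial x).setReg 1 ((initial x).reg 0)) := by
    refine ⟨by simp [State.setReg, initial], fun r => ?_, fun i _ => rfl, fun a i => ?_⟩
    · have h1 : 2 * r.idx ≠ 1 := by omega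
      -- The variable `size` has index 0, so it is register 0, which holds `n` from the start.
      have h2 : 2 * r.idx = 0 ↔ r = .size := by
        constructor
        · exact fun h0 => Var.idx_inj (show r.idx = Var.size.idx by
            rw [show Var.size.idx = 0 from rfl]; omega)
        · rintro rfl; rfl
      simp [State.setReg, initial, h, h1, h2]
    · simp only [State.setReg, initial, h]
      rw [if_neg (by omega), List.getD_eq_default _ _ (by omega)]
  have hxR : ∀ k < x.length, x.getD k 0 < (x.length + 2) ^ R := by
    intro k hk
    have h1 := hx (x.getD k 0) (by rw [List.getD_eq_getElem _ _ hk]; exact List.getElem_mem hk)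
    have h2 : ∀ c, 1 ≤ c → c ≤ R → x.length ^ c < (x.length + 2) ^ R := fun c hc hcR =>
      (Nat.pow_lt_pow_left (by omega) (by omega)).trans_le (Nat.pow_le_pow_right (by omega) hcR)
    rw [Finset.mem_union, paramAlphabet, staticAlphabet, Finset.mem_Icc, Finset.mem_Icc] at h1
    rcases h1 with h1 | h1
    · exact h1.2.trans_lt (h2 c₁ hc₁ (by omega))
    · exact h1.2.trans_lt (h2 c₂ hc₂ (by omega))
  obtain ⟨t, s, hex, ht, g, hr, hA⟩ :=
    paramSuffixArray_spec (M := M) (P := paramAlphabet x.length c₁) (x := x) (h := h) (c₁ := c₁)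
      (R := R) (by simp [paramAlphabet]) hc₁ (by omega) hRB
      rfl le_rfl (by simp [h]) (fun k hk => by simp [h, initial]) hxR _ hrep
  rw [← hKR] at ht
  refine ⟨_, s, .seq (.move _ _ _) hex, ?_, ?_⟩
  · have hπ := numParams_le (paramAlphabet x.length c₁) x
    generalize numParams (paramAlphabet x.length c₁) x = π at *
    -- Here `π ≤ n` is needed, for the summand `π`.
    have h1 : (π + 1) * (x.length + 1) ≤ 3 * (x.length * max 1 π + 1) := by
      have h2 : x.length * π ≤ x.length * max 1 π := Nat.mul_le_mul_left _ (le_max_right _ _)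
      have h3 : x.length ≤ x.length * max 1 π := Nat.le_mul_of_pos_right _ (by omega)
      have h4 : (π + 1) * (x.length + 1) = x.length * π + π + x.length + 1 := by ring
      omega
    have h5 := Nat.mul_le_mul_left K h1
    have h6 : (3 * K + 1) * (x.length * max 1 π + 1) =
      K * (3 * (x.length * max 1 π + 1)) + (x.length * max 1 π + 1) := by ring
    omega
  · intro i hi j
    -- The suffix array is read only in cells `1, …, n`, where memory and the abstract output cells
    -- agree.
    rw [hr.io i (Finset.mem_Icc.1 hi).2]
    exact hA i hi j
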